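/- **Lemma 4.9 (monodromy).** *The fibration.* Let $x,y,z$ be nonzero complex coordinates, $v_0=xyz$, $r_x=|x|$, $r_y=|y|$, $r_z=|z|$, $0<T\ll 1$, and let $\Gamma_B\cong\mathbb Z^2$ act by $(x,y,z)\mapsto(T^3v_0x,\,y,\,T^{-3}v_0^{-1}z)$ and $(x,y,z)\mapsto(x,\,T^3v_0y,\,T^{-3}v_0^{-1}z)$; away from the zero fibre, $Y$ is the quotient. Put $(x''',y''',z''')=(Tv_0x^{-1},Tv_0y^{-1},T^{-2}z^{-1})$. Fix $l\gg 0$ and consider the fibres with $|v_0|=T^l$. The fundamental parallelogram of $T_B$ is given on these fibres by $T^{l+2}<r_x,r_y\le T^{-1}$. *The symplectic form.* For coordinate norms $a,b,c$ put $g_{bc}=\log\,(1+|Tb|^2)(1+|Tc|^2)(1+|T^2bc|^2)$ and $\varphi_a=\log\frac{1+|Ta|^2}{1+|T^2bc|^2}$. Let $p>16$, and let $\alpha_3,\alpha_4,\alpha_5,\alpha_6$ be smooth increasing functions on $\mathbb R$ such that - $\alpha_3$ goes from $2/3$ to $1$ and $\alpha_5$ from $0$ to $1$, both constant outside $[\,T^{l/2+2},\,T^{l/2-2l/p+2}]$;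 - $\alpha_4$ is odd, $\alpha_4(s)=0$ for $|s|\le T^{3l/4+3/2}$, and $\alpha_4(s)=1/2$ for $s\ge\theta_*:=T^{3l/4-2l/p+2}$; - $\alpha_6$ goes from $0$ to $1$ and is constant outside $[-(\tfrac l8-\tfrac lp),\,-(\tfrac l8-\tfrac{2l}p)]$; - the first and second derivatives of $\alpha_3,\alpha_4,\alpha_5$ with respect to $\log_T s$, and of $\alpha_6$ with respect to $s$, are at most $C/l$ and $C/l^2$ in absolute value. If $a\ge b\ge c$ are the norms of the three coordinates at a vertex in decreasing order, let $\alpha_6=\alpha_6(\log_Ta-\log_Tb)$, $\theta=\varphi_b-\varphi_c$, $d=\varphi_a-\tfrac12(\varphi_b+\varphi_c)+\tfrac32\alpha_6\varphi_b$, and $$F=g_{bc}-\alpha_6\varphi_b+\alpha_3(d)\,d+\alpha_4(\theta)\,\alpha_5(d)\,(\varphi_b-\varphi_c-\alpha_6\varphi_b).$$ The form $\omega$ is $\frac{i}{2\pi}\partial\bar\partial(F+\kappa|v_0|^2)$, with $F$ evaluated at $(r_x,r_y,r_z)$ in the half $r_z\le T^{-1}$ of the parallelogram and at $(r_{x'''},r_{y'''},r_{z'''})$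 in the half $r_z>T^{-1}$, extended $\Gamma_B$-invariantly. *The four corners.* Say that the inverse of one of the three coordinate norms *dominates by the factor $K$* if it is at least $K$ times each of the other two inverses. Say that it *dominates completely* if it is the largest of the three inverses and moreover $d\ge T^{l/2-2l/p+2}$ and $\theta\ge\theta_*$ (so that $F=g_{ab}$ there). A point of the parallelogram is in - the upper right corner if $r_z\le T^{-1}$ and $r_z^{-1}$ dominates among $r_x^{-1},r_y^{-1},r_z^{-1}$; - the right corner if $r_z\le T^{-1}$ and $r_y^{-1}$ dominates, or $r_z>T^{-1}$ and $r_{x'''}^{-1}$ dominates among $r_{x'''}^{-1},r_{y'''}^{-1},r_{z'''}^{-1}$; - the left corner if $r_z\le T^{-1}$ and $r_x^{-1}$ dominates, or $r_z>T^{-1}$ and $r_{y'''}^{-1}$ dominates; - the lower left corner if $r_z>T^{-1}$ and $r_{z'''}^{-1}$ dominates. *Claim.* For all $p>16$ and $C$ there are $T_0>0$, $l_0$ and a function $K(\varepsilon)$ such that for all $0<T<T_0$, $l\ge l_0$, all $\kappa\in\mathbb R$ and all $\alpha_3,\dots,\alpha_6$ as above there are real functions $f_1,f_2$ of $(r_x,r_y)$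 with the following properties. 1. For every point over the parallelogram with $|v_0|=T^l$, parallel transport for the symplectic connection $(\ker dv_0)^{\omega}$ around the loop $e^{it}v_0$, $0\le t\le2\pi$, is defined, preserves $r_x,r_y,r_z$, and changes the continuously followed angles $(\arg x,\arg y)$ by exactly $2\pi(f_1,f_2)$. 2. Where the respective inverse norm dominates completely, $(f_1,f_2)$ is constant: it equals $(0,0)$ in the upper right corner, $(0,1)$ in the right corner, $(1,0)$ in the left corner and $(1,1)$ in the lower left corner. 3. For every $\varepsilon>0$, where the respective inverse norm dominates by the factor $K(\varepsilon)$, $f_1$ and $f_2$ differ from these values by at most $\varepsilon$. -/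

import Mathlib

open scoped ContDiff

noncomputable section

namespace GenusTwoMirror

/-! ### The complex manifold: coordinates, superpotential, deck group, charts -/

/-- Coordinates `(x, y, z) = (P 0, P 1, P 2)`.  The part of the covering space of the total space
lying over nonzero values of the superpotential is the set where all three are nonzero. -/
abbrev Pt := Fin 3 → ℂ

/-- The superpotential `v₀ = x y z`. -/
def v0 (P : Pt) : ℂ := P 0 * P 1 * P 2

/-- The action of the lattice `Γ_B ≅ ℤ²`, written in the basis `-γ', -γ''`, where
`-γ'  : (x, y, z) ↦ (T³ v₀ x, y, T⁻³ v₀⁻¹ z)` and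
`-γ'' : (x, y, z) ↦ (x, T³ v₀ y, T⁻³ v₀⁻¹ z)`.  It preserves `v₀`, and the total space (away from
the zero fibre) is the quotient by it. -/
def deck (T : ℝ) (m n : ℤ) (P : Pt) : Pt :=
  ![((T : ℂ) ^ 3 * v0 P) ^ m * P 0, ((T : ℂ) ^ 3 * v0 P) ^ n * P 1,
    ((T : ℂ) ^ 3 * v0 P) ^ (-(m + n)) * P 2]

/-- The coordinates `(x''', y''', z''') = (T v₀ x⁻¹, T v₀ y⁻¹, T⁻² z⁻¹)` at the other end of the
`z`-axis.  Every vertex of the tiling is a `Γ_B`-translate of the vertex of `(x, y, z)` or of the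
vertex of `(x''', y''', z''')`. -/
def tripleChart (T : ℝ) (P : Pt) : Pt :=
  ![(T : ℂ) * v0 P * (P 0)⁻¹, (T : ℂ) * v0 P * (P 1)⁻¹, ((T : ℂ) ^ 2)⁻¹ * (P 2)⁻¹]

/-- The norms of the coordinates. -/
def norms (P : Pt) : Fin 3 → ℝ := fun j => ‖P j‖

/-! ### The Kähler potential near a vertex -/

/-- `φ_a = log ((1 + |T a|²) / (1 + |T² b c|²))` for coordinates of norms `a`, `b`, `c`. -/
def phi (T a b c : ℝ) : ℝ := Real.log ((1 + (T * a) ^ 2) / (1 + (T ^ 2 * b * c) ^ 2))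

/-- The toric potential `g_{bc} = log (1 + |T b|²)(1 + |T c|²)(1 + |T² b c|²)` of `ℂP²` blown up at
three points, for coordinates of norms `b`, `c`. -/
def toricPotential (T b c : ℝ) : ℝ :=
  Real.log ((1 + (T * b) ^ 2) * (1 + (T * c) ^ 2) * (1 + (T ^ 2 * b * c) ^ 2))

/-- The derivative of `α` with respect to `log_T s`. -/
def derivLogT (T : ℝ) (α : ℝ → ℝ) (s : ℝ) : ℝ := Real.log T * (s * deriv α s)

/-- The value of the radial variable `d` at which the cut-offs `α₃`, `α₅` start to vary. -/
def radialStart (T l : ℝ) : ℝ := T ^ (l / 2 + 2)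

/-- The value of the radial variable `d` at which the cut-offs `α₃`, `α₅` have become `1`. -/
def radialEnd (T l p : ℝ) : ℝ := T ^ (l / 2 - 2 * l / p + 2)

/-- The value of the angular variable `θ` below which `α₄` vanishes (the sliver around `θ = 0`). -/
def angularStart (T l : ℝ) : ℝ := T ^ (3 * l / 4 + 3 / 2)

/-- The value of the angular variable `θ` from which on `α₄ = 1/2`. -/
def angularEnd (T l p : ℝ) : ℝ := T ^ (3 * l / 4 - 2 * l / p + 2)

/-- The bump functions `α₃, α₄, α₅, α₆` used to interpolate, on the circle of fibres
`|v₀| = T ^ l`, between the toric potentials of the three tiles meeting in a vertex.  They are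
smooth and increasing and constant beyond the ends of the interval on which they interpolate; `α₄`
is odd; they vary slowly with respect to `log_T` of their argument (first derivative of order
`1 / l`, second derivative of order `1 / l²`, with implied constant `C`).  The argument of `α₆` is
itself a `log_T`. -/
structure BumpFunctions (T l p C : ℝ) where
  α₃ : ℝ → ℝ
  α₄ : ℝ → ℝ
  α₅ : ℝ → ℝ
  α₆ : ℝ → ℝ
  smooth₃ : ContDiff ℝ ∞ α₃
  smooth₄ : ContDiff ℝ ∞ α₄
  smooth₅ : ContDiff ℝ ∞ α₅
  smooth₆ : ContDiff ℝ ∞ α₆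
  mono₃ : Monotone α₃
  mono₄ : Monotone α₄
  mono₅ : Monotone α₅
  mono₆ : Monotone α₆
  start₃ : ∀ s ≤ radialStart T l, α₃ s = 2 / 3
  end₃ : ∀ s ≥ radialEnd T l p, α₃ s = 1
  odd₄ : ∀ s, α₄ (-s) = -α₄ s
  start₄ : ∀ s, |s| ≤ angularStart T l → α₄ s = 0
  end₄ : ∀ s ≥ angularEnd T l p, α₄ s = 1 / 2
  start₅ : ∀ s ≤ radialStart T l, α₅ s = 0
  end₅ : ∀ s ≥ radialEnd T l p, α₅ s = 1
  start₆ : ∀ s ≤ -(l / 8 - l / p), α₆ s = 0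
  end₆ : ∀ s ≥ -(l / 8 - 2 * l / p), α₆ s = 1
  slow₃ : ∀ s, |derivLogT T α₃ s| ≤ C / l ∧ |derivLogT T (derivLogT T α₃) s| ≤ C / l ^ 2
  slow₄ : ∀ s, |derivLogT T α₄ s| ≤ C / l ∧ |derivLogT T (derivLogT T α₄) s| ≤ C / l ^ 2
  slow₅ : ∀ s, |derivLogT T α₅ s| ≤ C / l ∧ |derivLogT T (derivLogT T α₅) s| ≤ C / l ^ 2
  slow₆ : ∀ s, |deriv α₆ s| ≤ C / l ∧ |deriv (deriv α₆) s| ≤ C / l ^ 2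

/-- Largest, middle and smallest of three numbers. -/
def hi (r : Fin 3 → ℝ) : ℝ := max (r 0) (max (r 1) (r 2))
def mid (r : Fin 3 → ℝ) : ℝ := max (min (r 0) (r 1)) (min (max (r 0) (r 1)) (r 2))
def lo (r : Fin 3 → ℝ) : ℝ := min (r 0) (min (r 1) (r 2))

/-- The angular variable `θ = φ_b - φ_c`, where `a ≥ b ≥ c` are the three norms. -/
def angularVar (T : ℝ) (r : Fin 3 → ℝ) : ℝ :=
  phi T (mid r) (hi r) (lo r) - phi T (lo r) (hi r) (mid r)

section Potential

variable {T l p C : ℝ} (B : BumpFunctions T l p C)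

/-- The bump function `α₆` of the angular direction `log_T b - log_T a`, where `a ≥ b ≥ c` are the
three norms; it is `0` for `b ≪ a` and `1` for `b` close to `a`. -/
def turning (r : Fin 3 → ℝ) : ℝ := B.α₆ (Real.logb T (hi r) - Real.logb T (mid r))

/-- The radial variable `d = φ_a - (φ_b + φ_c) / 2 + (3 / 2) α₆ φ_b`, where `a ≥ b ≥ c` are the
three norms. -/
def radialVar (r : Fin 3 → ℝ) : ℝ :=
  phi T (hi r) (mid r) (lo r)
    - (phi T (mid r) (hi r) (lo r) + phi T (lo r) (hi r) (mid r)) / 2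
    + 3 / 2 * turning B r * phi T (mid r) (hi r) (lo r)

/-- The Kähler potential near a vertex as a function of the norms `r` of the three coordinates at
the vertex.  With `a ≥ b ≥ c` the norms in decreasing order it is
`F = g_{bc} - α₆ φ_b + α₃(d) d + α₄(θ) α₅(d) (φ_b - φ_c - α₆ φ_b)`.
All regions are covered by this formula: near the vertex (`α₃ = 2/3`, `α₅ = 0`) it is
`(g_{xy} + g_{xz} + g_{yz}) / 3`; in the interior of a tile (`α₃ = α₅ = 1`, `α₄ = 1/2`) it is
`g_{ab}`; for `α₆ = 0` it is `g_{bc} + α₃(d) d + α₄(θ) α₅(d) θ`; along the axes, away from the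
vertex (`α₃ = α₅ = 1`, `α₆ = 0`) it is `(g_{ab} + g_{ac}) / 2 + α₄(θ) θ`; and for `α₄ = 1/2` it
interpolates across the middle of a tile. -/
def vertexPotential (r : Fin 3 → ℝ) : ℝ :=
  toricPotential T (mid r) (lo r)
    - turning B r * phi T (mid r) (hi r) (lo r)
    + B.α₃ (radialVar B r) * radialVar B r
    + B.α₄ (angularVar T r) * B.α₅ (radialVar B r) *
      (angularVar T r - turning B r * phi T (mid r) (hi r) (lo r))

/-! ### The symplectic form and its connection -/

/-- The second derivative `D²F(P)(v, w)` of a real function on `ℂ³ = ℝ⁶`. -/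
def hess (F : Pt → ℝ) (P v w : Pt) : ℝ := fderiv ℝ (fun Q => fderiv ℝ F Q w) P v

/-- The real two-form `(i / 2π) ∂∂̄F = -(1 / 4π) d(dF ∘ J)`, where `J` is multiplication by `i`;
its value on `v`, `w` is `(D²F(iv, w) - D²F(v, iw)) / 4π`. -/
def kahlerForm (F : Pt → ℝ) (P v w : Pt) : ℝ :=
  (hess F P (Complex.I • v) w - hess F P v (Complex.I • w)) / (4 * Real.pi)

/-- The number of lattice steps that bring a coordinate of norm `r` into
`T ^ (l + 2) < r ≤ T⁻¹` (on the circle `|v₀| = T ^ l` a step multiplies `r` by `T ^ (l + 3)`). -/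
def cell (T l r : ℝ) : ℤ := -⌊(Real.logb T r + 1) / (l + 3)⌋

/-- Vertex coordinates that may be used near `P`: translate `P` into the fundamental parallelogram
and use there `(x, y, z)` where `|z| ≤ T⁻¹` and `(x''', y''', z''')` where `|z| > T⁻¹`.  They are
functions of a variable point `Q` near `P`. -/
def localChart (T l : ℝ) (P Q : Pt) : Pt :=
  if ‖deck T (cell T l ‖P 0‖) (cell T l ‖P 1‖) P 2‖ ≤ T⁻¹ then
    deck T (cell T l ‖P 0‖) (cell T l ‖P 1‖) Q
  else
    tripleChart T (deck T (cell T l ‖P 0‖) (cell T l ‖P 1‖) Q)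

/-- The symplectic form at `P`, on the covering space: its local Kähler potential is the vertex
potential in suitable vertex coordinates plus the multiple `κ |v₀|²` pulled back from the base.  By
construction it is the lift of a form on the quotient by `Γ_B`. -/
def symplecticForm (κ : ℝ) (P v w : Pt) : ℝ :=
  kahlerForm (fun Q => vertexPotential B (norms (localChart T l P Q)) + κ * ‖v0 Q‖ ^ 2) P v w

/-- The symplectic horizontal distribution: the `ω`-complement of the tangent spaces of the fibres
of `v₀`. -/
def IsHorizontal (κ : ℝ) (P v : Pt) : Prop :=
  ∀ w : Pt, fderiv ℂ v0 P w = 0 → symplecticForm B κ P v w = 0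

/-- `γ` is the horizontal lift, starting at `P`, of the loop `t ↦ e^{it} v₀(P)`, `0 ≤ t ≤ 2π`, that
goes once counterclockwise around the origin of the base. -/
structure IsHorizontalLift (κ : ℝ) (P : Pt) (γ : ℝ → Pt) : Prop where
  start : γ 0 = P
  covers : ∀ t ∈ Set.Icc 0 (2 * Real.pi), v0 (γ t) = Complex.exp (t * Complex.I) * v0 P
  horizontal : ∀ t ∈ Set.Icc 0 (2 * Real.pi), ∃ v : Pt,
    HasDerivWithinAt γ v (Set.Icc 0 (2 * Real.pi)) t ∧ IsHorizontal B κ (γ t) v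

/-- Parallel transport around the loop is defined at `P`, fixes the norms of all coordinates, and
shifts the continuously followed angles `θ₁ = arg x`, `θ₂ = arg y` by `2π f₁`, `2π f₂` (by `f₁`,
`f₂` when angles are measured in full turns). -/
def MonodromyShiftsBy (κ : ℝ) (P : Pt) (f₁ f₂ : ℝ) : Prop :=
  (∃ γ, IsHorizontalLift B κ P γ) ∧
  ∀ γ, IsHorizontalLift B κ P γ →
    (∀ t ∈ Set.Icc 0 (2 * Real.pi), ∀ j, ‖γ t j‖ = ‖P j‖) ∧
    ∀ θ₁ θ₂ : ℝ → ℝ,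
      ContinuousOn θ₁ (Set.Icc 0 (2 * Real.pi)) → ContinuousOn θ₂ (Set.Icc 0 (2 * Real.pi)) →
      (∀ t ∈ Set.Icc 0 (2 * Real.pi), γ t 0 = ‖γ t 0‖ * Complex.exp (θ₁ t * Complex.I)) →
      (∀ t ∈ Set.Icc 0 (2 * Real.pi), γ t 1 = ‖γ t 1‖ * Complex.exp (θ₂ t * Complex.I)) →
      θ₁ (2 * Real.pi) - θ₁ 0 = 2 * Real.pi * f₁ ∧
      θ₂ (2 * Real.pi) - θ₂ 0 = 2 * Real.pi * f₂

/-! ### The fundamental parallelogram and its corners -/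

/-- The points of the circle of fibres `|v₀| = T ^ l` over the fundamental parallelogram of `T_B`,
whose edges are `|x| = T⁻¹`, `|y| = T⁻¹` and their lattice translates. -/
def parallelogram (T l : ℝ) : Set Pt :=
  {P | ‖v0 P‖ = T ^ l ∧ T ^ (l + 2) < ‖P 0‖ ∧ ‖P 0‖ ≤ T⁻¹ ∧ T ^ (l + 2) < ‖P 1‖ ∧ ‖P 1‖ ≤ T⁻¹}

/-- Vertex coordinates of norms `r` lie in the part of a tile where the potential is the toric
potential in the two coordinates other than the `s`-th: the `s`-th is the smallest, and the radial
and angular variables are beyond the range where the bump functions vary. -/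
def InTile (r : Fin 3 → ℝ) (s : Fin 3) : Prop :=
  (∀ j, r s ≤ r j) ∧ radialEnd T l p ≤ radialVar B r ∧ angularEnd T l p ≤ angularVar T r

end Potential

/-- `r_s⁻¹` exceeds the inverses of the other two norms by at least the factor `K`. -/
def Dominates (K : ℝ) (r : Fin 3 → ℝ) (s : Fin 3) : Prop := ∀ j, j ≠ s → K * (r j)⁻¹ ≤ (r s)⁻¹

/-- The four corners of the fundamental parallelogram. -/
inductive Corner
  | upperRight
  | right
  | left
  | lowerLeft

/-- The values of `(f₁, f₂)`. -/
def Corner.shift : Corner → ℝ × ℝ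
  | .upperRight => (0, 0)
  | .right => (0, 1)
  | .left => (1, 0)
  | .lowerLeft => (1, 1)

/-- `P` lies in the given corner, where `S r s` says that the inverse of the `s`-th coordinate norm
dominates among `r`.  In the half `|z| ≤ T⁻¹` of the parallelogram the corners are distinguished by
which of `r_z⁻¹`, `r_y⁻¹`, `r_x⁻¹` dominates; in the half `|z| > T⁻¹` by which of `r_{z'''}⁻¹`
(opposite corner), `r_{x'''}⁻¹` (right), `r_{y'''}⁻¹` (left) does. -/
def Corner.Contains (T : ℝ) (S : (Fin 3 → ℝ) → Fin 3 → Prop) (P : Pt) : Corner → Prop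
  | .upperRight => ‖P 2‖ ≤ T⁻¹ ∧ S (norms P) 2
  | .right =>
      (‖P 2‖ ≤ T⁻¹ ∧ S (norms P) 1) ∨ (T⁻¹ < ‖P 2‖ ∧ S (norms (tripleChart T P)) 0)
  | .left =>
      (‖P 2‖ ≤ T⁻¹ ∧ S (norms P) 0) ∨ (T⁻¹ < ‖P 2‖ ∧ S (norms (tripleChart T P)) 1)
  | .lowerLeft => T⁻¹ < ‖P 2‖ ∧ S (norms (tripleChart T P)) 2

end GenusTwoMirror

end

/-! Where all coordinates are nonzero the form is invariant under the torus, so it is governed by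
the Hessian `H` of the potential in the variables `y_j = log ‖P_j‖`. In terms of the logarithmic
velocities `v_j / P_j`, the form pairs real parts with imaginary parts through `H`
(`kahlerForm_comp_logNorms`). A vector is tangent to the fibre iff its logarithmic velocities sum to
zero. Hence it is horizontal iff the real and imaginary parts of its logarithmic velocity are both
`H`-orthogonal to the plane `w 0 + w 1 + w 2 = 0` (`isHorizontal_iff`). The term `κ |v₀|²` depends
on the sum of the `y_j` only and drops out.

Once `H` is positive on that plane, there is exactly one real vector `u` of sum `1` that is
orthogonal to the plane. The lift of the rotation of the base has logarithmic velocity `i u`, so it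
preserves all norms. As `u` depends on the norms alone, the lift is `P_j exp(i u_j t)`, and `(f₁,
f₂) = (u 0, u 1)` (`IsHorizontalLift.eq_rotate`, `IsRotation.monodromyShiftsBy`). The charts act on
`y` by affine maps that are `1` or `-1` on the plane, so everything reduces to one vertex.

For the corners let `s` be the smallest coordinate at the vertex and `t = u - e_s`. Then `t` lies in
the plane and `H(t, t) = -H(e_s, t)`. If `s` dominates completely, the potential does not involve
the `s`-th coordinate, the right side vanishes and `t = 0`. In general let `ta ≥ tb ≥ tc` be the
squares of `T` times the norms. The left side is at least `(ta t_i² + tb t_j²) / 4`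
(`SortedPoint.le_secondDeriv`) and the right side at most `101 tc (|t_i| + |t_j|)` in absolute value
(`SortedPoint.abs_secondDeriv_last_le`). So `t` is of order `tc / tb`, which is at most `1 / K²`.

Two things remain about the potential. The formula depends on the order of the norms, so the
formulas for different orders must agree near ties (`SortedPoint.vertexPotential_eventuallyEq`). And
the Hessian must be estimated: with constant bump functions it is an explicit form, diagonal on the
plane (`SortedPoint.mainCurv_ge`); the derivatives of the bump functions contribute only a small
multiple, of order `C / (l |log T|)`, of the same weights (`JetBounds.abs_mixed_sub_main_le`). -/

open Filter Topology

namespace GenusTwoMirror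

/-! ### Second order jets -/

section Jets

variable {E : Type*} [NormedAddCommGroup E] [NormedSpace ℝ E]

/-- `f` is differentiable near `x` and its derivative is differentiable at `x`. -/
def TwiceDiffAt (f : E → ℝ) (x : E) : Prop :=
  (∀ᶠ y in 𝓝 x, DifferentiableAt ℝ f y) ∧ DifferentiableAt ℝ (fderiv ℝ f) x

/-- The second derivative as a bilinear form. -/
noncomputable abbrev secondDeriv (f : E → ℝ) (x : E) : E →L[ℝ] E →L[ℝ] ℝ :=
  fderiv ℝ (fderiv ℝ f) x

/-- `f` is twice differentiable at `x`; its value, its derivatives along `v` and `w` and its mixed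
second derivative along `v`, `w` are `a`, `a₁`, `a₂`, `a₁₂`. -/
structure HasJet (f : E → ℝ) (x v w : E) (a a₁ a₂ a₁₂ : ℝ) : Prop where
  twice : TwiceDiffAt f x
  val : f x = a
  fst : fderiv ℝ f x v = a₁
  snd : fderiv ℝ f x w = a₂
  mixed : secondDeriv f x v w = a₁₂

theorem HasJet.of_hasFDerivAt {f : E → ℝ} {x v w : E} {a a₁ a₂ a₁₂ : ℝ} {f' : E → E →L[ℝ] ℝ}
    {f'' : E →L[ℝ] E →L[ℝ] ℝ} (h : ∀ᶠ y in 𝓝 x, HasFDerivAt f (f' y) y)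
    (h' : HasFDerivAt f' f'' x) (h0 : f x = a) (h1 : f' x v = a₁) (h2 : f' x w = a₂)
    (h12 : f'' v w = a₁₂) : HasJet f x v w a a₁ a₂ a₁₂ := by
  have e : fderiv ℝ f =ᶠ[𝓝 x] f' := h.mono fun y hy => hy.fderiv
  have h3 : HasFDerivAt (fderiv ℝ f) f'' x := h'.congr_of_eventuallyEq e
  refine ⟨⟨h.mono fun y hy => hy.differentiableAt, h3.differentiableAt⟩, h0, ?_, ?_, ?_⟩
  · rw [e.self_of_nhds, h1]
  · rw [e.self_of_nhds, h2]
  · rw [secondDeriv, h3.fderiv, h12]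

theorem TwiceDiffAt.eventually {f : E → ℝ} {x : E} (h : TwiceDiffAt f x) :
    ∀ᶠ y in 𝓝 x, HasFDerivAt f (fderiv ℝ f y) y :=
  h.1.mono fun _ hy => hy.hasFDerivAt

theorem TwiceDiffAt.hasFDerivAt {f : E → ℝ} {x : E} (h : TwiceDiffAt f x) :
    HasFDerivAt f (fderiv ℝ f x) x :=
  h.eventually.self_of_nhds

theorem HasJet.continuousAt {f : E → ℝ} {x v w : E} {a a₁ a₂ a₁₂ : ℝ}
    (h : HasJet f x v w a a₁ a₂ a₁₂) : ContinuousAt f x :=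
  h.twice.hasFDerivAt.continuousAt

theorem HasJet.congr {f g : E → ℝ} {x v w : E} {a a₁ a₂ a₁₂ : ℝ}
    (h : HasJet f x v w a a₁ a₂ a₁₂) (e : g =ᶠ[𝓝 x] f) : HasJet g x v w a a₁ a₂ a₁₂ := by
  refine .of_hasFDerivAt (f' := fderiv ℝ f) (f'' := secondDeriv f x) ?_ h.twice.2.hasFDerivAt
    (e.self_of_nhds.trans h.val) h.fst h.snd h.mixed
  filter_upwards [e.eventually_nhds, h.twice.eventually] with y hy hf
  exact hf.congr_of_eventuallyEq hy

theorem HasJet.const (c : ℝ) (x v w : E) : HasJet (fun _ : E => c) x v w c 0 0 0 :=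
  .of_hasFDerivAt (f' := fun _ => 0) (f'' := 0) (.of_forall fun y => hasFDerivAt_const c y)
    (hasFDerivAt_const 0 x) rfl rfl rfl rfl

theorem HasJet.affine (L : E →L[ℝ] ℝ) (c : ℝ) (x v w : E) :
    HasJet (fun y => L y + c) x v w (L x + c) (L v) (L w) 0 :=
  .of_hasFDerivAt (f' := fun _ => L) (f'' := 0)
    (.of_forall fun _ => L.hasFDerivAt.add_const c) (hasFDerivAt_const L x) rfl rfl rfl rfl

theorem HasJet.add {f g : E → ℝ} {x v w : E} {a a₁ a₂ a₁₂ b b₁ b₂ b₁₂ : ℝ}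
    (hf : HasJet f x v w a a₁ a₂ a₁₂) (hg : HasJet g x v w b b₁ b₂ b₁₂) :
    HasJet (fun y => f y + g y) x v w (a + b) (a₁ + b₁) (a₂ + b₂) (a₁₂ + b₁₂) := by
  refine .of_hasFDerivAt (f' := fun y => fderiv ℝ f y + fderiv ℝ g y)
    (f'' := secondDeriv f x + secondDeriv g x) ?_
    (hf.twice.2.hasFDerivAt.add hg.twice.2.hasFDerivAt) ?_ ?_ ?_ ?_
  · filter_upwards [hf.twice.eventually, hg.twice.eventually] with y h1 h2 using h1.add h2
  · rw [hf.val, hg.val]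
  · simp [hf.fst, hg.fst]
  · simp [hf.snd, hg.snd]
  · simp only [_root_.add_apply, hf.mixed, hg.mixed]

theorem HasJet.mul {f g : E → ℝ} {x v w : E} {a a₁ a₂ a₁₂ b b₁ b₂ b₁₂ : ℝ}
    (hf : HasJet f x v w a a₁ a₂ a₁₂) (hg : HasJet g x v w b b₁ b₂ b₁₂) :
    HasJet (fun y => f y * g y) x v w (a * b) (a₁ * b + a * b₁) (a₂ * b + a * b₂)
      (a₁₂ * b + a₁ * b₂ + a₂ * b₁ + a * b₁₂) := by
  refine .of_hasFDerivAt (f' := fun y => f y • fderiv ℝ g y + g y • fderiv ℝ f y) ?_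
    ((hf.twice.hasFDerivAt.smul hg.twice.2.hasFDerivAt).add
      (hg.twice.hasFDerivAt.smul hf.twice.2.hasFDerivAt)) ?_ ?_ ?_ ?_
  · filter_upwards [hf.twice.eventually, hg.twice.eventually] with y h1 h2 using h1.mul h2
  · rw [hf.val, hg.val]
  · simp [hf.fst, hg.fst, hf.val, hg.val]; ring
  · simp [hf.snd, hg.snd, hf.val, hg.val]; ring
  · have h1 := hf.mixed
    have h2 := hg.mixed
    simp only [secondDeriv] at h1 h2
    simp [hf.fst, hg.fst, hf.snd, hg.snd, hf.val, hg.val, h1, h2]; ring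

theorem HasJet.comp {f : E → ℝ} {g g' : ℝ → ℝ} {g'' : ℝ} {x v w : E} {a a₁ a₂ a₁₂ : ℝ}
    (hf : HasJet f x v w a a₁ a₂ a₁₂) (hg : ∀ᶠ s in 𝓝 a, HasDerivAt g (g' s) s)
    (hg' : HasDerivAt g' g'' a) :
    HasJet (fun y => g (f y)) x v w (g a) (g' a * a₁) (g' a * a₂)
      (g'' * a₁ * a₂ + g' a * a₁₂) := by
  have hv := hf.val
  subst hv
  refine .of_hasFDerivAt (f' := fun y => g' (f y) • fderiv ℝ f y) ?_
    ((hg'.comp_hasFDerivAt x hf.twice.hasFDerivAt).smul hf.twice.2.hasFDerivAt) rfl ?_ ?_ ?_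
  · filter_upwards [hf.twice.eventually, hf.continuousAt.eventually hg] with y h1 h2
    exact h2.comp_hasFDerivAt y h1
  · simp [hf.fst]
  · simp [hf.snd]
  · have h1 := hf.mixed
    simp only [secondDeriv] at h1
    simp [hf.fst, hf.snd, h1]; ring

theorem HasJet.congr_coeff {f : E → ℝ} {x v w : E} {a a₁ a₂ a₁₂ b b₁ b₂ b₁₂ : ℝ}
    (h : HasJet f x v w a a₁ a₂ a₁₂) (h0 : a = b) (h1 : a₁ = b₁) (h2 : a₂ = b₂)
    (h12 : a₁₂ = b₁₂) : HasJet f x v w b b₁ b₂ b₁₂ := by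
  subst h0 h1 h2 h12; exact h

theorem HasJet.const_mul {f : E → ℝ} {x v w : E} {a a₁ a₂ a₁₂ : ℝ} (c : ℝ)
    (hf : HasJet f x v w a a₁ a₂ a₁₂) :
    HasJet (fun y => c * f y) x v w (c * a) (c * a₁) (c * a₂) (c * a₁₂) :=
  ((HasJet.const c x v w).mul hf).congr_coeff rfl (by ring) (by ring) (by ring)

theorem HasJet.sub {f g : E → ℝ} {x v w : E} {a a₁ a₂ a₁₂ b b₁ b₂ b₁₂ : ℝ}
    (hf : HasJet f x v w a a₁ a₂ a₁₂) (hg : HasJet g x v w b b₁ b₂ b₁₂) :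
    HasJet (fun y => f y - g y) x v w (a - b) (a₁ - b₁) (a₂ - b₂) (a₁₂ - b₁₂) :=
  ((hf.add (hg.const_mul (-1))).congr (.of_forall fun y => by ring)).congr_coeff
    (by ring) (by ring) (by ring) (by ring)

theorem HasJet.comp_contDiff {f : E → ℝ} {g : ℝ → ℝ} {x v w : E} {a a₁ a₂ a₁₂ : ℝ}
    (hf : HasJet f x v w a a₁ a₂ a₁₂) (hg : ContDiff ℝ ∞ g) :
    HasJet (fun y => g (f y)) x v w (g a) (deriv g a * a₁) (deriv g a * a₂)
      (deriv (deriv g) a * a₁ * a₂ + deriv g a * a₁₂) := by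
  have h1 : ContDiff ℝ ∞ (deriv g) := by
    have := (contDiff_infty_iff_deriv (𝕜 := ℝ)).1 hg
    exact this.2
  exact hf.comp (.of_forall fun s => (hg.differentiable (by simp) s).hasDerivAt)
    (h1.differentiable (by simp) a).hasDerivAt

theorem HasJet.comp_affine {F : Type*} [NormedAddCommGroup F] [NormedSpace ℝ F]
    {f : F → ℝ} {a a₁ a₂ a₁₂ : ℝ} (M : E →L[ℝ] F) (k : F) {x v w : E}
    (hf : HasJet f (M x + k) (M v) (M w) a a₁ a₂ a₁₂) :
    HasJet (fun y => f (M y + k)) x v w a a₁ a₂ a₁₂ := by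
  have hA : ∀ y, HasFDerivAt (fun y => M y + k) M y := fun y => M.hasFDerivAt.add_const k
  refine .of_hasFDerivAt (f' := fun y => (fderiv ℝ f (M y + k)).comp M)
    (f'' := ((ContinuousLinearMap.compL ℝ E F ℝ).flip M).comp
      ((secondDeriv f (M x + k)).comp M)) ?_ ?_ hf.val hf.fst hf.snd hf.mixed
  · filter_upwards [(hA x).continuousAt.eventually hf.twice.eventually] with y hy
    exact hy.comp y (hA y)
  · exact (((ContinuousLinearMap.compL ℝ E F ℝ).flip M).hasFDerivAt).comp x
      (HasFDerivAt.comp (f := fun y => M y + k) (g := fderiv ℝ f) x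
        hf.twice.2.hasFDerivAt (hA x))

end Jets

/-! ### Functions constant on part of the line -/

/-- A one-sided derivative suffices, so `s` may be an endpoint of a closed interval on which `g` is
constant. This matters because the flat ranges of the bump functions are given by weak inequalities.
-/
theorem deriv_eq_zero_of_eqOn_const {g : ℝ → ℝ} {S : Set ℝ} {c s : ℝ}
    (hg : DifferentiableAt ℝ g s) (hS : UniqueDiffOn ℝ S) (h : ∀ t ∈ S, g t = c) (hs : s ∈ S) :
    deriv g s = 0 := by
  have h1 : HasDerivWithinAt g (deriv g s) S s := hg.hasDerivAt.hasDerivWithinAt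
  have h2 : HasDerivWithinAt g 0 S s := (hasDerivWithinAt_const s S c).congr h (h s hs)
  exact (hS s hs).eq_deriv _ h1 h2

theorem deriv_deriv_eq_zero_of_eqOn_const {g : ℝ → ℝ} {S : Set ℝ} {c s : ℝ}
    (hg : ContDiff ℝ ∞ g) (hS : UniqueDiffOn ℝ S) (h : ∀ t ∈ S, g t = c) (hs : s ∈ S) :
    deriv g s = 0 ∧ deriv (deriv g) s = 0 := by
  have h1 : ∀ t ∈ S, deriv g t = 0 := fun t ht =>
    deriv_eq_zero_of_eqOn_const (hg.differentiable (by simp) t) hS h ht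
  have h2 : ContDiff ℝ ∞ (deriv g) := ((contDiff_infty_iff_deriv (𝕜 := ℝ)).1 hg).2
  exact ⟨h1 s hs, deriv_eq_zero_of_eqOn_const (h2.differentiable (by simp) s) hS h1 hs⟩

/-! ### Kähler forms of functions of the logarithms of the norms -/

/-- The logarithms of the norms of the coordinates. -/
noncomputable def logNorms (P : Pt) : Fin 3 → ℝ := fun j => Real.log ‖P j‖

/-- The derivative of `logNorms` at `P` along `v`. -/
noncomputable def logVel (P v : Pt) : Pt := fun j => v j / P j

noncomputable def rePart (q : Pt) : Fin 3 → ℝ := fun j => (q j).re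
noncomputable def imPart (q : Pt) : Fin 3 → ℝ := fun j => (q j).im

theorem hasFDerivAt_log_norm {z : ℂ} (hz : z ≠ 0) :
    HasFDerivAt (fun z : ℂ => Real.log ‖z‖)
      (Complex.reCLM.comp ((z⁻¹ • (1 : ℂ →L[ℂ] ℂ)).restrictScalars ℝ)) z := by
  -- The norm enters through `log ‖z‖ = (1/2) log ‖z‖²`, which avoids differentiating the square
  -- root.
  have h1 : HasFDerivAt (fun z : ℂ => ‖z‖ ^ 2) (2 • (innerSL ℝ z)) z := by
    simpa using (hasStrictFDerivAt_norm_sq z).hasFDerivAt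
  have h2 := (h1.log (by positivity)).const_mul (1 / 2 : ℝ)
  refine (h2.congr_fderiv ?_).congr_of_eventuallyEq ?_
  · ext w
    have hn : Complex.normSq z ≠ 0 := by simpa using hz
    simp [Complex.inner, ← Complex.normSq_eq_norm_sq]
    field_simp
    ring
  · filter_upwards with w
    rw [Real.log_pow]; push_cast; ring

theorem hasFDerivAt_logNorms {P : Pt} (hP : ∀ j, P j ≠ 0) :
    HasFDerivAt logNorms (ContinuousLinearMap.pi fun j =>
      (Complex.reCLM.comp (((P j)⁻¹ • (1 : ℂ →L[ℂ] ℂ)).restrictScalars ℝ)).comp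
        (ContinuousLinearMap.proj j : Pt →L[ℝ] ℂ)) P := by
  rw [hasFDerivAt_pi]
  intro j
  exact (hasFDerivAt_log_norm (hP j)).comp P
    (ContinuousLinearMap.proj (R := ℝ) (φ := fun _ : Fin 3 => ℂ) j).hasFDerivAt

theorem logNorms_deriv_apply {P : Pt} (v : Pt) :
    (ContinuousLinearMap.pi fun j =>
      (Complex.reCLM.comp (((P j)⁻¹ • (1 : ℂ →L[ℂ] ℂ)).restrictScalars ℝ)).comp
        (ContinuousLinearMap.proj j : Pt →L[ℝ] ℂ)) v = rePart (logVel P v) := by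
  ext j
  simp [rePart, logVel, div_eq_inv_mul]

theorem eventually_ne_zero {P : Pt} (hP : ∀ j, P j ≠ 0) : ∀ᶠ Q in 𝓝 P, ∀ j, Q j ≠ 0 := by
  rw [eventually_all]
  exact fun j => (continuous_apply j).continuousAt.eventually_ne (hP j)

/-- For fixed `w` the quotient `w j / Q j` has derivative `-(v j / P j)(w j / P j)`. This is
symmetric and complex bilinear in the two logarithmic velocities, which is why it will cancel in the
Kähler form. -/
theorem hasFDerivAt_rePart_logVel {P : Pt} (hP : ∀ j, P j ≠ 0) (w : Pt) :
    ∃ L : Pt →L[ℝ] (Fin 3 → ℝ), HasFDerivAt (fun Q => rePart (logVel Q w)) L P ∧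
      ∀ v, L v = -rePart (fun j => logVel P v j * logVel P w j) := by
  refine ⟨ContinuousLinearMap.pi fun j =>
      (Complex.reCLM.comp (((-(w j) / (P j) ^ 2) • (1 : ℂ →L[ℂ] ℂ)).restrictScalars ℝ)).comp
        (ContinuousLinearMap.proj j : Pt →L[ℝ] ℂ), ?_, ?_⟩
  · rw [hasFDerivAt_pi]
    intro j
    have h1 : HasDerivAt (fun z : ℂ => w j / z) (-(w j) / (P j) ^ 2) (P j) := by
      have := (hasDerivAt_inv (hP j)).const_mul (w j)
      simpa only [div_eq_mul_inv, neg_mul, mul_neg, one_mul] using this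
    have h2 : HasFDerivAt (fun z : ℂ => w j / z)
        (((-(w j) / (P j) ^ 2) • (1 : ℂ →L[ℂ] ℂ)).restrictScalars ℝ) (P j) := by
      have := h1.hasFDerivAt.restrictScalars ℝ
      refine this.congr_fderiv ?_
      ext; simp [mul_comm]
    exact HasFDerivAt.comp (g := fun z : ℂ => (w j / z).re) (f := fun Q : Pt => Q j) P
      (Complex.reCLM.hasFDerivAt.comp (P j) h2)
      (ContinuousLinearMap.proj (R := ℝ) (φ := fun _ : Fin 3 => ℂ) j).hasFDerivAt
  · intro v
    ext j
    have := hP j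
    simp only [ContinuousLinearMap.coe_pi', ContinuousLinearMap.comp_apply,
      ContinuousLinearMap.proj_apply, ContinuousLinearMap.coe_restrictScalars', _root_.smul_apply,
      one_apply_eq_self, Complex.reCLM_apply, rePart, logVel, Pi.neg_apply,
      smul_eq_mul, ← Complex.neg_re]
    congr 1
    field_simp

theorem hess_comp_logNorms {G : (Fin 3 → ℝ) → ℝ} {P : Pt} (hP : ∀ j, P j ≠ 0)
    (hG : TwiceDiffAt G (logNorms P)) (v w : Pt) :
    hess (fun Q => G (logNorms Q)) P v w =
      secondDeriv G (logNorms P) (rePart (logVel P v)) (rePart (logVel P w))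
        - fderiv ℝ G (logNorms P) (rePart fun j => logVel P v j * logVel P w j) := by
  obtain ⟨L, hL, hLv⟩ := hasFDerivAt_rePart_logVel hP w
  have hl := hasFDerivAt_logNorms hP
  have e : (fun Q => fderiv ℝ (fun Q => G (logNorms Q)) Q w) =ᶠ[𝓝 P]
      fun Q => fderiv ℝ G (logNorms Q) (rePart (logVel Q w)) := by
    filter_upwards [eventually_ne_zero hP, hl.continuousAt.eventually hG.eventually] with Q h1 h2
    have := h2.comp Q (hasFDerivAt_logNorms h1)
    change fderiv ℝ (G ∘ logNorms) Q w = _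
    rw [this.fderiv, ContinuousLinearMap.comp_apply, logNorms_deriv_apply]
  have h3 : HasFDerivAt (fun Q => fderiv ℝ G (logNorms Q)) _ P :=
    HasFDerivAt.comp (g := fderiv ℝ G) P hG.2.hasFDerivAt hl
  have h4 := (h3.clm_apply hL).congr_of_eventuallyEq e
  rw [hess, h4.fderiv]
  simp only [_root_.add_apply, ContinuousLinearMap.comp_apply, ContinuousLinearMap.flip_apply, hLv,
    map_neg, logNorms_deriv_apply]
  ring

theorem rePart_I_mul (q : Pt) : (rePart fun j => Complex.I * q j) = -imPart q := by
  ext j; simp [rePart, imPart]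

/-- The first-order terms of the two Hessians are evaluated at the same vector, since `(i v) w = v
(i w)`, and cancel. Multiplication by `i` turns real parts into imaginary parts up to sign, which
leaves only the second derivative of `G`. -/
theorem kahlerForm_comp_logNorms {G : (Fin 3 → ℝ) → ℝ} {P : Pt} (hP : ∀ j, P j ≠ 0)
    (hG : TwiceDiffAt G (logNorms P)) (v w : Pt) :
    kahlerForm (fun Q => G (logNorms Q)) P v w =
      (secondDeriv G (logNorms P) (rePart (logVel P v)) (imPart (logVel P w))
        - secondDeriv G (logNorms P) (imPart (logVel P v)) (rePart (logVel P w)))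
        / (4 * Real.pi) := by
  have hI : ∀ u : Pt, logVel P (Complex.I • u) = fun j => Complex.I * logVel P u j := by
    intro u; ext j; simp [logVel, mul_div_assoc]
  rw [kahlerForm, hess_comp_logNorms hP hG, hess_comp_logNorms hP hG, hI, hI, rePart_I_mul,
    rePart_I_mul]
  have e : (fun j => Complex.I * logVel P v j * logVel P w j) =
      fun j => logVel P v j * (Complex.I * logVel P w j) := by
    ext j; ring
  rw [e]
  simp only [map_neg, _root_.neg_apply]
  ring

theorem kahlerForm_congr {F F' : Pt → ℝ} {P : Pt} (h : F =ᶠ[𝓝 P] F') (v w : Pt) :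
    kahlerForm F P v w = kahlerForm F' P v w := by
  have key : ∀ v w, hess F P v w = hess F' P v w := by
    intro v w
    have : (fun Q => fderiv ℝ F Q w) =ᶠ[𝓝 P] fun Q => fderiv ℝ F' Q w :=
      (h.fderiv (𝕜 := ℝ)).mono fun Q hQ => by simp only [hQ]
    simp only [hess, this.fderiv_eq]
  simp only [kahlerForm, key]

/-! ### Estimates for the second derivative of the potential -/

theorem abs_mul_le_mul {a b A B : ℝ} (ha : |a| ≤ A) (hb : |b| ≤ B) : |a * b| ≤ A * B := by
  rw [abs_mul]
  exact mul_le_mul ha hb (abs_nonneg _) ((abs_nonneg _).trans ha)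

/-- Bounds for the jets along two directions of the functions `φ_a`, `φ_b`, `φ_c` and `α₆`. -/
structure JetBounds (ta tb R δ z₁ x₁ z₂ x₂ φb φc pa pb pc qa qb qc ha hb hc m m₁ m₂ m₁₂ : ℝ) :
    Prop where
  ta_pos : 0 < ta
  tb_pos : 0 < tb
  tb_le : tb ≤ ta
  z₁_nonneg : 0 ≤ z₁
  z₂_nonneg : 0 ≤ z₂
  zx₁ : z₁ ≤ x₁
  zx₂ : z₂ ≤ x₂
  xz₁ : tb * x₁ ≤ ta * z₁
  xz₂ : tb * x₂ ≤ ta * z₂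
  zR : ta * (z₁ * z₂) ≤ R
  xR : tb * (x₁ * x₂) ≤ R
  δ_nonneg : 0 ≤ δ
  δ_le : δ ≤ 1
  φb_le : |φb| ≤ tb
  φc_le : |φc| ≤ tb
  pa_le : |pa| ≤ 4 * (ta * z₁)
  pb_le : |pb| ≤ 4 * (tb * x₁)
  pc_le : |pc| ≤ 4 * (tb * x₁)
  qa_le : |qa| ≤ 4 * (ta * z₂)
  qb_le : |qb| ≤ 4 * (tb * x₂)
  qc_le : |qc| ≤ 4 * (tb * x₂)
  ha_le : |ha| ≤ 8 * R
  hb_le : |hb| ≤ 8 * R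
  hc_le : |hc| ≤ 8 * R
  m_nonneg : 0 ≤ m
  m_le : m ≤ 1
  m₁_le : |m₁| ≤ 2 * (δ * x₁)
  m₂_le : |m₂| ≤ 2 * (δ * x₂)
  m₁₂_le : |m₁₂| ≤ 4 * (δ * (x₁ * x₂))

namespace JetBounds

variable {ta tb R δ z₁ x₁ z₂ x₂ φb φc pa pb pc qa qb qc ha hb hc m m₁ m₂ m₁₂ : ℝ}

theorem R_nonneg (J : JetBounds ta tb R δ z₁ x₁ z₂ x₂ φb φc pa pb pc qa qb qc ha hb hc m m₁ m₂ m₁₂) :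
    0 ≤ R :=
  le_trans (mul_nonneg J.ta_pos.le (mul_nonneg J.z₁_nonneg J.z₂_nonneg)) J.zR

theorem swap (J : JetBounds ta tb R δ z₁ x₁ z₂ x₂ φb φc pa pb pc qa qb qc ha hb hc m m₁ m₂ m₁₂) :
    JetBounds ta tb R δ z₂ x₂ z₁ x₁ φb φc qa qb qc pa pb pc ha hb hc m m₂ m₁ m₁₂ where
  ta_pos := J.ta_pos
  tb_pos := J.tb_pos
  tb_le := J.tb_le
  z₁_nonneg := J.z₂_nonneg
  z₂_nonneg := J.z₁_nonneg
  zx₁ := J.zx₂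
  zx₂ := J.zx₁
  xz₁ := J.xz₂
  xz₂ := J.xz₁
  zR := by rw [mul_comm z₂]; exact J.zR
  xR := by rw [mul_comm x₂]; exact J.xR
  δ_nonneg := J.δ_nonneg
  δ_le := J.δ_le
  φb_le := J.φb_le
  φc_le := J.φc_le
  pa_le := J.qa_le
  pb_le := J.qb_le
  pc_le := J.qc_le
  qa_le := J.pa_le
  qb_le := J.pb_le
  qc_le := J.pc_le
  ha_le := J.ha_le
  hb_le := J.hb_le
  hc_le := J.hc_le
  m_nonneg := J.m_nonneg
  m_le := J.m_le
  m₁_le := J.m₂_le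
  m₂_le := J.m₁_le
  m₁₂_le := by rw [mul_comm x₂]; exact J.m₁₂_le

/-- In `JetBounds` the indices `1`, `2` refer to the two directions; `z` is the weight of a
direction for `φ_a` and `x` its weight for `φ_b`, `φ_c`. Since `ta z₁ z₂ ≤ R` and `tb x₁ x₂ ≤ R`, a
product of two first derivatives divided by the size of the function is of order `R`, like a second
derivative. -/
theorem turn_fst (J : JetBounds ta tb R δ z₁ x₁ z₂ x₂ φb φc pa pb pc qa qb qc ha hb hc m m₁ m₂ m₁₂) :
    |m₁ * φb + m * pb| ≤ 6 * (tb * x₁) := by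
  have hx : 0 ≤ tb * x₁ := mul_nonneg J.tb_pos.le (J.z₁_nonneg.trans J.zx₁)
  have h1 := abs_mul_le_mul J.m₁_le J.φb_le
  have h2 := abs_mul_le_mul (abs_le.2 ⟨by linarith [J.m_nonneg], J.m_le⟩) J.pb_le
  have h3 : 2 * (δ * x₁) * tb ≤ 2 * (tb * x₁) := by nlinarith [J.δ_le]
  linarith [abs_add_le (m₁ * φb) (m * pb)]

theorem turn_mixed
    (J : JetBounds ta tb R δ z₁ x₁ z₂ x₂ φb φc pa pb pc qa qb qc ha hb hc m m₁ m₂ m₁₂) :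
    |m₁₂ * φb + m₁ * qb + m₂ * pb| ≤ 20 * (δ * R) := by
  have h1 := abs_mul_le_mul J.m₁₂_le J.φb_le
  have h2 := abs_mul_le_mul J.m₁_le J.qb_le
  have h3 := abs_mul_le_mul J.m₂_le J.pb_le
  have h4 : δ * (tb * (x₁ * x₂)) ≤ δ * R := mul_le_mul_of_nonneg_left J.xR J.δ_nonneg
  have := abs_add_three (m₁₂ * φb) (m₁ * qb) (m₂ * pb)
  linarith

theorem radial_fst
    (J : JetBounds ta tb R δ z₁ x₁ z₂ x₂ φb φc pa pb pc qa qb qc ha hb hc m m₁ m₂ m₁₂) :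
    |pa - (pb + pc) / 2 + 3 / 2 * (m₁ * φb + m * pb)| ≤ 17 * (ta * z₁) := by
  have h1 := J.turn_fst
  have h2 := J.pa_le
  have h3 := J.pb_le
  have h4 := J.pc_le
  have h5 := J.xz₁
  rw [abs_le] at *
  constructor <;> linarith

theorem radial_mixed
    (J : JetBounds ta tb R δ z₁ x₁ z₂ x₂ φb φc pa pb pc qa qb qc ha hb hc m m₁ m₂ m₁₂) :
    |ha - (hb + hc) / 2 + 3 / 2 * (m₁₂ * φb + m₁ * qb + m₂ * pb + m * hb)| ≤ 58 * R := by
  have h1 := J.turn_mixed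
  have h2 := J.ha_le
  have h3 := J.hb_le
  have h4 := J.hc_le
  have h5 : δ * R ≤ R := by nlinarith [J.δ_le, J.R_nonneg]
  have h6 := abs_mul_le_mul (abs_le.2 ⟨by linarith [J.m_nonneg], J.m_le⟩) J.hb_le
  rw [abs_le] at *
  constructor <;> linarith

end JetBounds

/-- The second derivative of `α₃(d) d` beyond `α₃(d) D²d` is small. -/
theorem abs_cutoff_radial_le {ta R δ d d₁ d₂ d₁₂ e f : ℝ} (hR : 0 ≤ R)
    (hd : |d| ≤ 3 * ta) (hdd : |d₁ * d₂| ≤ 289 * (ta * R)) (hd12 : |d₁₂| ≤ 58 * R)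
    (he : |e| * ta ≤ 4 * δ) (hf : |f| * ta ^ 2 ≤ 32 * δ) :
    |2 * (e * (d₁ * d₂)) + (f * (d₁ * d₂) + e * d₁₂) * d| ≤ 31000 * (δ * R) := by
  -- The factor `δ / ta` from the derivative of the cut-off cancels against `d₁ d₂ = O(ta R)`. In
  -- the next two terms the factor `d = O(ta)` restores the missing powers of `ta`.
  have h1 : |e * (d₁ * d₂)| ≤ 1156 * (δ * R) := by
    have := abs_mul_le_mul le_rfl hdd (a := e)
    have h := mul_le_mul_of_nonneg_right he hR
    linarith
  have h2 : |f * (d₁ * d₂) * d| ≤ 27744 * (δ * R) := by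
    have := abs_mul_le_mul (abs_mul_le_mul le_rfl hdd (a := f)) hd
    have h := mul_le_mul_of_nonneg_right hf hR
    linarith
  have h3 : |e * d₁₂ * d| ≤ 696 * (δ * R) := by
    have := abs_mul_le_mul (abs_mul_le_mul le_rfl hd12 (a := e)) hd
    have h := mul_le_mul_of_nonneg_right he hR
    linarith
  rw [abs_le] at h1 h2 h3 ⊢
  constructor <;> linarith

/-- The second derivative of `α₄(θ) α₅(d) X` beyond `α₄(θ) α₅(d) D²X` is small. -/
theorem abs_cutoff_angular_le {ta tb R δ z₁ x₁ z₂ x₂ d₁ d₂ d₁₂ θ₁ θ₂ θ₁₂ X X₁ X₂ A B e₄ f₄ e₅ f₅ : ℝ}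
    (hta : 0 < ta) (htb : 0 < tb) (hba : tb ≤ ta) (hR : 0 ≤ R) (hδ : 0 ≤ δ) (hδ1 : δ ≤ 1)
    (hz₁ : 0 ≤ z₁) (hz₂ : 0 ≤ z₂) (hzx₁ : z₁ ≤ x₁) (hzx₂ : z₂ ≤ x₂)
    (hzR : ta * (z₁ * z₂) ≤ R) (hxR : tb * (x₁ * x₂) ≤ R)
    (hA : |A| ≤ 1 / 2) (hB : |B| ≤ 1)
    (hd₁ : |d₁| ≤ 17 * (ta * z₁)) (hd₂ : |d₂| ≤ 17 * (ta * z₂)) (hd12 : |d₁₂| ≤ 58 * R)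
    (hθ₁ : |θ₁| ≤ 8 * (tb * x₁)) (hθ₂ : |θ₂| ≤ 8 * (tb * x₂)) (hθ12 : |θ₁₂| ≤ 16 * R)
    (hX : |X| ≤ 3 * tb) (hX₁ : |X₁| ≤ 14 * (tb * x₁)) (hX₂ : |X₂| ≤ 14 * (tb * x₂))
    (he₄ : |e₄| * tb ≤ 3 * δ) (hf₄ : |f₄| * tb ^ 2 ≤ 18 * δ)
    (he₅ : |e₅| * ta ≤ 4 * δ) (hf₅ : |f₅| * ta ^ 2 ≤ 32 * δ) :
    |(f₄ * (θ₁ * θ₂) + e₄ * θ₁₂) * B * X + A * (f₅ * (d₁ * d₂) + e₅ * d₁₂) * X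
      + (e₄ * θ₁) * (e₅ * d₂) * X + (e₄ * θ₂) * (e₅ * d₁) * X
      + (e₄ * θ₁) * B * X₂ + (e₄ * θ₂) * B * X₁
      + A * (e₅ * d₁) * X₂ + A * (e₅ * d₂) * X₁| ≤ 60000 * (δ * R) := by
  have hx₁ : 0 ≤ x₁ := hz₁.trans hzx₁
  have hx₂ : 0 ≤ x₂ := hz₂.trans hzx₂
  have hδR : 0 ≤ δ * R := mul_nonneg hδ hR
  have hxx : δ * (tb * (x₁ * x₂)) ≤ δ * R := mul_le_mul_of_nonneg_left hxR hδ
  -- Mixed products pair a derivative of `d` with one of `θ` or `X`; `z ≤ x` reduces them to the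
  -- bound on `tb x₁ x₂`.
  have hzx : tb * (z₁ * x₂) ≤ R := le_trans (by gcongr) hxR
  have hxz : tb * (x₁ * z₂) ≤ R := le_trans (by gcongr) hxR
  have hdd : |d₁ * d₂| ≤ 289 * (ta * R) := by
    have := abs_mul_le_mul hd₁ hd₂
    have h := mul_le_mul_of_nonneg_left hzR hta.le
    linarith
  have hθθ : |θ₁ * θ₂| ≤ 64 * (tb * R) := by
    have := abs_mul_le_mul hθ₁ hθ₂
    have h := mul_le_mul_of_nonneg_left hxR htb.le
    linarith
  have a₁ : |e₄ * θ₁| ≤ 24 * (δ * x₁) := by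
    have := abs_mul_le_mul le_rfl hθ₁ (a := e₄)
    have h := mul_le_mul_of_nonneg_right he₄ hx₁
    linarith
  have a₂ : |e₄ * θ₂| ≤ 24 * (δ * x₂) := by
    have := abs_mul_le_mul le_rfl hθ₂ (a := e₄)
    have h := mul_le_mul_of_nonneg_right he₄ hx₂
    linarith
  have b₁ : |e₅ * d₁| ≤ 68 * (δ * z₁) := by
    have := abs_mul_le_mul le_rfl hd₁ (a := e₅)
    have h := mul_le_mul_of_nonneg_right he₅ hz₁
    linarith
  have b₂ : |e₅ * d₂| ≤ 68 * (δ * z₂) := by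
    have := abs_mul_le_mul le_rfl hd₂ (a := e₅)
    have h := mul_le_mul_of_nonneg_right he₅ hz₂
    linarith
  have t1 : |f₄ * (θ₁ * θ₂) * B * X| ≤ 3456 * (δ * R) := by
    have := abs_mul_le_mul (abs_mul_le_mul (abs_mul_le_mul le_rfl hθθ (a := f₄)) hB) hX
    have h := mul_le_mul_of_nonneg_right hf₄ hR
    linarith
  have t2 : |e₄ * θ₁₂ * B * X| ≤ 144 * (δ * R) := by
    have := abs_mul_le_mul (abs_mul_le_mul (abs_mul_le_mul le_rfl hθ12 (a := e₄)) hB) hX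
    have h := mul_le_mul_of_nonneg_right he₄ hR
    linarith
  have t3 : |A * (f₅ * (d₁ * d₂)) * X| ≤ 13872 * (δ * R) := by
    have := abs_mul_le_mul (abs_mul_le_mul hA (abs_mul_le_mul le_rfl hdd (a := f₅)))
      (hX.trans (by linarith : 3 * tb ≤ 3 * ta))
    have h := mul_le_mul_of_nonneg_right hf₅ hR
    linarith
  have t4 : |A * (e₅ * d₁₂) * X| ≤ 348 * (δ * R) := by
    have := abs_mul_le_mul (abs_mul_le_mul hA (abs_mul_le_mul le_rfl hd12 (a := e₅)))
      (hX.trans (by linarith : 3 * tb ≤ 3 * ta))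
    have h := mul_le_mul_of_nonneg_right he₅ hR
    linarith
  -- When `α₄` and `α₅` are both differentiated there are two factors `δ`; one is enough.
  have hδδ : δ * (δ * R) ≤ δ * R := mul_le_of_le_one_left hδR hδ1
  have t5 : |(e₄ * θ₁) * (e₅ * d₂) * X| ≤ 4896 * (δ * R) := by
    have h := abs_mul_le_mul (abs_mul_le_mul a₁ b₂) hX
    have h' : δ * (δ * (tb * (x₁ * z₂))) ≤ δ * (δ * R) := by gcongr
    linarith
  have t6 : |(e₄ * θ₂) * (e₅ * d₁) * X| ≤ 4896 * (δ * R) := by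
    have h := abs_mul_le_mul (abs_mul_le_mul a₂ b₁) hX
    have h' : δ * (δ * (tb * (z₁ * x₂))) ≤ δ * (δ * R) := by gcongr
    linarith
  have t7 : |(e₄ * θ₁) * B * X₂| ≤ 336 * (δ * R) := by
    have h := abs_mul_le_mul (abs_mul_le_mul a₁ hB) hX₂
    linarith
  have t8 : |(e₄ * θ₂) * B * X₁| ≤ 336 * (δ * R) := by
    have h := abs_mul_le_mul (abs_mul_le_mul a₂ hB) hX₁
    linarith
  have t9 : |A * (e₅ * d₁) * X₂| ≤ 476 * (δ * R) := by
    have h := abs_mul_le_mul (abs_mul_le_mul hA b₁) hX₂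
    have h' : δ * (tb * (z₁ * x₂)) ≤ δ * R := by gcongr
    linarith
  have t10 : |A * (e₅ * d₂) * X₁| ≤ 476 * (δ * R) := by
    have h := abs_mul_le_mul (abs_mul_le_mul hA b₂) hX₁
    have h' : δ * (tb * (x₁ * z₂)) ≤ δ * R := by gcongr
    linarith
  rw [abs_le] at t1 t2 t3 t4 t5 t6 t7 t8 t9 t10 ⊢
  constructor <;> linarith

/-- The second derivative of the potential differs little from the value it would have if the bump
functions were constant. -/
theorem JetBounds.abs_mixed_sub_main_le
    {ta tb R δ z₁ x₁ z₂ x₂ φb φc pa pb pc qa qb qc ha hb hc m m₁ m₂ m₁₂ : ℝ}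
    (J : JetBounds ta tb R δ z₁ x₁ z₂ x₂ φb φc pa pb pc qa qb qc ha hb hc m m₁ m₂ m₁₂)
    {d d₁ d₂ d₁₂ θ₁ θ₂ θ₁₂ y₁ y₂ y₁₂ X A B D e₃ f₃ e₄ f₄ e₅ f₅ g : ℝ}
    (hy₁ : y₁ = m₁ * φb + m * pb) (hy₂ : y₂ = m₂ * φb + m * qb)
    (hy₁₂ : y₁₂ = m₁₂ * φb + m₁ * qb + m₂ * pb + m * hb)
    (hd₁ : d₁ = pa - (pb + pc) / 2 + 3 / 2 * y₁) (hd₂ : d₂ = qa - (qb + qc) / 2 + 3 / 2 * y₂)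
    (hd₁₂ : d₁₂ = ha - (hb + hc) / 2 + 3 / 2 * y₁₂)
    (hθ₁ : θ₁ = pb - pc) (hθ₂ : θ₂ = qb - qc) (hθ₁₂ : θ₁₂ = hb - hc)
    (hX : X = φb - φc - m * φb)
    (hdle : |d| ≤ 3 * ta) (hA : |A| ≤ 1 / 2) (hB : |B| ≤ 1) (hD : |D| ≤ 1)
    (he₃ : |e₃| * ta ≤ 4 * δ) (hf₃ : |f₃| * ta ^ 2 ≤ 32 * δ)
    (he₅ : |e₅| * ta ≤ 4 * δ) (hf₅ : |f₅| * ta ^ 2 ≤ 32 * δ)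
    (h₄ : (|e₄| * tb ≤ 3 * δ ∧ |f₄| * tb ^ 2 ≤ 18 * δ) ∨ (B = 0 ∧ e₅ = 0 ∧ f₅ = 0)) :
    |(g - ha - y₁₂
        + ((f₃ * d₁ * d₂ + e₃ * d₁₂) * d + e₃ * d₁ * d₂ + e₃ * d₂ * d₁ + D * d₁₂)
        + ((((f₄ * θ₁ * θ₂ + e₄ * θ₁₂) * B + e₄ * θ₁ * (e₅ * d₂) + e₄ * θ₂ * (e₅ * d₁)
            + A * (f₅ * d₁ * d₂ + e₅ * d₁₂)) * X
          + (e₄ * θ₁ * B + A * (e₅ * d₁)) * (θ₂ - y₂)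
          + (e₄ * θ₂ * B + A * (e₅ * d₂)) * (θ₁ - y₁) + A * B * (θ₁₂ - y₁₂))))
      - (g - ha - m * hb + D * (ha - (hb + hc) / 2 + 3 / 2 * (m * hb))
          + A * B * (hb - hc - m * hb))| ≤ 100000 * (δ * R) := by
  -- In the other alternative every occurrence of `e₄` and `f₄` is multiplied by `B`, `e₅` or `f₅`,
  -- all zero, so they may be replaced by `0`.
  wlog h : |e₄| * tb ≤ 3 * δ ∧ |f₄| * tb ^ 2 ≤ 18 * δ generalizing e₄ f₄
  · obtain ⟨hB0, h5, h5'⟩ := h₄.resolve_left h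
    have h0 : |(0 : ℝ)| * tb ≤ 3 * δ ∧ |(0 : ℝ)| * tb ^ 2 ≤ 18 * δ := by
      have := J.δ_nonneg
      simp [this]
    have := this (.inl h0) h0
    subst hB0 h5 h5'
    simpa only [mul_zero, zero_mul, add_zero, zero_add] using this
  obtain ⟨he₄, hf₄⟩ := h
  have hδR : 0 ≤ δ * R := mul_nonneg J.δ_nonneg J.R_nonneg
  have bd₁ := J.radial_fst
  have bd₂ := J.swap.radial_fst
  have bd₁₂ := J.radial_mixed
  have by₁ := J.turn_fst
  have by₂ := J.swap.turn_fst
  have by₁₂ := J.turn_mixed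
  rw [← hy₁] at by₁ bd₁
  rw [← hy₂] at by₂ bd₂
  rw [← hy₁₂] at bd₁₂
  rw [← hd₁] at bd₁
  rw [← hd₂] at bd₂
  rw [← hd₁₂] at bd₁₂
  have bdd : |d₁ * d₂| ≤ 289 * (ta * R) := by
    have := abs_mul_le_mul bd₁ bd₂
    nlinarith [J.zR, J.ta_pos]
  have bθ₁ : |θ₁| ≤ 8 * (tb * x₁) := by
    rw [hθ₁]; linarith [abs_sub pb pc, J.pb_le, J.pc_le]
  have bθ₂ : |θ₂| ≤ 8 * (tb * x₂) := by
    rw [hθ₂]; linarith [abs_sub qb qc, J.qb_le, J.qc_le]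
  have bθ₁₂ : |θ₁₂| ≤ 16 * R := by
    rw [hθ₁₂]; linarith [abs_sub hb hc, J.hb_le, J.hc_le]
  have bX : |X| ≤ 3 * tb := by
    have h6 := abs_mul_le_mul (abs_le.2 ⟨by linarith [J.m_nonneg], J.m_le⟩) J.φb_le
    rw [hX]; linarith [abs_sub (φb - φc) (m * φb), abs_sub φb φc, J.φb_le, J.φc_le]
  have bX₁ : |θ₁ - y₁| ≤ 14 * (tb * x₁) := by linarith [abs_sub θ₁ y₁]
  have bX₂ : |θ₂ - y₂| ≤ 14 * (tb * x₂) := by linarith [abs_sub θ₂ y₂]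
  have r1 := abs_cutoff_radial_le J.R_nonneg hdle bdd bd₁₂ he₃ hf₃
  have r2 := abs_cutoff_angular_le J.ta_pos J.tb_pos J.tb_le J.R_nonneg J.δ_nonneg J.δ_le
    J.z₁_nonneg J.z₂_nonneg J.zx₁ J.zx₂ J.zR J.xR hA hB bd₁ bd₂ bd₁₂ bθ₁ bθ₂ bθ₁₂ bX bX₁ bX₂
    he₄ hf₄ he₅ hf₅
  have r3 := abs_mul_le_mul hD by₁₂
  have r4 := abs_mul_le_mul (abs_mul_le_mul hA hB) by₁₂
  have r5 := by₁₂
  rw [abs_le] at r1 r2 r3 r4 r5 ⊢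
  rw [hθ₁₂] at r2 ⊢
  rw [hd₁₂, hy₁₂] at *
  constructor <;> linarith

/-! ### Elementary inequalities for the toric potentials -/

theorem log_one_add_le {t : ℝ} (ht : 0 ≤ t) : Real.log (1 + t) ≤ t := by
  linarith [Real.log_le_sub_one_of_pos (by linarith : 0 < 1 + t)]

theorem le_log_one_add {t : ℝ} (ht : 0 ≤ t) (h1 : t ≤ 1) : 2 / 3 * t ≤ Real.log (1 + t) := by
  refine le_trans ?_ (Real.le_log_one_add_of_nonneg ht)
  rw [le_div_iff₀ (by linarith)]
  nlinarith

theorem log_one_add_nonneg {t : ℝ} (ht : 0 ≤ t) : 0 ≤ Real.log (1 + t) :=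
  Real.log_nonneg (by linarith)

theorem log_one_add_mono {s t : ℝ} (hs : 0 ≤ s) (h : s ≤ t) :
    Real.log (1 + s) ≤ Real.log (1 + t) :=
  Real.log_le_log (by linarith) (by linarith)

/-- `2 t / (1 + t)`, the derivative of `log (1 + e^{2 s})` at `t = e^{2 s}`. -/
noncomputable def slope (t : ℝ) : ℝ := 2 * t / (1 + t)

/-- `4 t / (1 + t)²`, the second derivative of `log (1 + e^{2 s})` at `t = e^{2 s}`. -/
noncomputable def curv (t : ℝ) : ℝ := 4 * t / (1 + t) ^ 2

theorem slope_nonneg {t : ℝ} (ht : 0 ≤ t) : 0 ≤ slope t := by unfold slope; positivity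

theorem slope_le {t : ℝ} (ht : 0 ≤ t) : slope t ≤ 2 * t := by
  rw [slope, div_le_iff₀ (by linarith)]; nlinarith

theorem curv_nonneg {t : ℝ} (ht : 0 ≤ t) : 0 ≤ curv t := by unfold curv; positivity

theorem curv_le {t : ℝ} (ht : 0 ≤ t) : curv t ≤ 4 * t := by
  rw [curv, div_le_iff₀ (by positivity)]
  nlinarith [mul_nonneg ht ht, mul_nonneg ht (mul_nonneg ht ht)]

theorem le_curv {t : ℝ} (ht : 0 ≤ t) (h1 : t ≤ 1) : t ≤ curv t := by
  rw [curv, le_div_iff₀ (by positivity)]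
  nlinarith [mul_nonneg ht (sub_nonneg.2 h1), mul_nonneg (mul_nonneg ht ht) (sub_nonneg.2 h1)]

/-- `t / (1 + t)²` increases only up to `t = 1`. This is where it matters that the norms in a vertex
chart are at most `1 / T`. -/
theorem curv_mono {s t : ℝ} (hs : 0 ≤ s) (h : s ≤ t) (h1 : t ≤ 1) : curv s ≤ curv t := by
  rw [curv, curv, div_le_div_iff₀ (by positivity) (by nlinarith)]
  have : 0 ≤ (t - s) * (1 - s * t) := mul_nonneg (by linarith) (by nlinarith)
  nlinarith

/-! ### Jets of the vertex potential -/

section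

variable {T : ℝ} {x v w : Fin 3 → ℝ}

/-- Every potential here is a sum of such terms: in logarithmic coordinates the square of a monomial
is the exponential of an affine function, so each term has a Hessian of rank one. -/
theorem hasJet_log_one_add_exp {E : Type*} [NormedAddCommGroup E] [NormedSpace ℝ E]
    (L : E →L[ℝ] ℝ) (c : ℝ) {t : ℝ} {x v w : E} (ht : t = Real.exp (2 * (L x + c))) :
    HasJet (fun y => Real.log (1 + Real.exp (2 * (L y + c)))) x v w (Real.log (1 + t))
      (slope t * L v) (slope t * L w) (curv t * L v * L w) := by
  have hpos : ∀ s : ℝ, 1 + Real.exp (2 * s) ≠ 0 := fun s => by positivity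
  have he : ∀ s : ℝ, HasDerivAt (fun s => Real.exp (2 * s)) (2 * Real.exp (2 * s)) s := by
    intro s
    have := ((hasDerivAt_id s).const_mul 2).exp
    simpa [mul_comm] using this
  have h1 : ∀ s : ℝ, HasDerivAt (fun s => Real.log (1 + Real.exp (2 * s)))
      (slope (Real.exp (2 * s))) s := fun s => by
    simpa [slope] using ((he s).const_add 1).log (hpos s)
  have h2 : ∀ s : ℝ, HasDerivAt (fun s => slope (Real.exp (2 * s))) (curv (Real.exp (2 * s))) s := by
    intro s
    refine (((he s).const_mul 2).div ((he s).const_add 1) (hpos s)).congr_deriv ?_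
    rw [curv]
    congr 1
    ring
  subst ht
  exact ((HasJet.affine L c x v w).comp (.of_forall h1) (h2 _)).congr_coeff rfl rfl rfl (by ring)

/-- The square of the norm of `T` times a coordinate. -/
noncomputable def sqNorm (T : ℝ) (x : Fin 3 → ℝ) (i : Fin 3) : ℝ := (T * Real.exp (x i)) ^ 2

theorem sqNorm_eq (hT : 0 < T) (x : Fin 3 → ℝ) (i : Fin 3) :
    sqNorm T x i = Real.exp (2 * (x i + Real.log T)) := by
  rw [sqNorm, two_mul, Real.exp_add, Real.exp_add, Real.exp_log hT]; ring

theorem sqNorm_mul_eq (hT : 0 < T) (x : Fin 3 → ℝ) (i j : Fin 3) :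
    sqNorm T x i * sqNorm T x j = Real.exp (2 * (x i + x j + 2 * Real.log T)) := by
  rw [sqNorm_eq hT, sqNorm_eq hT, ← Real.exp_add]; ring_nf

theorem sqNorm_mul_eq' (x : Fin 3 → ℝ) (i j : Fin 3) :
    (T ^ 2 * Real.exp (x i) * Real.exp (x j)) ^ 2 = sqNorm T x i * sqNorm T x j := by
  rw [sqNorm, sqNorm]; ring

theorem hasJet_log_one_add_sqNorm (hT : 0 < T) (i : Fin 3) :
    HasJet (fun y => Real.log (1 + sqNorm T y i)) x v w (Real.log (1 + sqNorm T x i))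
      (slope (sqNorm T x i) * v i) (slope (sqNorm T x i) * w i)
      (curv (sqNorm T x i) * v i * w i) :=
  (hasJet_log_one_add_exp (ContinuousLinearMap.proj (R := ℝ) (φ := fun _ : Fin 3 => ℝ) i)
    (Real.log T) (sqNorm_eq hT x i)).congr (.of_forall fun y => by simp [sqNorm_eq hT])

theorem hasJet_log_one_add_sqNorm_mul (hT : 0 < T) (i j : Fin 3) :
    HasJet (fun y => Real.log (1 + sqNorm T y i * sqNorm T y j)) x v w
      (Real.log (1 + sqNorm T x i * sqNorm T x j))
      (slope (sqNorm T x i * sqNorm T x j) * (v i + v j))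
      (slope (sqNorm T x i * sqNorm T x j) * (w i + w j))
      (curv (sqNorm T x i * sqNorm T x j) * (v i + v j) * (w i + w j)) :=
  (hasJet_log_one_add_exp
    (ContinuousLinearMap.proj (R := ℝ) (φ := fun _ : Fin 3 => ℝ) i +
      ContinuousLinearMap.proj (R := ℝ) (φ := fun _ : Fin 3 => ℝ) j)
    (2 * Real.log T) (sqNorm_mul_eq hT x i j)).congr
      (.of_forall fun y => by simp [sqNorm_mul_eq hT])

theorem sqNorm_pos (hT : 0 < T) (x : Fin 3 → ℝ) (i : Fin 3) : 0 < sqNorm T x i := by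
  unfold sqNorm; positivity

theorem phi_exp (hT : 0 < T) (y : Fin 3 → ℝ) (i j k : Fin 3) :
    phi T (Real.exp (y i)) (Real.exp (y j)) (Real.exp (y k)) =
      Real.log (1 + sqNorm T y i) - Real.log (1 + sqNorm T y j * sqNorm T y k) := by
  have h1 := sqNorm_pos hT y i
  have h2 := mul_pos (sqNorm_pos hT y j) (sqNorm_pos hT y k)
  rw [phi, sqNorm_mul_eq', ← sqNorm, Real.log_div (by positivity) (by positivity)]

theorem toricPotential_exp (hT : 0 < T) (y : Fin 3 → ℝ) (j k : Fin 3) :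
    toricPotential T (Real.exp (y j)) (Real.exp (y k)) =
      Real.log (1 + sqNorm T y j) + Real.log (1 + sqNorm T y k) +
        Real.log (1 + sqNorm T y j * sqNorm T y k) := by
  have h1 := sqNorm_pos hT y j
  have h2 := sqNorm_pos hT y k
  rw [toricPotential, sqNorm_mul_eq', ← sqNorm, ← sqNorm, Real.log_mul (by positivity)
    (by positivity), Real.log_mul (by positivity) (by positivity)]

theorem hasJet_phi (hT : 0 < T) (i j k : Fin 3) :
    HasJet (fun y => phi T (Real.exp (y i)) (Real.exp (y j)) (Real.exp (y k))) x v w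
      (Real.log (1 + sqNorm T x i) - Real.log (1 + sqNorm T x j * sqNorm T x k))
      (slope (sqNorm T x i) * v i - slope (sqNorm T x j * sqNorm T x k) * (v j + v k))
      (slope (sqNorm T x i) * w i - slope (sqNorm T x j * sqNorm T x k) * (w j + w k))
      (curv (sqNorm T x i) * v i * w i
        - curv (sqNorm T x j * sqNorm T x k) * (v j + v k) * (w j + w k)) :=
  ((hasJet_log_one_add_sqNorm hT i).sub (hasJet_log_one_add_sqNorm_mul hT j k)).congr
    (.of_forall fun y => phi_exp hT y i j k)

theorem hasJet_toricPotential (hT : 0 < T) (j k : Fin 3) :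
    ∃ a a₁ a₂, HasJet (fun y => toricPotential T (Real.exp (y j)) (Real.exp (y k))) x v w a a₁ a₂
      (curv (sqNorm T x j) * v j * w j + curv (sqNorm T x k) * v k * w k
        + curv (sqNorm T x j * sqNorm T x k) * (v j + v k) * (w j + w k)) :=
  ⟨_, _, _, (((hasJet_log_one_add_sqNorm hT j).add (hasJet_log_one_add_sqNorm hT k)).add
    (hasJet_log_one_add_sqNorm_mul hT j k)).congr
      (.of_forall fun y => toricPotential_exp hT y j k)⟩

end

/-! ### The potential for norms given in decreasing order -/

section Ordered

variable {T l p C : ℝ} (B : BumpFunctions T l p C)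

/-- `turning`, `radialVar`, `angularVar` and `vertexPotential` for norms `a`, `b`, `c` that are
given in decreasing order. -/
noncomputable def orderedTurning (a b : ℝ) : ℝ := B.α₆ (Real.logb T a - Real.logb T b)

noncomputable def orderedRadial (a b c : ℝ) : ℝ :=
  phi T a b c - (phi T b a c + phi T c a b) / 2 + 3 / 2 * orderedTurning B a b * phi T b a c

noncomputable def orderedPotential (a b c : ℝ) : ℝ :=
  toricPotential T b c - orderedTurning B a b * phi T b a c
    + B.α₃ (orderedRadial B a b c) * orderedRadial B a b c
    + B.α₄ (phi T b a c - phi T c a b) * B.α₅ (orderedRadial B a b c) *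
      (phi T b a c - phi T c a b - orderedTurning B a b * phi T b a c)

theorem vertexPotential_eq (r : Fin 3 → ℝ) :
    vertexPotential B r = orderedPotential B (hi r) (mid r) (lo r) := rfl

variable {E : Type*} [NormedAddCommGroup E] [NormedSpace ℝ E]

/-- This is the chain and product rule for abstract jets. The derived quantities are passed through
equations so that the mixed coefficient has the shape treated in `JetBounds.abs_mixed_sub_main_le`.
-/
theorem hasJet_potential_of {tor φa φb φc m : E → ℝ} {x v w : E}
    {g₀ g₁ g₂ g₁₂ a pa qa ha b pb qb hb c pc qc hc t m₁ m₂ m₁₂ : ℝ}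
    (hg : HasJet tor x v w g₀ g₁ g₂ g₁₂) (hφa : HasJet φa x v w a pa qa ha)
    (hφb : HasJet φb x v w b pb qb hb) (hφc : HasJet φc x v w c pc qc hc)
    (hm : HasJet m x v w t m₁ m₂ m₁₂) {d d₁ d₂ d₁₂ y₁ y₂ y₁₂ θ θ₁ θ₂ θ₁₂ X : ℝ}
    (hy₁ : y₁ = m₁ * b + t * pb) (hy₂ : y₂ = m₂ * b + t * qb)
    (hy₁₂ : y₁₂ = m₁₂ * b + m₁ * qb + m₂ * pb + t * hb)
    (hd : d = a - (b + c) / 2 + 3 / 2 * (t * b))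
    (hd₁ : d₁ = pa - (pb + pc) / 2 + 3 / 2 * y₁) (hd₂ : d₂ = qa - (qb + qc) / 2 + 3 / 2 * y₂)
    (hd₁₂ : d₁₂ = ha - (hb + hc) / 2 + 3 / 2 * y₁₂)
    (hθ : θ = b - c) (hθ₁ : θ₁ = pb - pc) (hθ₂ : θ₂ = qb - qc) (hθ₁₂ : θ₁₂ = hb - hc)
    (hX : X = b - c - t * b) :
    ∃ F₀ F₁ F₂, HasJet (fun y => tor y - m y * φb y
        + B.α₃ (φa y - (φb y + φc y) / 2 + 3 / 2 * m y * φb y)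
          * (φa y - (φb y + φc y) / 2 + 3 / 2 * m y * φb y)
        + B.α₄ (φb y - φc y) * B.α₅ (φa y - (φb y + φc y) / 2 + 3 / 2 * m y * φb y)
          * (φb y - φc y - m y * φb y)) x v w F₀ F₁ F₂
      (g₁₂ - y₁₂
        + ((deriv (deriv B.α₃) d * d₁ * d₂ + deriv B.α₃ d * d₁₂) * d + deriv B.α₃ d * d₁ * d₂
          + deriv B.α₃ d * d₂ * d₁ + B.α₃ d * d₁₂)
        + ((((deriv (deriv B.α₄) θ * θ₁ * θ₂ + deriv B.α₄ θ * θ₁₂) * B.α₅ d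
            + deriv B.α₄ θ * θ₁ * (deriv B.α₅ d * d₂) + deriv B.α₄ θ * θ₂ * (deriv B.α₅ d * d₁)
            + B.α₄ θ * (deriv (deriv B.α₅) d * d₁ * d₂ + deriv B.α₅ d * d₁₂)) * X
          + (deriv B.α₄ θ * θ₁ * B.α₅ d + B.α₄ θ * (deriv B.α₅ d * d₁)) * (θ₂ - y₂)
          + (deriv B.α₄ θ * θ₂ * B.α₅ d + B.α₄ θ * (deriv B.α₅ d * d₂)) * (θ₁ - y₁)
          + B.α₄ θ * B.α₅ d * (θ₁₂ - y₁₂)))) := by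
  have hY := (hm.mul hφb).congr_coeff rfl hy₁.symm hy₂.symm hy₁₂.symm
  have hR : HasJet (fun y => φa y - (φb y + φc y) / 2 + 3 / 2 * m y * φb y) x v w d d₁ d₂ d₁₂ :=
    (((hφa.sub ((hφb.add hφc).const_mul (1 / 2))).add (hY.const_mul (3 / 2))).congr
      (.of_forall fun y => by ring)).congr_coeff (by rw [hd]; ring) (by rw [hd₁]; ring)
      (by rw [hd₂]; ring) (by rw [hd₁₂]; ring)
  have hΘ := (hφb.sub hφc).congr_coeff hθ.symm hθ₁.symm hθ₂.symm hθ₁₂.symm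
  have hXj := (hΘ.sub hY).congr_coeff (b := X) (by rw [hX, hθ]) rfl rfl rfl
  exact ⟨_, _, _, ((hg.sub hY).add ((hR.comp_contDiff B.smooth₃).mul hR)).add
    (((hΘ.comp_contDiff B.smooth₄).mul (hR.comp_contDiff B.smooth₅)).mul hXj)⟩

theorem hasJet_orderedTurning {x v w : Fin 3 → ℝ} (i j : Fin 3) :
    HasJet (fun y : Fin 3 → ℝ => orderedTurning B (Real.exp (y i)) (Real.exp (y j))) x v w
      (orderedTurning B (Real.exp (x i)) (Real.exp (x j)))
      (deriv B.α₆ ((x i - x j) / Real.log T) * ((v i - v j) / Real.log T))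
      (deriv B.α₆ ((x i - x j) / Real.log T) * ((w i - w j) / Real.log T))
      (deriv (deriv B.α₆) ((x i - x j) / Real.log T) * ((v i - v j) / Real.log T)
        * ((w i - w j) / Real.log T)) := by
  have e : ∀ y : Fin 3 → ℝ, orderedTurning B (Real.exp (y i)) (Real.exp (y j)) =
      B.α₆ ((y i - y j) / Real.log T) := by
    intro y
    simp only [orderedTurning, Real.logb, Real.log_exp, sub_div]
  have h := (HasJet.affine ((Real.log T)⁻¹ •
    (ContinuousLinearMap.proj (R := ℝ) (φ := fun _ : Fin 3 => ℝ) i -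
      ContinuousLinearMap.proj (R := ℝ) (φ := fun _ : Fin 3 => ℝ) j)) 0 x v w)
  have h' : HasJet (fun y : Fin 3 → ℝ => (y i - y j) / Real.log T) x v w
      ((x i - x j) / Real.log T) ((v i - v j) / Real.log T) ((w i - w j) / Real.log T) 0 :=
    (h.congr (.of_forall fun y => by simp [div_eq_inv_mul])).congr_coeff
      (by simp [div_eq_inv_mul]) (by simp [div_eq_inv_mul]) (by simp [div_eq_inv_mul]) rfl
  exact ((h'.comp_contDiff B.smooth₆).congr (.of_forall e)).congr_coeff (e x).symm rfl rfl
    (by ring)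

end Ordered

/-! ### Admissible parameters and the size of the bump functions -/

/-- The conditions on `T` and `l` under which the fibres are symplectic. -/
structure Admissible (T l p C : ℝ) : Prop where
  T_pos : 0 < T
  T_le : T ≤ 1 / 100
  p_gt : 16 < p
  p_le : p ≤ l
  gap : 1 ≤ l * (1 / 4 - 4 / p)
  one_le_log : 1 ≤ -Real.log T
  C_le : C ≤ 1 / 1000000 * (-Real.log T)

/-- The bound for the logarithmic derivatives of the bump functions. -/
noncomputable def slowness (T l C : ℝ) : ℝ := C / (l * (-Real.log T))

section Bumps

variable {T l p C : ℝ}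

theorem Admissible.l_pos (hp : Admissible T l p C) : 0 < l := by linarith [hp.p_gt, hp.p_le]

theorem Admissible.log_neg (hp : Admissible T l p C) : Real.log T < 0 := by linarith [hp.one_le_log]

theorem Admissible.one_le_mul (hp : Admissible T l p C) : 1 ≤ l * (-Real.log T) := by
  nlinarith [hp.p_gt, hp.p_le, hp.one_le_log]

theorem Admissible.C_nonneg (hp : Admissible T l p C) (B : BumpFunctions T l p C) : 0 ≤ C := by
  have := (abs_nonneg _).trans (B.slow₃ 0).1
  have h := hp.l_pos
  by_contra hC
  have : C / l < 0 := div_neg_of_neg_of_pos (by linarith) h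
  linarith

theorem Admissible.slowness_nonneg (hp : Admissible T l p C) (B : BumpFunctions T l p C) : 0 ≤ slowness T l C :=
  div_nonneg (hp.C_nonneg B) (by linarith [hp.one_le_mul])

theorem Admissible.slowness_le (hp : Admissible T l p C) : slowness T l C ≤ 1 / 1000000 := by
  rw [slowness, div_le_iff₀ (by linarith [hp.one_le_mul])]
  have h1 := hp.C_le
  have h2 : (-Real.log T) ≤ l * (-Real.log T) := by
    nlinarith [hp.p_gt, hp.p_le, hp.one_le_log]
  linarith

theorem Admissible.second_slowness_le (hp : Admissible T l p C) (B : BumpFunctions T l p C) : C / l ^ 2 / Real.log T ^ 2 ≤ slowness T l C := by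
  have h := hp.one_le_mul
  have hC := hp.C_nonneg B
  rw [slowness, div_div]
  apply div_le_div_of_nonneg_left hC (by linarith)
  nlinarith

/-- The second derivative with respect to `log_T s` is `(log T)² (s α' + s² α'')`. Subtracting the
bound for `s α'` isolates `s² α''` and accounts for the factor `2`. -/
theorem Admissible.slow_bounds (hp : Admissible T l p C) (hB : BumpFunctions T l p C) {α : ℝ → ℝ} (hα : ContDiff ℝ ∞ α) {s : ℝ}
    (h : |derivLogT T α s| ≤ C / l ∧ |derivLogT T (derivLogT T α) s| ≤ C / l ^ 2) :
    |deriv α s| * |s| ≤ slowness T l C ∧ |deriv (deriv α) s| * s ^ 2 ≤ 2 * slowness T l C := by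
  have hL : 0 < -Real.log T := by linarith [hp.log_neg]
  have hl := hp.l_pos
  have hLa : |Real.log T| = -Real.log T := abs_of_neg hp.log_neg
  have h1 : |s * deriv α s| ≤ slowness T l C := by
    have := h.1
    rw [derivLogT, abs_mul, hLa] at this
    rw [slowness, ← div_div, le_div_iff₀ hL]
    linarith
  have hα' : ContDiff ℝ ∞ (deriv α) := ((contDiff_infty_iff_deriv (𝕜 := ℝ)).1 hα).2
  have h2 : derivLogT T (derivLogT T α) s =
      Real.log T ^ 2 * (s * deriv α s + s ^ 2 * deriv (deriv α) s) := by
    have : HasDerivAt (derivLogT T α)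
        (Real.log T * (1 * deriv α s + s * deriv (deriv α) s)) s :=
      ((hasDerivAt_id s).mul (hα'.differentiable (by simp) s).hasDerivAt).const_mul _
    rw [derivLogT, this.deriv]
    ring
  have h3 : |s * deriv α s + s ^ 2 * deriv (deriv α) s| ≤ slowness T l C := by
    have := h.2
    rw [h2, abs_mul, abs_of_nonneg (sq_nonneg _)] at this
    refine le_trans ?_ (hp.second_slowness_le hB)
    rw [le_div_iff₀ (by nlinarith)]
    linarith
  refine ⟨by rwa [← abs_mul, mul_comm], ?_⟩
  have h4 : |s ^ 2 * deriv (deriv α) s| ≤ 2 * slowness T l C := by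
    have := abs_sub (s * deriv α s + s ^ 2 * deriv (deriv α) s) (s * deriv α s)
    rw [add_sub_cancel_left] at this
    linarith
  rwa [abs_mul, abs_of_nonneg (sq_nonneg s), mul_comm] at h4

theorem BumpFunctions.α₃_mem (B : BumpFunctions T l p C) (s : ℝ) :
    2 / 3 ≤ B.α₃ s ∧ B.α₃ s ≤ 1 := by
  constructor
  · rw [← B.start₃ _ (min_le_right s _)]; exact B.mono₃ (min_le_left _ _)
  · rw [← B.end₃ _ (le_max_right s _)]; exact B.mono₃ (le_max_left _ _)

theorem BumpFunctions.α₅_mem (B : BumpFunctions T l p C) (s : ℝ) :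
    0 ≤ B.α₅ s ∧ B.α₅ s ≤ 1 := by
  constructor
  · rw [← B.start₅ _ (min_le_right s _)]; exact B.mono₅ (min_le_left _ _)
  · rw [← B.end₅ _ (le_max_right s _)]; exact B.mono₅ (le_max_left _ _)

theorem BumpFunctions.α₆_mem (B : BumpFunctions T l p C) (s : ℝ) :
    0 ≤ B.α₆ s ∧ B.α₆ s ≤ 1 := by
  constructor
  · rw [← B.start₆ _ (min_le_right s _)]; exact B.mono₆ (min_le_left _ _)
  · rw [← B.end₆ _ (le_max_right s _)]; exact B.mono₆ (le_max_left _ _)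

theorem BumpFunctions.α₄_mem (B : BumpFunctions T l p C) {s : ℝ} (hs : 0 ≤ s) :
    0 ≤ B.α₄ s ∧ B.α₄ s ≤ 1 / 2 := by
  constructor
  · have h0 : B.α₄ 0 = 0 := by have := B.odd₄ 0; rw [neg_zero] at this; linarith
    rw [← h0]; exact B.mono₄ hs
  · rw [← B.end₄ _ (le_max_right s _)]; exact B.mono₄ (le_max_left _ _)

end Bumps

/-! ### Points with ordered coordinates -/

/-- `φ_b` and its companions in terms of the squares `t` of `T` times the norms. -/
noncomputable def phiSq (t u v : ℝ) : ℝ := Real.log (1 + t) - Real.log (1 + u * v)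

/-- Three squared norms in decreasing order, with small product. -/
structure Ordered (ta tb tc : ℝ) : Prop where
  tc_pos : 0 < tc
  tc_le : tc ≤ tb
  tb_le : tb ≤ ta
  ta_le : ta ≤ 1
  tc_small : tc ≤ 1 / 100

namespace Ordered

variable {ta tb tc m : ℝ}

theorem tb_pos (h : Ordered ta tb tc) : 0 < tb := by linarith [h.tc_pos, h.tc_le]
theorem ta_pos (h : Ordered ta tb tc) : 0 < ta := by linarith [h.tb_pos, h.tb_le]

theorem phib_nonneg (h : Ordered ta tb tc) : 0 ≤ phiSq tb ta tc := by
  have := log_one_add_mono (mul_pos h.ta_pos h.tc_pos).le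
    (by nlinarith [h.ta_le, h.tc_pos, h.tc_le] : ta * tc ≤ tb)
  unfold phiSq; linarith

theorem phib_le (h : Ordered ta tb tc) : phiSq tb ta tc ≤ tb := by
  have h1 := log_one_add_le h.tb_pos.le
  have h2 := log_one_add_nonneg (mul_pos h.ta_pos h.tc_pos).le
  unfold phiSq; linarith

theorem abs_phic_le (h : Ordered ta tb tc) : |phiSq tc ta tb| ≤ tb := by
  have h1 := log_one_add_le h.tc_pos.le
  have h2 := log_one_add_nonneg (mul_pos h.ta_pos h.tb_pos).le
  have h3 := log_one_add_le (mul_pos h.ta_pos h.tb_pos).le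
  have h4 := log_one_add_nonneg h.tc_pos.le
  have h5 : ta * tb ≤ tb := by nlinarith [h.ta_le, h.tb_pos]
  have h6 := h.tc_le
  unfold phiSq
  rw [abs_le]; constructor <;> linarith

theorem phia_le (h : Ordered ta tb tc) : phiSq ta tb tc ≤ ta := by
  have h1 := log_one_add_le h.ta_pos.le
  have h2 := log_one_add_nonneg (mul_pos h.tb_pos h.tc_pos).le
  unfold phiSq; linarith

theorem le_phia (h : Ordered ta tb tc) : ta / 2 ≤ phiSq ta tb tc := by
  have h1 := le_log_one_add h.ta_pos.le h.ta_le
  have h2 := log_one_add_le (mul_pos h.tb_pos h.tc_pos).le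
  have h3 : tb * tc ≤ ta * (1 / 100) :=
    mul_le_mul h.tb_le h.tc_small h.tc_pos.le h.ta_pos.le
  unfold phiSq; linarith [h.ta_pos]

theorem phic_le_phib (h : Ordered ta tb tc) : phiSq tc ta tb ≤ phiSq tb ta tc := by
  have h1 := log_one_add_mono h.tc_pos.le h.tc_le
  have h2 := log_one_add_mono (mul_pos h.ta_pos h.tc_pos).le
    (mul_le_mul_of_nonneg_left h.tc_le h.ta_pos.le)
  unfold phiSq; linarith

/-- The radial variable is comparable to the largest squared norm. -/
theorem le_radial (h : Ordered ta tb tc) (hm : 0 ≤ m) (hm1 : m = 1 ∨ tb ≤ ta / 100) :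
    ta / 4 ≤ phiSq ta tb tc - (phiSq tb ta tc + phiSq tc ta tb) / 2
      + 3 / 2 * (m * phiSq tb ta tc) := by
  have h1 := h.le_phia
  have h2 := h.phib_nonneg
  have h3 := h.phib_le
  have h4 := h.phic_le_phib
  have h5 := h.ta_pos
  -- For `m = 1` the expression is `φ_a + φ_b - φ_c / 2`, and `φ_c ≤ φ_b` makes it at least `φ_a`.
  -- Otherwise `φ_b` and `φ_c` are at most `ta / 100`, negligible against `φ_a ≥ ta / 2`.
  rcases hm1 with rfl | hm1
  · linarith
  · have := mul_nonneg hm h2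
    linarith

theorem abs_radial_le (h : Ordered ta tb tc) (hm : 0 ≤ m) (hm1 : m ≤ 1) :
    |phiSq ta tb tc - (phiSq tb ta tc + phiSq tc ta tb) / 2
      + 3 / 2 * (m * phiSq tb ta tc)| ≤ 3 * ta := by
  have h1 := h.le_phia
  have h0 := h.phia_le
  have h2 := h.phib_nonneg
  have h3 := h.phib_le
  have h4 := abs_le.1 h.abs_phic_le
  have h5 := h.ta_pos
  have h6 := h.tb_le
  have h7 : m * phiSq tb ta tc ≤ phiSq tb ta tc := by nlinarith
  have h8 := mul_nonneg hm h2
  rw [abs_le]; constructor <;> linarith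

theorem angular_le (h : Ordered ta tb tc) : phiSq tb ta tc - phiSq tc ta tb ≤ 2 * tb := by
  linarith [h.phib_le, (abs_le.1 h.abs_phic_le).1]

theorem le_angular (h : Ordered ta tb tc) :
    2 / 3 * tb - tc ≤ phiSq tb ta tc - phiSq tc ta tb := by
  have h1 := le_log_one_add h.tb_pos.le (h.tb_le.trans h.ta_le)
  have h2 := log_one_add_mono (mul_pos h.ta_pos h.tc_pos).le
    (mul_le_mul_of_nonneg_left h.tc_le h.ta_pos.le)
  have h3 := log_one_add_le h.tc_pos.le
  unfold phiSq; linarith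

end Ordered

/-- The coordinates at `x`, given by the logarithms of their norms, are in decreasing order `i`,
`j`, `k`, at most `1 / T`, and lie on the fibre over the circle of radius `T ^ l`. -/
structure SortedPoint (T l : ℝ) (x : Fin 3 → ℝ) (i j k : Fin 3) : Prop where
  ne_ij : i ≠ j
  ne_ik : i ≠ k
  ne_jk : j ≠ k
  le_ji : x j ≤ x i
  le_kj : x k ≤ x j
  le_log : x i + Real.log T ≤ 0
  sum_eq : x i + x j + x k = l * Real.log T

theorem rpow_eq_exp {T : ℝ} (hT : 0 < T) (e : ℝ) : T ^ e = Real.exp (e * Real.log T) := by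
  rw [Real.rpow_def_of_pos hT, mul_comm]

theorem sqNorm_mono {T : ℝ} (hT : 0 < T) {x : Fin 3 → ℝ} {i j : Fin 3} (h : x j ≤ x i) :
    sqNorm T x j ≤ sqNorm T x i := by
  rw [sqNorm_eq hT, sqNorm_eq hT]
  apply Real.exp_le_exp.2; linarith

section Points

variable {T l p C : ℝ} {x : Fin 3 → ℝ} {i j k : Fin 3}

theorem SortedPoint.prod_eq (hx : SortedPoint T l x i j k) (hp : Admissible T l p C) :
    sqNorm T x i * sqNorm T x j * sqNorm T x k = T ^ (2 * l + 6) := by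
  rw [sqNorm_eq hp.T_pos, sqNorm_eq hp.T_pos, sqNorm_eq hp.T_pos, ← Real.exp_add, ← Real.exp_add,
    rpow_eq_exp hp.T_pos]
  congr 1
  linear_combination 2 * hx.sum_eq

theorem SortedPoint.ordered (hx : SortedPoint T l x i j k) (hp : Admissible T l p C) :
    Ordered (sqNorm T x i) (sqNorm T x j) (sqNorm T x k) where
  tc_pos := sqNorm_pos hp.T_pos x k
  tc_le := sqNorm_mono hp.T_pos hx.le_kj
  tb_le := sqNorm_mono hp.T_pos hx.le_ji
  ta_le := by
    rw [sqNorm_eq hp.T_pos, Real.exp_le_one_iff]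
    linarith [hx.le_log]
  tc_small := by
    -- The three logarithms sum to `l log T < 0`, so the smallest is negative.
    have h1 : x k + Real.log T ≤ Real.log T := by
      have := hx.sum_eq
      have := hp.l_pos
      have := hp.log_neg
      nlinarith [hx.le_ji, hx.le_kj]
    rw [sqNorm_eq hp.T_pos]
    calc Real.exp (2 * (x k + Real.log T)) ≤ Real.exp (Real.log T) :=
          Real.exp_le_exp.2 (by linarith [hp.log_neg])
      _ = T := Real.exp_log hp.T_pos
      _ ≤ 1 / 100 := hp.T_le

/-- Either `α₆ = 1` or the two larger norms differ by a large factor. -/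
theorem Admissible.turning_eq_one_or (hp : Admissible T l p C) (B : BumpFunctions T l p C)
    (x : Fin 3 → ℝ) (i j : Fin 3) :
    orderedTurning B (Real.exp (x i)) (Real.exp (x j)) = 1 ∨
      sqNorm T x j ≤ sqNorm T x i / 100 := by
  simp only [orderedTurning, Real.logb, Real.log_exp]
  by_cases h : -(l / 8 - 2 * l / p) ≤ x i / Real.log T - x j / Real.log T
  · exact .inl (B.end₆ _ h)
  · right
    have hL := hp.log_neg
    have hg : l * (1 / 4 - 4 / p) = 2 * (l / 8 - 2 * l / p) := by ring
    have hg' := hp.gap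
    rw [hg] at hg'
    rw [not_le, ← sub_div, div_lt_iff_of_neg hL] at h
    -- By `gap` the transition of `α₆` to `1` ends at `log_T b - log_T a ≥ 1/2`. Beyond it the
    -- squares differ by a factor of at most `T`.
    have h1 : 2 * (x j + Real.log T) ≤ Real.log T + 2 * (x i + Real.log T) := by nlinarith
    rw [sqNorm_eq hp.T_pos, sqNorm_eq hp.T_pos]
    calc Real.exp (2 * (x j + Real.log T)) ≤ Real.exp (Real.log T + 2 * (x i + Real.log T)) :=
          Real.exp_le_exp.2 h1
      _ = T * Real.exp (2 * (x i + Real.log T)) := by rw [Real.exp_add, Real.exp_log hp.T_pos]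
      _ ≤ _ := by nlinarith [hp.T_le, Real.exp_pos (2 * (x i + Real.log T))]

theorem rpow_le_rpow_of_le {T a b : ℝ} (hp : Admissible T l p C) (h : a ≤ b) : T ^ b ≤ T ^ a :=
  Real.rpow_le_rpow_of_exponent_ge hp.T_pos (by linarith [hp.T_le]) h

/-- Where `α₄` and `α₅` may vary, the smallest norm is much smaller than the middle one. -/
theorem SortedPoint.le_angular (hx : SortedPoint T l x i j k) (hp : Admissible T l p C)
    {d θ : ℝ} (hd : radialStart T l ≤ d) (hd' : d ≤ 3 * sqNorm T x i)
    (hθ : angularStart T l ≤ θ) (hθ' : θ ≤ 2 * sqNorm T x j) :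
    sqNorm T x k ≤ sqNorm T x j / 4 := by
  have ho := hx.ordered hp
  have hprod := hx.prod_eq hp
  set ta := sqNorm T x i
  set tb := sqNorm T x j
  set tc := sqNorm T x k
  have hT := hp.T_pos
  have h1 : T ^ (l / 2 + 2) ≤ 3 * ta := hd.trans hd'
  have h2 : T ^ (3 * l / 4 + 3 / 2) ≤ 2 * tb := hθ.trans hθ'
  by_contra! hlt
  -- The exponents on the right add up to `2 l + 5`, leaving one factor `T`. If `tc > tb / 4`, the
  -- product `ta tb tc = T ^ (2 l + 6)` would exceed `ta tb² / 4`, but it is at most `12 T ta tb²`.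
  -- The offset `3 / 2` in `angularStart` provides this factor.
  have e : T ^ (2 * l + 6) = T * (T ^ (l / 2 + 2) * (T ^ (3 * l / 4 + 3 / 2) *
      T ^ (3 * l / 4 + 3 / 2))) := by
    nth_rw 2 [← Real.rpow_one T]
    rw [← Real.rpow_add hT, ← Real.rpow_add hT, ← Real.rpow_add hT]
    congr 1; ring
  have h3 : T ^ (l / 2 + 2) * (T ^ (3 * l / 4 + 3 / 2) * T ^ (3 * l / 4 + 3 / 2)) ≤
      3 * ta * (2 * tb * (2 * tb)) := by
    have := Real.rpow_pos_of_pos hT (l / 2 + 2)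
    have := Real.rpow_pos_of_pos hT (3 * l / 4 + 3 / 2)
    have := ho.ta_pos
    have := ho.tb_pos
    gcongr
  have h4 : ta * tb * (tb / 4) ≤ ta * tb * tc :=
    mul_le_mul_of_nonneg_left hlt.le (mul_pos ho.ta_pos ho.tb_pos).le
  have h5 : 0 < ta * (tb * tb) := mul_pos ho.ta_pos (mul_pos ho.tb_pos ho.tb_pos)
  have h6 := mul_le_mul_of_nonneg_left h3 hT.le
  have h7 : T * (ta * (tb * tb)) ≤ 1 / 100 * (ta * (tb * tb)) :=
    mul_le_mul_of_nonneg_right hp.T_le h5.le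
  rw [← e] at h6
  linarith

/-- Where the two larger norms agree, either the point is close to the vertex or the angular
variable is beyond the interval of variation of `α₄`. -/
theorem SortedPoint.angularEnd_lt (hx : SortedPoint T l x i j k) (hp : Admissible T l p C)
    (hij : x i = x j) (hd : radialStart T l ≤ 3 * sqNorm T x i) :
    angularEnd T l p < phiSq (sqNorm T x j) (sqNorm T x i) (sqNorm T x k)
      - phiSq (sqNorm T x k) (sqNorm T x i) (sqNorm T x j) := by
  have ho := hx.ordered hp
  have hprod := hx.prod_eq hp
  refine lt_of_lt_of_le ?_ ho.le_angular
  have hb : sqNorm T x j = sqNorm T x i := by rw [sqNorm, sqNorm, hij]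
  rw [hb] at hprod ⊢
  set ta := sqNorm T x i
  set tc := sqNorm T x k
  have hT := hp.T_pos
  have hs := Real.rpow_pos_of_pos hT (l / 2 + 2)
  rw [radialStart] at hd
  have hl : 16 < l := hp.p_gt.trans_le hp.p_le
  have hg := hp.gap
  have hg' : l * (1 / 4 - 4 / p) = 2 * (l / 8 - 2 * l / p) := by ring
  rw [hg'] at hg
  -- With `S = T ^ (l / 2 + 2) ≤ 3 ta`, both `angularEnd` and `tc` are of order `T S`, so `2 ta / 3
  -- - tc` beats `angularEnd`. The bound on `tc` comes from `tc = T ^ (2 l + 6) / ta²`.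
  have e1 : angularEnd T l p ≤ T * T ^ (l / 2 + 2) := by
    rw [angularEnd]
    nth_rw 2 [← Real.rpow_one T]
    rw [← Real.rpow_add hT]
    exact rpow_le_rpow_of_le hp (by linarith)
  have e2 : T ^ (2 * l + 6) ≤ T * (T ^ (l / 2 + 2) * (T ^ (l / 2 + 2) * T ^ (l / 2 + 2))) := by
    nth_rw 2 [← Real.rpow_one T]
    rw [← Real.rpow_add hT, ← Real.rpow_add hT, ← Real.rpow_add hT]
    exact rpow_le_rpow_of_le hp (by linarith)
  have h3 : T ^ (l / 2 + 2) * (T ^ (l / 2 + 2) * T ^ (l / 2 + 2)) ≤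
      T ^ (l / 2 + 2) * (3 * ta * (3 * ta)) := by
    have := ho.ta_pos
    gcongr
  have h4 : tc ≤ 9 * (T * T ^ (l / 2 + 2)) := by
    have h5 : 0 < ta * ta := mul_pos ho.ta_pos ho.ta_pos
    refine le_of_mul_le_mul_left ?_ h5
    have := mul_le_mul_of_nonneg_left h3 hT.le
    linarith
  have h5 : T * T ^ (l / 2 + 2) ≤ 1 / 100 * T ^ (l / 2 + 2) :=
    mul_le_mul_of_nonneg_right hp.T_le hs.le
  linarith

/-- Where the two smaller norms agree, either the largest norm is much larger or the point is close
to the vertex. -/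
theorem SortedPoint.lt_radialStart (hx : SortedPoint T l x i j k) (hp : Admissible T l p C)
    (hjk : x j = x k) (h : -(l / 8 - l / p) ≤ (x i - x j) / Real.log T) :
    3 * sqNorm T x i < radialStart T l := by
  have hT := hp.T_pos
  have hL := hp.log_neg
  have hl := hp.l_pos
  rw [le_div_iff_of_neg hL] at h
  have hs := hx.sum_eq
  have hlp : 1 ≤ l / p := by rw [le_div_iff₀ (by linarith [hp.p_gt])]; linarith [hp.p_le]
  -- As `x j = x k`, the fibre equation reads `3 x i = l log T + 2 (x i - x j)`. The margin `l / p ≥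
  -- 1` in the range of `α₆` yields an extra factor `T`, which absorbs the constant `3`.
  have h1 : 2 * (x i + Real.log T) ≤ (l / 2 + 2) * Real.log T + Real.log T := by
    nlinarith
  rw [sqNorm_eq hT, radialStart, rpow_eq_exp hT]
  have h2 : Real.exp (2 * (x i + Real.log T)) ≤ T * Real.exp ((l / 2 + 2) * Real.log T) := by
    calc Real.exp (2 * (x i + Real.log T)) ≤ _ := Real.exp_le_exp.2 h1
      _ = _ := by rw [Real.exp_add, Real.exp_log hT, mul_comm]
  nlinarith [hp.T_le, Real.exp_pos ((l / 2 + 2) * Real.log T)]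

end Points

/-! ### The second derivative of the vertex potential at a sorted point -/

/-- The derivative of `φ_i` along `v`. -/
noncomputable def phiSlope (T : ℝ) (x v : Fin 3 → ℝ) (i j k : Fin 3) : ℝ :=
  slope (sqNorm T x i) * v i - slope (sqNorm T x j * sqNorm T x k) * (v j + v k)

/-- The second derivative of `φ_i` along `v`, `w`. -/
noncomputable def phiCurv (T : ℝ) (x v w : Fin 3 → ℝ) (i j k : Fin 3) : ℝ :=
  curv (sqNorm T x i) * v i * w i
    - curv (sqNorm T x j * sqNorm T x k) * (v j + v k) * (w j + w k)

/-- The second derivative of `log (1 + |T x|²) (1 + |T y|²) (1 + |T z|²)`. -/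
noncomputable def totalCurv (T : ℝ) (x v w : Fin 3 → ℝ) (i j k : Fin 3) : ℝ :=
  curv (sqNorm T x i) * v i * w i + curv (sqNorm T x j) * v j * w j
    + curv (sqNorm T x k) * v k * w k

/-- The second derivative of the vertex potential if the bump functions were constant. -/
noncomputable def mainCurv (T : ℝ) (x v w : Fin 3 → ℝ) (i j k : Fin 3) (D A m : ℝ) : ℝ :=
  totalCurv T x v w i j k - phiCurv T x v w i j k - m * phiCurv T x v w j i k
    + D * (phiCurv T x v w i j k - (phiCurv T x v w j i k + phiCurv T x v w k i j) / 2
      + 3 / 2 * (m * phiCurv T x v w j i k))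
    + A * (phiCurv T x v w j i k - phiCurv T x v w k i j - m * phiCurv T x v w j i k)

section

variable {T l p C : ℝ} {x v w : Fin 3 → ℝ} {i j k : Fin 3} {B : BumpFunctions T l p C}

/-- `JetBounds` for the jets of the functions entering the vertex potential at `x`. -/
def PointBounds (B : BumpFunctions T l p C) (x v w : Fin 3 → ℝ) (i j k : Fin 3)
    (R z₁ x₁ z₂ x₂ : ℝ) : Prop :=
  JetBounds (sqNorm T x i) (sqNorm T x j) R (slowness T l C) z₁ x₁ z₂ x₂
    (phiSq (sqNorm T x j) (sqNorm T x i) (sqNorm T x k))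
    (phiSq (sqNorm T x k) (sqNorm T x i) (sqNorm T x j))
    (phiSlope T x v i j k) (phiSlope T x v j i k) (phiSlope T x v k i j)
    (phiSlope T x w i j k) (phiSlope T x w j i k) (phiSlope T x w k i j)
    (phiCurv T x v w i j k) (phiCurv T x v w j i k) (phiCurv T x v w k i j)
    (orderedTurning B (Real.exp (x i)) (Real.exp (x j)))
    (deriv B.α₆ ((x i - x j) / Real.log T) * ((v i - v j) / Real.log T))
    (deriv B.α₆ ((x i - x j) / Real.log T) * ((w i - w j) / Real.log T))
    (deriv (deriv B.α₆) ((x i - x j) / Real.log T) * ((v i - v j) / Real.log T)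
        * ((w i - w j) / Real.log T))

theorem hasJet_phi' (hT : 0 < T) (i j k : Fin 3) :
    HasJet (fun y => phi T (Real.exp (y i)) (Real.exp (y j)) (Real.exp (y k))) x v w
      (phiSq (sqNorm T x i) (sqNorm T x j) (sqNorm T x k)) (phiSlope T x v i j k)
      (phiSlope T x w i j k) (phiCurv T x v w i j k) := hasJet_phi hT i j k

/-- `g_{bc}` is the symmetric function `log (1 + |T a|²)(1 + |T b|²)(1 + |T c|²)` minus `φ_a`. Thus
the potentials of the three tiles differ from one common function by `φ_a`, `φ_b`, `φ_c`. -/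
theorem hasJet_toricPotential' (hT : 0 < T) (i j k : Fin 3) :
    ∃ a a₁ a₂, HasJet (fun y => toricPotential T (Real.exp (y j)) (Real.exp (y k))) x v w a a₁ a₂
      (totalCurv T x v w i j k - phiCurv T x v w i j k) := by
  obtain ⟨a, a₁, a₂, h⟩ := hasJet_toricPotential (x := x) (v := v) (w := w) hT j k
  refine ⟨a, a₁, a₂, h.congr_coeff rfl rfl rfl ?_⟩
  rw [totalCurv, phiCurv]
  ring

theorem orderedRadial_exp (hT : 0 < T) (B : BumpFunctions T l p C) (x : Fin 3 → ℝ)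
    (i j k : Fin 3) :
    orderedRadial B (Real.exp (x i)) (Real.exp (x j)) (Real.exp (x k)) =
      phiSq (sqNorm T x i) (sqNorm T x j) (sqNorm T x k)
        - (phiSq (sqNorm T x j) (sqNorm T x i) (sqNorm T x k)
            + phiSq (sqNorm T x k) (sqNorm T x i) (sqNorm T x j)) / 2
        + 3 / 2 * (orderedTurning B (Real.exp (x i)) (Real.exp (x j))
            * phiSq (sqNorm T x j) (sqNorm T x i) (sqNorm T x k)) := by
  rw [orderedRadial, phi_exp hT, phi_exp hT, phi_exp hT]
  unfold phiSq
  ring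

theorem angular_exp (hT : 0 < T) (x : Fin 3 → ℝ) (i j k : Fin 3) :
    phi T (Real.exp (x j)) (Real.exp (x i)) (Real.exp (x k))
      - phi T (Real.exp (x k)) (Real.exp (x i)) (Real.exp (x j)) =
      phiSq (sqNorm T x j) (sqNorm T x i) (sqNorm T x k)
        - phiSq (sqNorm T x k) (sqNorm T x i) (sqNorm T x j) := by
  rw [phi_exp hT, phi_exp hT]
  unfold phiSq
  ring

theorem SortedPoint.le_radial (hx : SortedPoint T l x i j k) (hp : Admissible T l p C)
    (B : BumpFunctions T l p C) :
    sqNorm T x i / 4 ≤ orderedRadial B (Real.exp (x i)) (Real.exp (x j)) (Real.exp (x k)) := by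
  rw [orderedRadial_exp hp.T_pos]
  exact (hx.ordered hp).le_radial (B.α₆_mem _).1 (hp.turning_eq_one_or B x i j)

theorem SortedPoint.abs_radial_le (hx : SortedPoint T l x i j k) (hp : Admissible T l p C)
    (B : BumpFunctions T l p C) :
    |orderedRadial B (Real.exp (x i)) (Real.exp (x j)) (Real.exp (x k))| ≤ 3 * sqNorm T x i := by
  rw [orderedRadial_exp hp.T_pos]
  exact (hx.ordered hp).abs_radial_le (B.α₆_mem _).1 (B.α₆_mem _).2

/-- The bump functions vary slowly relative to their argument `s`, while the estimates need the size
`t` of a squared norm; `s ≥ t / c` converts one into the other. -/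
theorem scaled_slow_bounds {t s δ a b c : ℝ} (hc : 0 < c) (hs : t ≤ c * s) (ht : 0 < t)
    (h : a * |s| ≤ δ ∧ b * s ^ 2 ≤ 2 * δ) (ha : 0 ≤ a) (hb : 0 ≤ b) :
    a * t ≤ c * δ ∧ b * t ^ 2 ≤ 2 * c ^ 2 * δ := by
  have hs0 : 0 < s := by
    by_contra! hn
    nlinarith
  rw [abs_of_pos hs0] at h
  constructor
  · nlinarith [mul_le_mul_of_nonneg_left hs ha, mul_le_mul_of_nonneg_left h.1 hc.le]
  · have h1 : t ^ 2 ≤ (c * s) ^ 2 := by gcongr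
    nlinarith [mul_le_mul_of_nonneg_left h1 hb,
      mul_le_mul_of_nonneg_left h.2 (sq_nonneg c)]

/-- `D`, `A` and `m` are the values of `α₃`, `α₄ α₅` and `α₆` at the point; afterwards only their
ranges matter. Off the flat ranges `d` is comparable to `ta`, and `θ` to `tb`, so the logarithmic
slowness becomes a bound in `ta` and `tb`. -/
theorem SortedPoint.exists_hasJet (hx : SortedPoint T l x i j k) (hp : Admissible T l p C)
    {R z₁ x₁ z₂ x₂ : ℝ} (J : PointBounds B x v w i j k R z₁ x₁ z₂ x₂) :
    ∃ F₀ F₁ F₂ F₁₂ D A m, HasJet (fun y : Fin 3 → ℝ =>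
        orderedPotential B (Real.exp (y i)) (Real.exp (y j)) (Real.exp (y k))) x v w F₀ F₁ F₂ F₁₂ ∧
      (2 / 3 ≤ D ∧ D ≤ 1) ∧ (0 ≤ A ∧ A ≤ 1 / 2) ∧ (0 ≤ m ∧ m ≤ 1) ∧
      |F₁₂ - mainCurv T x v w i j k D A m| ≤ 100000 * (slowness T l C * R) ∧
      (radialEnd T l p ≤ orderedRadial B (Real.exp (x i)) (Real.exp (x j)) (Real.exp (x k)) →
        angularEnd T l p ≤ phi T (Real.exp (x j)) (Real.exp (x i)) (Real.exp (x k))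
          - phi T (Real.exp (x k)) (Real.exp (x i)) (Real.exp (x j)) →
        F₁₂ = totalCurv T x v w i j k - phiCurv T x v w k i j) := by
  have hT := hp.T_pos
  have ho := hx.ordered hp
  obtain ⟨g₀, g₁, g₂, hg⟩ := hasJet_toricPotential' (x := x) (v := v) (w := w) hT i j k
  set d := orderedRadial B (Real.exp (x i)) (Real.exp (x j)) (Real.exp (x k)) with hd
  set θ := phi T (Real.exp (x j)) (Real.exp (x i)) (Real.exp (x k))
          - phi T (Real.exp (x k)) (Real.exp (x i)) (Real.exp (x j)) with hθ
  have hd' := orderedRadial_exp hT B x i j k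
  have hθ' := angular_exp hT x i j k
  rw [← hd] at hd'
  rw [← hθ] at hθ'
  obtain ⟨F₀, F₁, F₂, hF⟩ := hasJet_potential_of B hg (hasJet_phi' hT i j k)
    (hasJet_phi' hT j i k) (hasJet_phi' hT k i j) (hasJet_orderedTurning B i j)
    rfl rfl rfl hd' rfl rfl rfl hθ' rfl rfl rfl rfl
  have hdlo := hx.le_radial hp B
  have hdhi := hx.abs_radial_le hp B
  rw [← hd] at hdlo hdhi
  have hθ0 : 0 ≤ θ := by rw [hθ']; linarith [ho.phic_le_phib]
  have hθhi : θ ≤ 2 * sqNorm T x j := by rw [hθ']; exact ho.angular_le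
  have hA := B.α₄_mem hθ0
  have hB := B.α₅_mem d
  have hD := B.α₃_mem d
  have s₃ := scaled_slow_bounds (by norm_num : (0 : ℝ) < 4) (by linarith) ho.ta_pos
    (hp.slow_bounds B B.smooth₃ (B.slow₃ d)) (abs_nonneg _) (abs_nonneg _)
  have s₅ := scaled_slow_bounds (by norm_num : (0 : ℝ) < 4) (by linarith) ho.ta_pos
    (hp.slow_bounds B B.smooth₅ (B.slow₅ d)) (abs_nonneg _) (abs_nonneg _)
  norm_num at s₃ s₅
  -- `θ` can be much smaller than `tb` when `b` and `c` are close. Then either the point is near the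
  -- vertex and `α₅` is flat at `0`, or `θ` lies in the sliver where `α₄` is flat at `0`. Otherwise
  -- `tc ≤ tb / 4` gives `θ ≥ tb / 3`.
  have h₄ : (|deriv B.α₄ θ| * sqNorm T x j ≤ 3 * slowness T l C ∧
      |deriv (deriv B.α₄) θ| * sqNorm T x j ^ 2 ≤ 18 * slowness T l C) ∨
      (B.α₅ d = 0 ∧ deriv B.α₅ d = 0 ∧ deriv (deriv B.α₅) d = 0) := by
    rcases le_total d (radialStart T l) with h | h
    · right
      exact ⟨B.start₅ d h, deriv_deriv_eq_zero_of_eqOn_const B.smooth₅ (uniqueDiffOn_Iic _)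
        (fun t ht => B.start₅ t ht) h⟩
    · left
      rcases le_total θ (angularStart T l) with h' | h'
      · have hpos : 0 < angularStart T l := Real.rpow_pos_of_pos hT _
        obtain ⟨e1, e2⟩ := deriv_deriv_eq_zero_of_eqOn_const B.smooth₄
          (uniqueDiffOn_Icc (by linarith : -angularStart T l < angularStart T l))
          (fun t ht => B.start₄ t (abs_le.2 ht)) (⟨by linarith, h'⟩ : θ ∈ Set.Icc _ _)
        have := hp.slowness_nonneg B
        rw [e1, e2]
        simp [this]
      · have hcb := hx.le_angular hp h (le_of_abs_le hdhi) h' hθhi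
        have hlow : sqNorm T x j ≤ 3 * θ := by
          rw [hθ']; linarith [ho.le_angular, ho.tb_pos]
        have := scaled_slow_bounds (by norm_num : (0 : ℝ) < 3) hlow ho.tb_pos
          (hp.slow_bounds B B.smooth₄ (B.slow₄ θ)) (abs_nonneg _) (abs_nonneg _)
        norm_num at this
        exact this
  refine ⟨F₀, F₁, F₂, _, B.α₃ d, B.α₄ θ * B.α₅ d,
    orderedTurning B (Real.exp (x i)) (Real.exp (x j)), hF, hD,
    ⟨mul_nonneg hA.1 hB.1, by nlinarith⟩, B.α₆_mem _, ?_, ?_⟩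
  · have key := JetBounds.abs_mixed_sub_main_le J (g := totalCurv T x v w i j k)
      rfl rfl rfl rfl rfl rfl rfl rfl rfl rfl hdhi (abs_le.2 ⟨by linarith, hA.2⟩)
      (abs_le.2 ⟨by linarith, hB.2⟩)
      (abs_le.2 ⟨by linarith, hD.2⟩) s₃.1 s₃.2 s₅.1 s₅.2 h₄
    rw [mainCurv]
    exact key
  · intro h1 h2
    obtain ⟨a1, a2⟩ := deriv_deriv_eq_zero_of_eqOn_const B.smooth₃ (uniqueDiffOn_Ici _)
      (fun t ht => B.end₃ t ht) h1
    obtain ⟨a3, a4⟩ := deriv_deriv_eq_zero_of_eqOn_const B.smooth₅ (uniqueDiffOn_Ici _)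
      (fun t ht => B.end₅ t ht) h1
    obtain ⟨a5, a6⟩ := deriv_deriv_eq_zero_of_eqOn_const B.smooth₄ (uniqueDiffOn_Ici _)
      (fun t ht => B.end₄ t ht) h2
    -- With `α₃ = α₅ = 1` and `α₄ = 1/2` the coefficients of `α₆ φ_b` are `-1 + 3/2 - 1/2 = 0`, so
    -- the derivatives of `α₆` cancel as well.
    rw [a1, a2, a3, a4, a5, a6, B.end₃ d h1, B.end₄ θ h2, B.end₅ d h1]
    ring

end

/-! ### Jet bounds along the fibre and in the direction of the smallest coordinate -/

section

variable {T l p C : ℝ} {x v w : Fin 3 → ℝ} {i j k : Fin 3} {B : BumpFunctions T l p C}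

theorem abs_turning_fst_le (hp : Admissible T l p C) (B : BumpFunctions T l p C) (s : ℝ) {u X : ℝ}
    (hu : |u| ≤ 2 * X) :
    |deriv B.α₆ s * (u / Real.log T)| ≤ 2 * (slowness T l C * X) := by
  have hL : 0 < -Real.log T := by linarith [hp.log_neg]
  have h := abs_mul_le_mul (B.slow₆ s).1 hu
  rw [mul_div_assoc', abs_div, abs_of_neg hp.log_neg, abs_mul, div_le_iff₀ hL, ← abs_mul]
  refine h.trans (le_of_eq ?_)
  have := hp.l_pos.ne'
  have := hL.ne'
  unfold slowness
  generalize -Real.log T = L at *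
  field_simp

theorem abs_turning_mixed_le (hp : Admissible T l p C) (B : BumpFunctions T l p C) (s : ℝ)
    {u u' X X' : ℝ} (hu : |u| ≤ 2 * X) (hu' : |u'| ≤ 2 * X') :
    |deriv (deriv B.α₆) s * (u / Real.log T) * (u' / Real.log T)|
      ≤ 4 * (slowness T l C * (X * X')) := by
  have hL : 0 < Real.log T ^ 2 := by nlinarith [hp.log_neg]
  have h0 : 0 ≤ X := by linarith [abs_nonneg u]
  have h0' : 0 ≤ X' := by linarith [abs_nonneg u']
  have h := abs_mul_le_mul (abs_mul_le_mul (B.slow₆ s).2 hu) hu'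
  have e : deriv (deriv B.α₆) s * (u / Real.log T) * (u' / Real.log T) =
      deriv (deriv B.α₆) s * u * u' / Real.log T ^ 2 := by
    have := hp.log_neg.ne
    field_simp
  rw [e, abs_div, abs_of_pos hL, div_le_iff₀ hL]
  refine h.trans ?_
  have h2 := hp.second_slowness_le B
  rw [div_le_iff₀ hL] at h2
  have := mul_le_mul_of_nonneg_right h2 (mul_nonneg h0 h0')
  linarith

theorem abs_slope_mul_le {t u U : ℝ} (ht : 0 ≤ t) (hu : |u| ≤ U) : |slope t * u| ≤ 2 * t * U :=
  abs_mul_le_mul (abs_le.2 ⟨by linarith [slope_nonneg ht], slope_le ht⟩) hu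

theorem abs_curv_mul_le {t u u' U U' : ℝ} (ht : 0 ≤ t) (hu : |u| ≤ U) (hu' : |u'| ≤ U') :
    |curv t * u * u'| ≤ 4 * t * U * U' :=
  abs_mul_le_mul (abs_mul_le_mul (abs_le.2 ⟨by linarith [curv_nonneg ht], curv_le ht⟩) hu) hu'

theorem abs_phiSlope_le (hT : 0 < T) {τ U : ℝ} (h1 : sqNorm T x i ≤ τ)
    (h2 : sqNorm T x j * sqNorm T x k ≤ τ) (hu : |v i| ≤ U) (hu' : |v j + v k| ≤ U) :
    |phiSlope T x v i j k| ≤ 4 * (τ * U) := by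
  have hU : 0 ≤ U := (abs_nonneg _).trans hu
  have a1 := abs_slope_mul_le (sqNorm_pos hT x i).le hu
  have a2 := abs_slope_mul_le (mul_pos (sqNorm_pos hT x j) (sqNorm_pos hT x k)).le hu'
  have b1 := mul_le_mul_of_nonneg_right h1 hU
  have b2 := mul_le_mul_of_nonneg_right h2 hU
  rw [phiSlope]
  linarith [abs_sub (slope (sqNorm T x i) * v i)
    (slope (sqNorm T x j * sqNorm T x k) * (v j + v k))]

theorem abs_phiCurv_le (hT : 0 < T) {τ U U' : ℝ} (h1 : sqNorm T x i ≤ τ)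
    (h2 : sqNorm T x j * sqNorm T x k ≤ τ) (hu : |v i| ≤ U) (hu' : |v j + v k| ≤ U)
    (hw : |w i| ≤ U') (hw' : |w j + w k| ≤ U') :
    |phiCurv T x v w i j k| ≤ 8 * (τ * (U * U')) := by
  have hU : 0 ≤ U := (abs_nonneg _).trans hu
  have hU' : 0 ≤ U' := (abs_nonneg _).trans hw
  have a1 := abs_curv_mul_le (sqNorm_pos hT x i).le hu hw
  have a2 := abs_curv_mul_le (mul_pos (sqNorm_pos hT x j) (sqNorm_pos hT x k)).le hu' hw'
  have b1 := mul_le_mul_of_nonneg_right h1 (mul_nonneg hU hU')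
  have b2 := mul_le_mul_of_nonneg_right h2 (mul_nonneg hU hU')
  rw [phiCurv]
  linarith [abs_sub (curv (sqNorm T x i) * v i * w i)
    (curv (sqNorm T x j * sqNorm T x k) * (v j + v k) * (w j + w k))]

theorem Ordered.mul_bc {ta tb tc : ℝ} (h : Ordered ta tb tc) : tb * tc ≤ tc := by
  nlinarith [h.tc_pos, h.tb_le, h.ta_le]

theorem Ordered.mul_ac {ta tb tc : ℝ} (h : Ordered ta tb tc) : ta * tc ≤ tc := by
  nlinarith [h.tc_pos, h.ta_le]

theorem Ordered.mul_ab {ta tb tc : ℝ} (h : Ordered ta tb tc) : ta * tb ≤ tb := by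
  nlinarith [h.tb_pos, h.ta_le]

/-- `R` is twice the quadratic form that bounds the Hessian from below. The weights `√(R / ta)` and
`√(R / tb)` make the two product conditions equalities. -/
theorem SortedPoint.bounds_diag (hx : SortedPoint T l x i j k) (hp : Admissible T l p C)
    (B : BumpFunctions T l p C) (hw : w i + w j + w k = 0) :
    ∃ z X, PointBounds B x w w i j k
      (2 * (sqNorm T x i * w i ^ 2 + sqNorm T x j * w j ^ 2)) z X z X := by
  have hT := hp.T_pos
  have ho := hx.ordered hp
  have ha := ho.ta_pos
  have hb := ho.tb_pos
  have hc := ho.tc_pos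
  set ta := sqNorm T x i
  set tb := sqNorm T x j
  set tc := sqNorm T x k
  set R := 2 * (ta * w i ^ 2 + tb * w j ^ 2) with hR
  have hR0 : 0 ≤ R := by positivity
  have hza : ta * (√(R / ta) * √(R / ta)) = R := by
    rw [Real.mul_self_sqrt (by positivity)]; field_simp
  have hxb : tb * (√(R / tb) * √(R / tb)) = R := by
    rw [Real.mul_self_sqrt (by positivity)]; field_simp
  have hwi : |w i| ≤ √(R / ta) := by
    apply Real.abs_le_sqrt
    rw [le_div_iff₀ ha]
    nlinarith [mul_nonneg hb.le (sq_nonneg (w j)), mul_nonneg ha.le (sq_nonneg (w i))]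
  have hwj : |w j| ≤ √(R / tb) := by
    apply Real.abs_le_sqrt
    rw [le_div_iff₀ hb]
    nlinarith [mul_nonneg hb.le (sq_nonneg (w j)), mul_nonneg ha.le (sq_nonneg (w i))]
  have ek : w i + w j = -w k := by linarith
  have ei : w j + w k = -w i := by linarith
  have ej : w i + w k = -w j := by linarith
  -- As `w k = -(w i + w j)`, its square is at most `2 (w i² + w j²)`. This is the reason for the
  -- factor `2` in `R`.
  have hwk : |w k| ≤ √(R / tb) := by
    rw [← abs_neg, ← ek]
    apply Real.abs_le_sqrt
    rw [le_div_iff₀ hb]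
    have h1 : tb * w i ^ 2 ≤ ta * w i ^ 2 := mul_le_mul_of_nonneg_right ho.tb_le (sq_nonneg _)
    nlinarith [mul_nonneg hb.le (sq_nonneg (w i - w j))]
  have hzx : √(R / ta) ≤ √(R / tb) :=
    Real.sqrt_le_sqrt (div_le_div_of_nonneg_left hR0 hb ho.tb_le)
  have hxz : tb * √(R / tb) ≤ ta * √(R / ta) := by
    have h1 : √(R / tb) * √tb = √R := by
      rw [← Real.sqrt_mul (by positivity), div_mul_cancel₀ _ hb.ne']
    have h2 : √(R / ta) * √ta = √R := by
      rw [← Real.sqrt_mul (by positivity), div_mul_cancel₀ _ ha.ne']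
    have h3 : √tb * √tb = tb := Real.mul_self_sqrt hb.le
    have h4 : √ta * √ta = ta := Real.mul_self_sqrt ha.le
    calc tb * √(R / tb) = √tb * √R := by linear_combination √tb * h1 - √(R / tb) * h3
      _ ≤ √ta * √R := mul_le_mul_of_nonneg_right (Real.sqrt_le_sqrt ho.tb_le) (Real.sqrt_nonneg _)
      _ = ta * √(R / ta) := by linear_combination √(R / ta) * h4 - √ta * h2
  have hd : |w i - w j| ≤ 2 * √(R / tb) := by linarith [abs_sub (w i) (w j)]
  refine ⟨√(R / ta), √(R / tb), ?_⟩
  have ei' : |w j + w k| ≤ √(R / ta) := by rwa [ei, abs_neg]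
  have ej' : |w i + w k| ≤ √(R / tb) := by rwa [ej, abs_neg]
  have ek' : |w i + w j| ≤ √(R / tb) := by rwa [ek, abs_neg]
  have hbc : tb * tc ≤ ta := by linarith [ho.mul_bc, ho.tc_le, ho.tb_le]
  have hac : ta * tc ≤ tb := by linarith [ho.mul_ac, ho.tc_le]
  exact
  { ta_pos := ha
    tb_pos := hb
    tb_le := ho.tb_le
    z₁_nonneg := Real.sqrt_nonneg _
    z₂_nonneg := Real.sqrt_nonneg _
    zx₁ := hzx
    zx₂ := hzx
    xz₁ := hxz
    xz₂ := hxz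
    zR := hza.le
    xR := hxb.le
    δ_nonneg := hp.slowness_nonneg B
    δ_le := by linarith [hp.slowness_le]
    φb_le := abs_le.2 ⟨by linarith [ho.phib_nonneg], ho.phib_le⟩
    φc_le := ho.abs_phic_le
    pa_le := abs_phiSlope_le hT le_rfl hbc hwi ei'
    pb_le := abs_phiSlope_le hT le_rfl hac hwj ej'
    pc_le := abs_phiSlope_le hT ho.tc_le ho.mul_ab hwk ek'
    qa_le := abs_phiSlope_le hT le_rfl hbc hwi ei'
    qb_le := abs_phiSlope_le hT le_rfl hac hwj ej'
    qc_le := abs_phiSlope_le hT ho.tc_le ho.mul_ab hwk ek'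
    ha_le := by rw [← hza]; exact abs_phiCurv_le hT le_rfl hbc hwi ei' hwi ei'
    hb_le := by rw [← hxb]; exact abs_phiCurv_le hT le_rfl hac hwj ej' hwj ej'
    hc_le := by rw [← hxb]; exact abs_phiCurv_le hT ho.tc_le ho.mul_ab hwk ek' hwk ek'
    m_nonneg := (B.α₆_mem _).1
    m_le := (B.α₆_mem _).2
    m₁_le := abs_turning_fst_le hp B _ hd
    m₂_le := abs_turning_fst_le hp B _ hd
    m₁₂_le := abs_turning_mixed_le hp B _ hd hd }

/-- Along the smallest coordinate all first derivatives are of order `tc`. The weights `tc / ta` and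
`tc / tb` encode this: multiplied by `ta` and `tb` they both give `tc`. -/
theorem SortedPoint.bounds_last (hx : SortedPoint T l x i j k) (hp : Admissible T l p C)
    (B : BumpFunctions T l p C) (hw : w i + w j + w k = 0) :
    ∃ z₁ x₁ z₂ x₂, PointBounds B x (Pi.single k 1) w i j k
      (sqNorm T x k * (|w i| + |w j|)) z₁ x₁ z₂ x₂ := by
  have hT := hp.T_pos
  have ho := hx.ordered hp
  have ha := ho.ta_pos
  have hb := ho.tb_pos
  have hc := ho.tc_pos
  set ta := sqNorm T x i
  set tb := sqNorm T x j
  set tc := sqNorm T x k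
  set S := |w i| + |w j| with hS
  have hS0 : 0 ≤ S := by positivity
  have hwi : |w i| ≤ S := by linarith [abs_nonneg (w j)]
  have hwj : |w j| ≤ S := by linarith [abs_nonneg (w i)]
  have ek : w i + w j = -w k := by linarith
  have ei : w j + w k = -w i := by linarith
  have ej : w i + w k = -w j := by linarith
  have hwk : |w k| ≤ S := by rw [← abs_neg, ← ek]; exact abs_add_le _ _
  have ei' : |w j + w k| ≤ S := by rwa [ei, abs_neg]
  have ej' : |w i + w k| ≤ S := by rwa [ej, abs_neg]
  have ek' : |w i + w j| ≤ S := by rwa [ek, abs_neg]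
  have ca : ta * (tc / ta) = tc := mul_div_cancel₀ _ ha.ne'
  have cb : tb * (tc / tb) = tc := mul_div_cancel₀ _ hb.ne'
  have vi : (Pi.single k (1 : ℝ) : Fin 3 → ℝ) i = 0 := Pi.single_eq_of_ne hx.ne_ik 1
  have vj : (Pi.single k (1 : ℝ) : Fin 3 → ℝ) j = 0 := Pi.single_eq_of_ne hx.ne_jk 1
  have vk : (Pi.single k (1 : ℝ) : Fin 3 → ℝ) k = 1 := Pi.single_eq_same k 1
  have hbc : tb * tc ≤ ta := by linarith [ho.mul_bc, ho.tc_le, ho.tb_le]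
  have hac : ta * tc ≤ tb := by linarith [ho.mul_ac, ho.tc_le]
  have pa : |phiSlope T x (Pi.single k 1) i j k| ≤ 4 * tc := by
    have := abs_slope_mul_le (mul_pos hb hc).le (abs_one (α := ℝ)).le
    rw [phiSlope, vi, vj, vk, mul_zero, zero_add, zero_sub, abs_neg]
    linarith [ho.mul_bc]
  have pb : |phiSlope T x (Pi.single k 1) j i k| ≤ 4 * tc := by
    have := abs_slope_mul_le (mul_pos ha hc).le (abs_one (α := ℝ)).le
    rw [phiSlope, vi, vj, vk, mul_zero, zero_add, zero_sub, abs_neg]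
    linarith [ho.mul_ac]
  have pc : |phiSlope T x (Pi.single k 1) k i j| ≤ 4 * tc := by
    have := abs_slope_mul_le hc.le (abs_one (α := ℝ)).le
    rw [phiSlope, vi, vj, vk, add_zero, mul_zero, sub_zero]
    linarith
  have hcS : 0 ≤ tc * S := by positivity
  refine ⟨tc / ta, tc / tb, S, S, ?_⟩
  exact
  { ta_pos := ha
    tb_pos := hb
    tb_le := ho.tb_le
    z₁_nonneg := by positivity
    z₂_nonneg := hS0
    zx₁ := div_le_div_of_nonneg_left hc.le hb ho.tb_le
    zx₂ := le_rfl
    xz₁ := by rw [ca, cb]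
    xz₂ := mul_le_mul_of_nonneg_right ho.tb_le hS0
    zR := by rw [← mul_assoc, ca]
    xR := by rw [← mul_assoc, cb]
    δ_nonneg := hp.slowness_nonneg B
    δ_le := by linarith [hp.slowness_le]
    φb_le := abs_le.2 ⟨by linarith [ho.phib_nonneg], ho.phib_le⟩
    φc_le := ho.abs_phic_le
    pa_le := by rw [ca]; exact pa
    pb_le := by rw [cb]; exact pb
    pc_le := by rw [cb]; exact pc
    qa_le := abs_phiSlope_le hT le_rfl hbc hwi ei'
    qb_le := abs_phiSlope_le hT le_rfl hac hwj ej'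
    qc_le := abs_phiSlope_le hT ho.tc_le ho.mul_ab hwk ek'
    ha_le := by
      have h := abs_curv_mul_le (mul_pos hb hc).le (abs_one (α := ℝ)).le ei'
      rw [phiCurv, vi, vj, vk, zero_add, mul_zero, zero_mul, zero_sub, abs_neg]
      linarith [mul_le_mul_of_nonneg_right ho.mul_bc hS0]
    hb_le := by
      have h := abs_curv_mul_le (mul_pos ha hc).le (abs_one (α := ℝ)).le ej'
      rw [phiCurv, vi, vj, vk, zero_add, mul_zero, zero_mul, zero_sub, abs_neg]
      linarith [mul_le_mul_of_nonneg_right ho.mul_ac hS0]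
    hc_le := by
      have h := abs_curv_mul_le hc.le (abs_one (α := ℝ)).le hwk
      rw [phiCurv, vi, vj, vk, zero_add, mul_zero, zero_mul, sub_zero]
      linarith
    m_nonneg := (B.α₆_mem _).1
    m_le := (B.α₆_mem _).2
    m₁_le := by
      rw [vi, vj, sub_zero, zero_div, mul_zero, abs_zero]
      have := hp.slowness_nonneg B
      positivity
    m₂_le := abs_turning_fst_le hp B _ (by linarith [abs_sub (w i) (w j)])
    m₁₂_le := by
      rw [vi, vj, sub_zero, zero_div, mul_zero, zero_mul, abs_zero]
      have := hp.slowness_nonneg B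
      positivity }

/-- The potential is strictly plurisubharmonic along the fibres. -/
theorem SortedPoint.mainCurv_ge (hx : SortedPoint T l x i j k) (hp : Admissible T l p C)
    (hw : w i + w j + w k = 0) {D A m : ℝ} (hD : 2 / 3 ≤ D ∧ D ≤ 1) (hA : 0 ≤ A ∧ A ≤ 1 / 2)
    (hm : 0 ≤ m ∧ m ≤ 1) :
    1 / 2 * (sqNorm T x i * w i ^ 2 + sqNorm T x j * w j ^ 2) ≤
      mainCurv T x w w i j k D A m := by
  have ho := hx.ordered hp
  have ha := ho.ta_pos
  have hb := ho.tb_pos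
  have hc := ho.tc_pos
  have ek : w i + w j = -w k := by linarith
  have ei : w j + w k = -w i := by linarith
  have ej : w i + w k = -w j := by linarith
  -- On vectors of sum zero `w j + w k = -w i` and so on, so all terms become multiples of `w i²`,
  -- `w j²`, `w k²` and the form is diagonal.
  rw [mainCurv, totalCurv, phiCurv, phiCurv, phiCurv, ei, ej, ek]
  set ta := sqNorm T x i
  set tb := sqNorm T x j
  set tc := sqNorm T x k
  have a0 := curv_nonneg (mul_pos hb hc).le
  have b0 := curv_nonneg (mul_pos ha hc).le
  have c0 := curv_nonneg (mul_pos ha hb).le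
  have a1 := le_curv ha.le ho.ta_le
  have b1 := le_curv hb.le (ho.tb_le.trans ho.ta_le)
  have c1 := curv_nonneg hc.le
  have a2 := curv_mono (mul_pos hb hc).le (by linarith [ho.mul_bc, ho.tc_le, ho.tb_le]) ho.ta_le
  have b2 := curv_mono (mul_pos ha hc).le (by linarith [ho.mul_ac, ho.tc_le])
    (ho.tb_le.trans ho.ta_le)
  generalize curv ta = A1 at *
  generalize curv tb = B1 at *
  generalize curv tc = C1 at *
  generalize curv (tb * tc) = A0 at *
  generalize curv (ta * tc) = B0 at *
  generalize curv (ta * tb) = C0 at *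
  -- This is the coefficient with which `φ_b` is subtracted from the total. It is affine in `m`,
  -- equal to `D / 2 - A` at `m = 0` and to `1 - D` at `m = 1`, both at most `1/2`. The
  -- corresponding coefficients `1 - D` of `φ_a` and `D / 2 + A` of `φ_c` lie in `[0, 1]`.
  have kb : m - D * (-1 / 2 + 3 / 2 * m) - A * (1 - m) ≤ 1 / 2 := by nlinarith
  have pa : 1 / 2 * ta ≤ D * A1 + (1 - D) * A0 := by nlinarith
  have pb : 1 / 2 * tb ≤ B1 - (m - D * (-1 / 2 + 3 / 2 * m) - A * (1 - m)) * (B1 - B0) := by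
    nlinarith
  have pc : 0 ≤ (1 - (D / 2 + A)) * C1 + (D / 2 + A) * C0 := by
    have : 0 ≤ 1 - (D / 2 + A) := by linarith
    have : 0 ≤ D / 2 + A := by linarith
    positivity
  have qa := mul_le_mul_of_nonneg_right pa (sq_nonneg (w i))
  have qb := mul_le_mul_of_nonneg_right pb (sq_nonneg (w j))
  have qc := mul_nonneg pc (sq_nonneg (w k))
  linarith

theorem SortedPoint.abs_mainCurv_last_le (hx : SortedPoint T l x i j k) (hp : Admissible T l p C)
    {z₁ x₁ z₂ x₂ : ℝ}
    (J : PointBounds B x (Pi.single k 1) w i j k (sqNorm T x k * (|w i| + |w j|)) z₁ x₁ z₂ x₂)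
    (hw : w i + w j + w k = 0) {D A m : ℝ} (hD : 2 / 3 ≤ D ∧ D ≤ 1) (hA : 0 ≤ A ∧ A ≤ 1 / 2)
    (hm : 0 ≤ m ∧ m ≤ 1) :
    |mainCurv T x (Pi.single k 1) w i j k D A m| ≤ 100 * (sqNorm T x k * (|w i| + |w j|)) := by
  have ho := hx.ordered hp
  have hc := ho.tc_pos
  have vi : (Pi.single k (1 : ℝ) : Fin 3 → ℝ) i = 0 := Pi.single_eq_of_ne hx.ne_ik 1
  have vj : (Pi.single k (1 : ℝ) : Fin 3 → ℝ) j = 0 := Pi.single_eq_of_ne hx.ne_jk 1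
  have vk : (Pi.single k (1 : ℝ) : Fin 3 → ℝ) k = 1 := Pi.single_eq_same k 1
  have hG : |totalCurv T x (Pi.single k 1) w i j k| ≤ 4 * (sqNorm T x k * (|w i| + |w j|)) := by
    have hwk : |w k| ≤ |w i| + |w j| := by
      rw [show w k = -(w i + w j) by linarith, abs_neg]; exact abs_add_le _ _
    have := abs_curv_mul_le hc.le (abs_one (α := ℝ)).le hwk
    rw [totalCurv, vi, vj, vk, mul_zero, mul_zero, zero_mul, zero_mul, zero_add, zero_add]
    linarith
  have h1 := JetBounds.ha_le J
  have h2 := JetBounds.hb_le J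
  have h3 := JetBounds.hc_le J
  rw [mainCurv]
  set R := sqNorm T x k * (|w i| + |w j|)
  generalize phiCurv T x (Pi.single k 1) w i j k = a at *
  generalize phiCurv T x (Pi.single k 1) w j i k = b at *
  generalize phiCurv T x (Pi.single k 1) w k i j = c at *
  have m1 : |m| ≤ 1 := abs_le.2 ⟨by linarith, hm.2⟩
  have t1 := abs_mul_le_mul m1 h2
  have t2 : |a - (b + c) / 2 + 3 / 2 * (m * b)| ≤ 28 * R := by
    rw [abs_le] at h1 h2 h3 t1 ⊢; constructor <;> linarith
  have t3 : |b - c - m * b| ≤ 24 * R := by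
    rw [abs_le] at h1 h2 h3 t1 ⊢; constructor <;> linarith
  have t4 := abs_mul_le_mul (abs_le.2 ⟨by linarith, hD.2⟩) t2
  have t5 := abs_mul_le_mul (abs_le.2 ⟨by linarith, hA.2⟩) t3
  rw [abs_le] at *
  constructor <;> linarith

end

/-! ### Lower and upper bounds for the Hessian at a sorted point -/

section

variable {T l p C : ℝ} {x v w : Fin 3 → ℝ} {i j k : Fin 3}

/-- The potential for coordinates with norms `exp (y i) ≥ exp (y j) ≥ exp (y k)`. -/
noncomputable def logPotential (B : BumpFunctions T l p C) (i j k : Fin 3) (y : Fin 3 → ℝ) : ℝ :=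
  orderedPotential B (Real.exp (y i)) (Real.exp (y j)) (Real.exp (y k))

theorem SortedPoint.twiceDiffAt (hx : SortedPoint T l x i j k) (hp : Admissible T l p C)
    (B : BumpFunctions T l p C) : TwiceDiffAt (logPotential B i j k) x := by
  obtain ⟨z, X, J⟩ := hx.bounds_diag hp B (w := 0) (by simp)
  obtain ⟨_, _, _, _, _, _, _, hF, _⟩ := hx.exists_hasJet hp J
  exact hF.twice

theorem SortedPoint.le_secondDeriv (hx : SortedPoint T l x i j k) (hp : Admissible T l p C)
    (B : BumpFunctions T l p C) (hw : w i + w j + w k = 0) :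
    1 / 4 * (sqNorm T x i * w i ^ 2 + sqNorm T x j * w j ^ 2) ≤
      secondDeriv (logPotential B i j k) x w w := by
  obtain ⟨z, X, J⟩ := hx.bounds_diag hp B hw
  obtain ⟨_, _, _, F₁₂, D, A, m, hF, hD, hA, hm, hle, -⟩ := hx.exists_hasJet hp J
  have h1 := hx.mainCurv_ge hp hw hD hA hm
  have h2 : 0 ≤ sqNorm T x i * w i ^ 2 + sqNorm T x j * w j ^ 2 := by
    have := sqNorm_pos hp.T_pos x i
    have := sqNorm_pos hp.T_pos x j
    positivity
  -- The error is at most `100000 · 10⁻⁶ · 2 = 1/5` of the quadratic form, so `1/2` drops to no less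
  -- than `1/4`.
  have h3 := mul_le_mul_of_nonneg_right hp.slowness_le h2
  have h4 := (abs_le.1 hle).1
  rw [show secondDeriv (logPotential B i j k) x w w = F₁₂ from hF.mixed]
  linarith

theorem SortedPoint.abs_secondDeriv_last_le (hx : SortedPoint T l x i j k)
    (hp : Admissible T l p C) (B : BumpFunctions T l p C) (hw : w i + w j + w k = 0) :
    |secondDeriv (logPotential B i j k) x (Pi.single k 1) w| ≤
      101 * (sqNorm T x k * (|w i| + |w j|)) := by
  obtain ⟨_, _, _, _, J⟩ := hx.bounds_last hp B hw
  obtain ⟨_, _, _, F₁₂, D, A, m, hF, hD, hA, hm, hle, -⟩ := hx.exists_hasJet hp J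
  have h1 := hx.abs_mainCurv_last_le hp J hw hD hA hm
  have h2 : 0 ≤ sqNorm T x k * (|w i| + |w j|) := by
    have := sqNorm_pos hp.T_pos x k
    positivity
  have h3 := mul_le_mul_of_nonneg_right hp.slowness_le h2
  rw [show secondDeriv (logPotential B i j k) x (Pi.single k 1) w = F₁₂ from hF.mixed]
  rw [abs_le] at *
  constructor <;> linarith

/-- In the interior of a tile the second derivative is that of `g_{ab}`, which does not involve the
smallest coordinate `c`. -/
theorem SortedPoint.secondDeriv_last_eq_zero (hx : SortedPoint T l x i j k)
    (hp : Admissible T l p C) (B : BumpFunctions T l p C) (hw : w i + w j + w k = 0)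
    (hd : radialEnd T l p ≤ orderedRadial B (Real.exp (x i)) (Real.exp (x j)) (Real.exp (x k)))
    (hθ : angularEnd T l p ≤ phi T (Real.exp (x j)) (Real.exp (x i)) (Real.exp (x k))
          - phi T (Real.exp (x k)) (Real.exp (x i)) (Real.exp (x j))) :
    secondDeriv (logPotential B i j k) x (Pi.single k 1) w = 0 := by
  obtain ⟨_, _, _, _, J⟩ := hx.bounds_last hp B hw
  obtain ⟨_, _, _, F₁₂, D, A, m, hF, -, -, -, -, h⟩ := hx.exists_hasJet hp J
  rw [show secondDeriv (logPotential B i j k) x (Pi.single k 1) w = F₁₂ from hF.mixed, h hd hθ,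
    totalCurv, phiCurv, Pi.single_eq_of_ne hx.ne_ik, Pi.single_eq_of_ne hx.ne_jk,
    Pi.single_eq_same]
  ring

/-! ### The potential near a point whose coordinates have equal norms -/

theorem phi_comm (T a b c : ℝ) : phi T a b c = phi T a c b := by
  rw [phi, phi, mul_right_comm]

theorem toricPotential_comm (T b c : ℝ) : toricPotential T b c = toricPotential T c b := by
  rw [toricPotential, toricPotential, mul_right_comm (T ^ 2) b c,
    mul_comm (1 + (T * b) ^ 2) (1 + (T * c) ^ 2)]

theorem SortedPoint.swap_left (hx : SortedPoint T l x i j k) (h : x i = x j) :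
    SortedPoint T l x j i k where
  ne_ij := hx.ne_ij.symm
  ne_ik := hx.ne_jk
  ne_jk := hx.ne_ik
  le_ji := h.le
  le_kj := hx.le_kj.trans hx.le_ji
  le_log := h ▸ hx.le_log
  sum_eq := by rw [← hx.sum_eq]; ring

theorem SortedPoint.swap_right (hx : SortedPoint T l x i j k) (h : x j = x k) :
    SortedPoint T l x i k j where
  ne_ij := hx.ne_ik
  ne_ik := hx.ne_ij
  ne_jk := hx.ne_jk.symm
  le_ji := hx.le_kj.trans hx.le_ji
  le_kj := h.le
  le_log := hx.le_log
  sum_eq := by rw [← hx.sum_eq]; ring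

theorem continuousAt_orderedRadial (hT : 0 < T) (B : BumpFunctions T l p C) (x : Fin 3 → ℝ)
    (i j k : Fin 3) : ContinuousAt (fun y : Fin 3 → ℝ =>
      orderedRadial B (Real.exp (y i)) (Real.exp (y j)) (Real.exp (y k))) x := by
  have h1 := (hasJet_phi (x := x) (v := 0) (w := 0) hT i j k).continuousAt
  have h2 := (hasJet_phi (x := x) (v := 0) (w := 0) hT j i k).continuousAt
  have h3 := (hasJet_phi (x := x) (v := 0) (w := 0) hT k i j).continuousAt
  have h4 := (hasJet_orderedTurning (x := x) (v := 0) (w := 0) B i j).continuousAt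
  exact (h1.sub ((h2.add h3).div_const 2)).add ((continuousAt_const.mul h4).mul h2)

theorem continuousAt_angular (hT : 0 < T) (x : Fin 3 → ℝ) (i j k : Fin 3) :
    ContinuousAt (fun y : Fin 3 → ℝ => phi T (Real.exp (y j)) (Real.exp (y i)) (Real.exp (y k))
      - phi T (Real.exp (y k)) (Real.exp (y i)) (Real.exp (y j))) x :=
  (hasJet_phi (x := x) (v := 0) (w := 0) hT j i k).continuousAt.sub
    (hasJet_phi (x := x) (v := 0) (w := 0) hT k i j).continuousAt

theorem continuousAt_logRatio (T : ℝ) (x : Fin 3 → ℝ) (i j : Fin 3) :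
    ContinuousAt (fun y : Fin 3 → ℝ =>
      Real.logb T (Real.exp (y i)) - Real.logb T (Real.exp (y j))) x := by
  simp only [Real.logb, Real.log_exp]
  fun_prop

theorem orderedPotential_of_close (B : BumpFunctions T l p C) {a b c : ℝ}
    (h : orderedRadial B a b c ≤ radialStart T l) :
    orderedPotential B a b c = toricPotential T b c
      + 2 / 3 * phi T a b c - 1 / 3 * (phi T b a c + phi T c a b) := by
  rw [orderedPotential, B.start₃ _ h, B.start₅ _ h, orderedRadial]
  ring

/-- Exchanging `b` and `c` changes the sign of `θ`, and `α₄(θ) θ` is even because `α₄` is odd. -/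
theorem orderedPotential_swap_right (B : BumpFunctions T l p C) {a b c : ℝ}
    (hb : orderedTurning B a b = 0) (hc : orderedTurning B a c = 0) :
    orderedPotential B a b c = orderedPotential B a c b := by
  have hd : orderedRadial B a b c = orderedRadial B a c b := by
    rw [orderedRadial, orderedRadial, hb, hc, phi_comm T a b c]
    ring
  rw [orderedPotential, orderedPotential, hd, hb, hc, toricPotential_comm,
    ← neg_sub (phi T c a b), B.odd₄]
  ring

/-- For `α₆ = 1` both `d = φ_a + φ_b - φ_c / 2` and `g_{bc} - φ_b = g_{ac} - φ_a` are symmetric in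
`a` and `b`. The last term is `-α₄(θ) α₅(d) φ_c`, in which only `α₄(θ)` could break the symmetry. It
does not where `α₅ = 0` or where `α₄ = 1/2` for both orders. -/
theorem orderedPotential_swap_left (hT : 0 < T) (B : BumpFunctions T l p C) (y : Fin 3 → ℝ)
    {i j k : Fin 3} (hi : orderedTurning B (Real.exp (y i)) (Real.exp (y j)) = 1)
    (hj : orderedTurning B (Real.exp (y j)) (Real.exp (y i)) = 1)
    (h : (orderedRadial B (Real.exp (y i)) (Real.exp (y j)) (Real.exp (y k)) ≤ radialStart T l) ∨
      (angularEnd T l p ≤ phi T (Real.exp (y j)) (Real.exp (y i)) (Real.exp (y k))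
          - phi T (Real.exp (y k)) (Real.exp (y i)) (Real.exp (y j)) ∧
        angularEnd T l p ≤ phi T (Real.exp (y i)) (Real.exp (y j)) (Real.exp (y k))
          - phi T (Real.exp (y k)) (Real.exp (y j)) (Real.exp (y i)))) :
    logPotential B i j k y = logPotential B j i k y := by
  have hd : orderedRadial B (Real.exp (y i)) (Real.exp (y j)) (Real.exp (y k)) =
      orderedRadial B (Real.exp (y j)) (Real.exp (y i)) (Real.exp (y k)) := by
    rw [orderedRadial, orderedRadial, hi, hj,
      phi_comm T (Real.exp (y k)) (Real.exp (y i)) (Real.exp (y j))]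
    ring
  have hg : toricPotential T (Real.exp (y j)) (Real.exp (y k))
      - phi T (Real.exp (y j)) (Real.exp (y i)) (Real.exp (y k)) =
      toricPotential T (Real.exp (y i)) (Real.exp (y k))
      - phi T (Real.exp (y i)) (Real.exp (y j)) (Real.exp (y k)) := by
    rw [toricPotential_exp hT, toricPotential_exp hT, phi_exp hT, phi_exp hT]
    ring
  rw [logPotential, logPotential, orderedPotential, orderedPotential, ← hd, hi, hj]
  rcases h with h | ⟨h1, h2⟩
  · rw [B.start₅ _ h]
    linarith
  · rw [B.end₄ _ h1, B.end₄ _ h2, phi_comm T (Real.exp (y k)) (Real.exp (y i)) (Real.exp (y j))]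
    linarith

/-- At a tie of the two larger norms the conditions of `orderedPotential_swap_left` follow from
strict inequalities, which persist in a whole neighbourhood; equality on the wall alone would not
determine second derivatives. -/
theorem SortedPoint.eventually_swap_left (hx : SortedPoint T l x i j k) (hp : Admissible T l p C)
    (B : BumpFunctions T l p C) (h : x i = x j) :
    ∀ᶠ y in 𝓝 x, logPotential B i j k y = logPotential B j i k y := by
  have hT := hp.T_pos
  have hg : 0 < l / 8 - 2 * l / p := by
    have := hp.gap
    have e : l * (1 / 4 - 4 / p) = 2 * (l / 8 - 2 * l / p) := by ring
    linarith
  have t1 : ∀ᶠ y in 𝓝 x, orderedTurning B (Real.exp (y i)) (Real.exp (y j)) = 1 := by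
    have := (continuousAt_logRatio T x i j).eventually_const_lt
      (show -(l / 8 - 2 * l / p) < _ by beta_reduce; rw [h]; linarith)
    exact this.mono fun y hy => B.end₆ _ hy.le
  have t2 : ∀ᶠ y in 𝓝 x, orderedTurning B (Real.exp (y j)) (Real.exp (y i)) = 1 := by
    have := (continuousAt_logRatio T x j i).eventually_const_lt
      (show -(l / 8 - 2 * l / p) < _ by beta_reduce; rw [h]; linarith)
    exact this.mono fun y hy => B.end₆ _ hy.le
  rcases lt_or_ge (orderedRadial B (Real.exp (x i)) (Real.exp (x j)) (Real.exp (x k)))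
    (radialStart T l) with hd | hd
  · filter_upwards [t1, t2, (continuousAt_orderedRadial hT B x i j k).eventually_lt_const hd]
      with y h1 h2 h3
    exact orderedPotential_swap_left hT B y h1 h2 (.inl h3.le)
  · have hd' := hd.trans (le_of_abs_le (hx.abs_radial_le hp B))
    have a1 := hx.angularEnd_lt hp h hd'
    have a2 := (hx.swap_left h).angularEnd_lt hp h.symm
      (by rwa [sqNorm, ← h, ← sqNorm])
    rw [← angular_exp hT] at a1 a2
    filter_upwards [t1, t2, (continuousAt_angular hT x i j k).eventually_const_lt a1,
      (continuousAt_angular hT x j i k).eventually_const_lt a2] with y h1 h2 h3 h4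
    exact orderedPotential_swap_left hT B y h1 h2 (.inr ⟨h3.le, h4.le⟩)

/-- At a tie of the two smaller norms either `α₆` vanishes nearby for both orders, or the point is
so close to the vertex that the potential is the symmetric average of the three toric ones. -/
theorem SortedPoint.eventually_swap_right (hx : SortedPoint T l x i j k)
    (hp : Admissible T l p C) (B : BumpFunctions T l p C) (h : x j = x k) :
    ∀ᶠ y in 𝓝 x, logPotential B i j k y = logPotential B i k j y := by
  have hT := hp.T_pos
  rcases le_or_gt (-(l / 8 - l / p)) ((x i - x j) / Real.log T) with hr | hr
  · have hlt := hx.lt_radialStart hp h hr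
    have d1 := (le_of_abs_le (hx.abs_radial_le hp B)).trans_lt hlt
    have d2 := (le_of_abs_le ((hx.swap_right h).abs_radial_le hp B)).trans_lt hlt
    filter_upwards [(continuousAt_orderedRadial hT B x i j k).eventually_lt_const d1,
      (continuousAt_orderedRadial hT B x i k j).eventually_lt_const d2] with y h1 h2
    rw [logPotential, logPotential, orderedPotential_of_close B h1.le,
      orderedPotential_of_close B h2.le, toricPotential_comm,
      phi_comm T (Real.exp (y i)) (Real.exp (y j))]
    ring
  · have e : ∀ j, Real.logb T (Real.exp (x i)) - Real.logb T (Real.exp (x j)) =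
        (x i - x j) / Real.log T := fun j => by
      simp only [Real.logb, Real.log_exp, sub_div]
    filter_upwards [(continuousAt_logRatio T x i j).eventually_lt_const
        (show _ < -(l / 8 - l / p) by beta_reduce; rw [e]; exact hr),
      (continuousAt_logRatio T x i k).eventually_lt_const
        (show _ < -(l / 8 - l / p) by beta_reduce; rw [e, ← h]; exact hr)] with y h1 h2
    exact orderedPotential_swap_right B (B.start₆ _ h1.le) (B.start₆ _ h2.le)

theorem hi_mid_lo_eq {r : Fin 3 → ℝ} (hij : i ≠ j) (hik : i ≠ k) (hjk : j ≠ k) (h1 : r j ≤ r i)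
    (h2 : r k ≤ r j) : hi r = r i ∧ mid r = r j ∧ lo r = r k := by
  have h3 := h2.trans h1
  fin_cases i <;> fin_cases j <;> fin_cases k <;>
    simp_all [hi, mid, lo]

theorem vertexPotential_exp (B : BumpFunctions T l p C) {y : Fin 3 → ℝ} (hij : i ≠ j)
    (hik : i ≠ k) (hjk : j ≠ k) (h1 : y j ≤ y i) (h2 : y k ≤ y j) :
    vertexPotential B (fun n => Real.exp (y n)) = logPotential B i j k y := by
  obtain ⟨e1, e2, e3⟩ := hi_mid_lo_eq (r := fun n => Real.exp (y n)) hij hik hjk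
    (Real.exp_le_exp.2 h1) (Real.exp_le_exp.2 h2)
  rw [vertexPotential_eq, e1, e2, e3, logPotential]

/-- The vertex potential as a function of the logarithms of the norms. -/
noncomputable def expPotential {T l p C : ℝ} (B : BumpFunctions T l p C) (y : Fin 3 → ℝ) : ℝ :=
  vertexPotential B fun n => Real.exp (y n)

theorem SortedPoint.vertexPotential_eventuallyEq (hx : SortedPoint T l x i j k)
    (hp : Admissible T l p C) (B : BumpFunctions T l p C) :
    expPotential B =ᶠ[𝓝 x] logPotential B i j k := by
  have hij := hx.ne_ij
  have hik := hx.ne_ik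
  have hjk := hx.ne_jk
  have lt : ∀ a b : Fin 3, x a < x b → ∀ᶠ y in 𝓝 x, y a < y b := fun a b h =>
    (continuous_apply a).continuousAt.eventually_lt (continuous_apply b).continuousAt h
  rcases hx.le_ji.eq_or_lt with h1 | h1 <;> rcases hx.le_kj.eq_or_lt with h2 | h2
  · have hx' := hx.swap_left h1.symm
    have hx'' := hx.swap_right h2.symm
    -- At a triple tie all six orders occur nearby; they are reached from `i, j, k` by chains of
    -- adjacent transpositions.
    filter_upwards [hx.eventually_swap_left hp B h1.symm, hx.eventually_swap_right hp B h2.symm,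
      hx'.eventually_swap_right hp B (h1.symm.trans h2.symm),
      hx''.eventually_swap_left hp B (h1.symm.trans h2.symm),
      (hx'.swap_right (h1.symm.trans h2.symm)).eventually_swap_left hp B h2.symm]
      with y e1 e2 e3 e4 e5
    rcases le_total (y j) (y i) with a | a <;> rcases le_total (y k) (y j) with b | b <;>
      rcases le_total (y k) (y i) with c | c
    · exact vertexPotential_exp B hij hik hjk a b
    · exact vertexPotential_exp B hij hik hjk a b
    · rw [expPotential, vertexPotential_exp B hik hij hjk.symm c b, e2]
    · rw [expPotential, vertexPotential_exp B hik.symm hjk.symm hij c a, e2, e4]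
    · rw [expPotential, vertexPotential_exp B hij.symm hjk hik a c, e1]
    · rw [expPotential, vertexPotential_exp B hjk hij.symm hik.symm b c, e1, e3]
    · rw [expPotential, vertexPotential_exp B hjk.symm hik.symm hij.symm b a, e1, e3, e5]
    · rw [expPotential, vertexPotential_exp B hjk.symm hik.symm hij.symm b a, e1, e3, e5]
  · filter_upwards [hx.eventually_swap_left hp B h1.symm, lt k j h2, lt k i (h1 ▸ h2)]
      with y e1 b c
    rcases le_total (y j) (y i) with a | a
    · exact vertexPotential_exp B hij hik hjk a b.le
    · rw [expPotential, vertexPotential_exp B hij.symm hjk hik a c.le, e1]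
  · filter_upwards [hx.eventually_swap_right hp B h2.symm, lt j i h1, lt k i (h2 ▸ h1)]
      with y e2 a c
    rcases le_total (y k) (y j) with b | b
    · exact vertexPotential_exp B hij hik hjk a.le b
    · rw [expPotential, vertexPotential_exp B hik hij hjk.symm c.le b, e2]
  · filter_upwards [lt j i h1, lt k j h2] with y a b
    exact vertexPotential_exp B hij hik hjk a.le b.le

end

/-! ### The rotation vector at a vertex -/

/-- The logarithms `y` of the norms at points over `|v₀| = T ^ l` where the vertex coordinates are
used. -/
structure InVertexRegion (T l : ℝ) (y : Fin 3 → ℝ) : Prop where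
  le_log : ∀ n, y n + Real.log T ≤ 0
  sum_eq : y 0 + y 1 + y 2 = l * Real.log T

theorem add_add_eq_of_ne (f : Fin 3 → ℝ) {i j k : Fin 3} (hij : i ≠ j) (hik : i ≠ k)
    (hjk : j ≠ k) : f i + f j + f k = f 0 + f 1 + f 2 := by
  fin_cases i <;> fin_cases j <;> fin_cases k <;> simp_all <;> ring

theorem exists_others (s : Fin 3) : ∃ i j : Fin 3, i ≠ j ∧ i ≠ s ∧ j ≠ s ∧
    ∀ n, n = i ∨ n = j ∨ n = s := by
  revert s; decide

section

variable {T l p C : ℝ} {y w : Fin 3 → ℝ}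

theorem InVertexRegion.exists_sortedPoint (hy : InVertexRegion T l y) {s : Fin 3}
    (hs : ∀ n, y s ≤ y n) :
    ∃ i j, SortedPoint T l y i j s ∧ ∀ n, n = i ∨ n = j ∨ n = s := by
  obtain ⟨i, j, hij, his, hjs, hall⟩ := exists_others s
  rcases le_total (y j) (y i) with h | h
  · exact ⟨i, j, ⟨hij, his, hjs, h, hs j, hy.le_log i,
      by rw [← hy.sum_eq]; exact add_add_eq_of_ne y hij his hjs⟩, hall⟩
  · exact ⟨j, i, ⟨hij.symm, hjs, his, h, hs i, hy.le_log j,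
      by rw [← hy.sum_eq]; exact add_add_eq_of_ne y hij.symm hjs his⟩, fun n => by
        rcases hall n with h | h | h <;> simp [h]⟩

theorem exists_forall_le (y : Fin 3 → ℝ) : ∃ s, ∀ n, y s ≤ y n := by
  obtain ⟨s, -, hs⟩ := Finset.exists_min_image Finset.univ y ⟨0, Finset.mem_univ _⟩
  exact ⟨s, fun n => hs n (Finset.mem_univ _)⟩

theorem secondDeriv_congr {E : Type*} [NormedAddCommGroup E] [NormedSpace ℝ E] {f g : E → ℝ}
    {x : E} (h : f =ᶠ[𝓝 x] g) : secondDeriv f x = secondDeriv g x :=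
  (h.fderiv (𝕜 := ℝ)).fderiv_eq

theorem TwiceDiffAt.congr {E : Type*} [NormedAddCommGroup E] [NormedSpace ℝ E] {f g : E → ℝ}
    {x : E} (hg : TwiceDiffAt g x) (h : f =ᶠ[𝓝 x] g) : TwiceDiffAt f x :=
  ((⟨hg, rfl, rfl, rfl, rfl⟩ : HasJet g x 0 0 _ _ _ _).congr h).twice

theorem InVertexRegion.twiceDiffAt (hy : InVertexRegion T l y) (hp : Admissible T l p C)
    (B : BumpFunctions T l p C) : TwiceDiffAt (expPotential B) y := by
  obtain ⟨s, hs⟩ := exists_forall_le y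
  obtain ⟨i, j, hx, -⟩ := hy.exists_sortedPoint hs
  exact (hx.twiceDiffAt hp B).congr (hx.vertexPotential_eventuallyEq hp B)

theorem InVertexRegion.secondDeriv_pos (hy : InVertexRegion T l y) (hp : Admissible T l p C)
    (B : BumpFunctions T l p C) (hw : w 0 + w 1 + w 2 = 0) (hw0 : w ≠ 0) :
    0 < secondDeriv (expPotential B) y w w := by
  obtain ⟨s, hs⟩ := exists_forall_le y
  obtain ⟨i, j, hx, hall⟩ := hy.exists_sortedPoint hs
  have hsum : w i + w j + w s = 0 := by
    rw [add_add_eq_of_ne w hx.ne_ij hx.ne_ik hx.ne_jk, hw]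
  rw [secondDeriv_congr (hx.vertexPotential_eventuallyEq hp B)]
  refine lt_of_lt_of_le ?_ (hx.le_secondDeriv hp B hsum)
  have ha := sqNorm_pos hp.T_pos y i
  have hb := sqNorm_pos hp.T_pos y j
  by_contra! hle
  have h1 := mul_nonneg ha.le (sq_nonneg (w i))
  have h2 := mul_nonneg hb.le (sq_nonneg (w j))
  have hi : w i = 0 := by
    have : sqNorm T y i * w i ^ 2 = 0 := by linarith
    simpa [ha.ne'] using this
  have hj : w j = 0 := by
    have : sqNorm T y j * w j ^ 2 = 0 := by linarith
    simpa [hb.ne'] using this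
  apply hw0
  ext n
  rcases hall n with rfl | rfl | rfl
  · exact hi
  · exact hj
  · rw [Pi.zero_apply]; linarith

/-- `U` is the vector of angular velocities of the horizontal lift of the loop in the base. -/
structure IsRotationVector (H : (Fin 3 → ℝ) →L[ℝ] (Fin 3 → ℝ) →L[ℝ] ℝ) (U : Fin 3 → ℝ) :
    Prop where
  sum_eq : U 0 + U 1 + U 2 = 1
  orthogonal : ∀ w : Fin 3 → ℝ, w 0 + w 1 + w 2 = 0 → H U w = 0

/-- Existence is a square linear system: prescribe the sum and the pairings with a basis of the
plane. A vector in the kernel lies in the plane and is orthogonal to itself, so positivity makes the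
system invertible. -/
theorem exists_isRotationVector {H : (Fin 3 → ℝ) →L[ℝ] (Fin 3 → ℝ) →L[ℝ] ℝ}
    (hH : ∀ w : Fin 3 → ℝ, w 0 + w 1 + w 2 = 0 → w ≠ 0 → 0 < H w w) :
    ∃ U, IsRotationVector H U := by
  let h1 : Fin 3 → ℝ := ![1, 0, -1]
  let h2 : Fin 3 → ℝ := ![0, 1, -1]
  have hspan : ∀ w : Fin 3 → ℝ, w 0 + w 1 + w 2 = 0 → w = w 0 • h1 + w 1 • h2 := by
    intro w hw
    ext n
    fin_cases n <;> simp [h1, h2]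
    linarith
  let L : (Fin 3 → ℝ) →ₗ[ℝ] (Fin 3 → ℝ) :=
    { toFun := fun u => ![u 0 + u 1 + u 2, H u h1, H u h2]
      map_add' := by
        intro u v; ext n; fin_cases n <;> simp; ring
      map_smul' := by
        intro c u; ext n; fin_cases n <;> simp; ring }
  have horth : ∀ u, H u h1 = 0 → H u h2 = 0 →
      ∀ w : Fin 3 → ℝ, w 0 + w 1 + w 2 = 0 → H u w = 0 := by
    intro u e1 e2 w hw
    rw [hspan w hw, map_add, map_smul, map_smul, e1, e2]
    simp
  have hinj : Function.Injective L := by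
    rw [← LinearMap.ker_eq_bot, LinearMap.ker_eq_bot']
    intro u hu
    have e0 : u 0 + u 1 + u 2 = 0 := congrFun hu 0
    have e1 : H u h1 = 0 := congrFun hu 1
    have e2 : H u h2 = 0 := congrFun hu 2
    by_contra hne
    exact (hH u e0 hne).ne' (horth u e1 e2 u e0)
  obtain ⟨U, hU⟩ := LinearMap.injective_iff_surjective.1 hinj ![1, 0, 0]
  exact ⟨U, congrFun hU 0, horth U (congrFun hU 1) (congrFun hU 2)⟩

theorem single_sum (s : Fin 3) : (Pi.single s (1 : ℝ) : Fin 3 → ℝ) 0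
    + (Pi.single s (1 : ℝ) : Fin 3 → ℝ) 1 + (Pi.single s (1 : ℝ) : Fin 3 → ℝ) 2 = 1 := by
  fin_cases s <;> simp

/-- This identity drives both corner statements: the left side is controlled from below by
positivity, the right side from above because the potential depends little on a small coordinate. -/
theorem IsRotationVector.secondDeriv_sub {H : (Fin 3 → ℝ) →L[ℝ] (Fin 3 → ℝ) →L[ℝ] ℝ}
    {U : Fin 3 → ℝ} (hU : IsRotationVector H U) (s : Fin 3) :
    H (U - Pi.single s 1) (U - Pi.single s 1) = -H (Pi.single s 1) (U - Pi.single s 1) := by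
  have h := hU.orthogonal (U - Pi.single s 1) (by
    have := hU.sum_eq
    have := single_sum s
    simp only [Pi.sub_apply]
    linarith)
  rw [map_sub H, _root_.sub_apply, h, zero_sub]

theorem InVertexRegion.rotation_of_inTile (hy : InVertexRegion T l y) (hp : Admissible T l p C)
    (B : BumpFunctions T l p C) {s : Fin 3} {U : Fin 3 → ℝ}
    (hU : IsRotationVector (secondDeriv (expPotential B) y) U)
    (hs : InTile B (fun n => Real.exp (y n)) s) : U = Pi.single s 1 := by
  obtain ⟨i, j, hx, hall⟩ := hy.exists_sortedPoint fun n => Real.exp_le_exp.1 (hs.1 n)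
  set t : Fin 3 → ℝ := U - Pi.single s 1 with ht
  have hsum : t 0 + t 1 + t 2 = 0 := by
    have := hU.sum_eq
    have := single_sum s
    simp only [ht, Pi.sub_apply]
    linarith
  obtain ⟨e1, e2, e3⟩ := hi_mid_lo_eq (r := fun n => Real.exp (y n)) hx.ne_ij hx.ne_ik hx.ne_jk
    (Real.exp_le_exp.2 hx.le_ji) (Real.exp_le_exp.2 hx.le_kj)
  have hd := hs.2.1
  have hθ := hs.2.2
  rw [radialVar, turning, e1, e2, e3] at hd
  rw [angularVar, e1, e2, e3] at hθ
  have h0 := hx.secondDeriv_last_eq_zero hp B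
    (w := t) (by rw [add_add_eq_of_ne _ hx.ne_ij hx.ne_ik hx.ne_jk, hsum]) hd hθ
  have h1 := hU.secondDeriv_sub s
  rw [← secondDeriv_congr (hx.vertexPotential_eventuallyEq hp B)] at h0
  rw [← ht, h0] at h1
  by_contra hne
  have := hy.secondDeriv_pos hp B hsum (sub_ne_zero.2 hne)
  linarith

theorem InVertexRegion.rotation_of_dominates (hy : InVertexRegion T l y)
    (hp : Admissible T l p C) (B : BumpFunctions T l p C) {s : Fin 3} {U : Fin 3 → ℝ}
    (hU : IsRotationVector (secondDeriv (expPotential B) y) U) {K : ℝ} (hK : 1 ≤ K)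
    (hs : Dominates K (fun n => Real.exp (y n)) s) (n : Fin 3) :
    |U n - (Pi.single s 1 : Fin 3 → ℝ) n| ≤ 808 / K ^ 2 := by
  have hKs : ∀ m, m ≠ s → K * Real.exp (y s) ≤ Real.exp (y m) := by
    intro m hm
    have := hs m hm
    rw [← div_eq_mul_inv, div_le_iff₀ (Real.exp_pos _), inv_mul_eq_div,
      le_div_iff₀ (Real.exp_pos _)] at this
    exact this
  have hmin : ∀ m, y s ≤ y m := by
    intro m
    by_cases hm : m = s
    · rw [hm]
    · apply Real.exp_le_exp.1
      nlinarith [hKs m hm, Real.exp_pos (y s)]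
  obtain ⟨i, j, hx, hall⟩ := hy.exists_sortedPoint hmin
  set t : Fin 3 → ℝ := U - Pi.single s 1 with ht
  have hsum : t i + t j + t s = 0 := by
    rw [add_add_eq_of_ne _ hx.ne_ij hx.ne_ik hx.ne_jk]
    have := hU.sum_eq
    have := single_sum s
    simp only [ht, Pi.sub_apply]
    linarith
  have h1 := hU.secondDeriv_sub s
  rw [← ht, secondDeriv_congr (hx.vertexPotential_eventuallyEq hp B)] at h1
  have h2 := hx.le_secondDeriv hp B hsum
  have h3 := (abs_le.1 (hx.abs_secondDeriv_last_le hp B hsum)).1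
  have ho := hx.ordered hp
  have hcb : K ^ 2 * sqNorm T y s ≤ sqNorm T y j := by
    have := hKs j hx.ne_jk
    have h0 : 0 ≤ T * (K * Real.exp (y s)) := by have := hp.T_pos; positivity
    rw [sqNorm, sqNorm]
    calc K ^ 2 * (T * Real.exp (y s)) ^ 2 = (T * (K * Real.exp (y s))) ^ 2 := by ring
      _ ≤ _ := pow_le_pow_left₀ h0 (mul_le_mul_of_nonneg_left this hp.T_pos.le) 2
  set S := |t i| + |t j| with hS
  have hS0 : 0 ≤ S := by positivity
  have hSsq : S ^ 2 ≤ 2 * (t i ^ 2 + t j ^ 2) := by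
    rw [hS, ← sq_abs (t i), ← sq_abs (t j)]
    nlinarith [sq_nonneg (|t i| - |t j|)]
  have hb := ho.tb_pos
  -- The constant is `8 · 101`: the quadratic form is at least `tb S² / 8` and the linear term at
  -- most `101 tc S`. One power of `S` then cancels, leaving `S ≤ 808 tc / tb`.
  have h4 : sqNorm T y j * S ^ 2 ≤ 808 * (sqNorm T y s * S) := by
    have a1 := mul_le_mul_of_nonneg_right ho.tb_le (sq_nonneg (t i))
    have a2 := mul_le_mul_of_nonneg_left hSsq hb.le
    linarith
  have hKS : K ^ 2 * S ≤ 808 := by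
    rcases hS0.eq_or_lt with h | h
    · rw [← h]; norm_num
    · have hc := ho.tc_pos
      have h5 : K ^ 2 * sqNorm T y s * S ^ 2 ≤ sqNorm T y j * S ^ 2 :=
        mul_le_mul_of_nonneg_right hcb (sq_nonneg S)
      refine le_of_mul_le_mul_right ?_ (mul_pos hc h)
      linarith
  have hfin : S ≤ 808 / K ^ 2 := by
    rw [le_div_iff₀ (by positivity)]; linarith
  refine le_trans ?_ hfin
  change |t n| ≤ S
  rcases hall n with rfl | rfl | rfl
  · rw [hS]; linarith [abs_nonneg (t j)]
  · rw [hS]; linarith [abs_nonneg (t i)]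
  · rw [show t n = -(t i + t j) by linarith, abs_neg]
    exact abs_add_le _ _

end

/-! ### Charts -/

theorem ne_zero_of_norm_v0 {P : Pt} {a : ℝ} (ha : 0 < a) (h : ‖v0 P‖ = a) : ∀ j, P j ≠ 0 := by
  have h0 : v0 P ≠ 0 := by
    intro h1
    rw [h1, norm_zero] at h
    linarith
  have h1 := left_ne_zero_of_mul h0
  intro j
  fin_cases j
  · exact left_ne_zero_of_mul h1
  · exact right_ne_zero_of_mul h1
  · exact right_ne_zero_of_mul h0

theorem log_norm_v0 {Q : Pt} (hQ : ∀ j, Q j ≠ 0) :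
    Real.log ‖v0 Q‖ = logNorms Q 0 + logNorms Q 1 + logNorms Q 2 := by
  have h : ∀ j, ‖Q j‖ ≠ 0 := fun j => norm_ne_zero_iff.2 (hQ j)
  rw [v0, norm_mul, norm_mul, Real.log_mul (mul_ne_zero (h 0) (h 1)) (h 2),
    Real.log_mul (h 0) (h 1)]
  rfl

theorem exp_logNorms {Q : Pt} (hQ : ∀ j, Q j ≠ 0) (n : Fin 3) :
    Real.exp (logNorms Q n) = ‖Q n‖ :=
  Real.exp_log (norm_pos_iff.2 (hQ n))

/-- The sum of the coordinates. -/
noncomputable def sumCLM : (Fin 3 → ℝ) →L[ℝ] ℝ :=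
  ContinuousLinearMap.proj (R := ℝ) (φ := fun _ : Fin 3 => ℝ) 0
    + ContinuousLinearMap.proj (R := ℝ) (φ := fun _ : Fin 3 => ℝ) 1
    + ContinuousLinearMap.proj (R := ℝ) (φ := fun _ : Fin 3 => ℝ) 2

theorem sumCLM_apply (y : Fin 3 → ℝ) : sumCLM y = y 0 + y 1 + y 2 := rfl

/-- `A` is a change of coordinates that acts on the logarithms of the norms by the affine map
`y ↦ M y + k`, which preserves their sum, up to a constant, and acts by `ε` on vectors of sum
zero. -/
structure IsChart (A : Pt → Pt) (M : (Fin 3 → ℝ) →L[ℝ] (Fin 3 → ℝ)) (k : Fin 3 → ℝ) (ε : ℝ) :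
    Prop where
  logNorms_eq : ∀ Q, (∀ j, Q j ≠ 0) → logNorms (A Q) = M (logNorms Q) + k
  ne_zero : ∀ Q, (∀ j, Q j ≠ 0) → ∀ j, A Q j ≠ 0
  sum_eq : ∀ v, sumCLM (M v) = sumCLM v
  on_ker : ∀ w, sumCLM w = 0 → M w = ε • w
  sign_ne_zero : ε ≠ 0

/-- The linear part of the changes of coordinates. -/
noncomputable def chartCLM (ε : ℝ) (a : Fin 3 → ℝ) : (Fin 3 → ℝ) →L[ℝ] (Fin 3 → ℝ) :=
  ε • ContinuousLinearMap.id ℝ _ + sumCLM.smulRight a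

theorem chartCLM_apply (ε : ℝ) (a y : Fin 3 → ℝ) : chartCLM ε a y = ε • y + sumCLM y • a := rfl

theorem chartCLM_apply_apply (ε : ℝ) (a y : Fin 3 → ℝ) (j : Fin 3) :
    chartCLM ε a y j = ε * y j + (y 0 + y 1 + y 2) * a j := rfl

theorem sumCLM_chartCLM {ε : ℝ} {a : Fin 3 → ℝ} (h : ε + sumCLM a = 1) (y : Fin 3 → ℝ) :
    sumCLM (chartCLM ε a y) = sumCLM y := by
  rw [chartCLM_apply, map_add, map_smul, map_smul, smul_eq_mul, smul_eq_mul]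
  linear_combination sumCLM y * h

theorem chartCLM_of_sum_eq_zero {ε : ℝ} {a y : Fin 3 → ℝ} (h : sumCLM y = 0) :
    chartCLM ε a y = ε • y := by
  rw [chartCLM_apply, h, zero_smul, add_zero]

theorem isChart_deck {T : ℝ} (hT : 0 < T) (m n : ℤ) :
    IsChart (deck T m n) (chartCLM 1 ![m, n, -(m + n)])
      ((3 * Real.log T) • ![(m : ℝ), n, -(m + n)]) 1 where
  logNorms_eq Q hQ := by
    have h : ∀ j, ‖Q j‖ ≠ 0 := fun j => norm_ne_zero_iff.2 (hQ j)
    have hv : ‖v0 Q‖ ≠ 0 := by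
      simp only [v0, norm_mul]
      exact mul_ne_zero (mul_ne_zero (h 0) (h 1)) (h 2)
    have hs := log_norm_v0 hQ
    have hTv : ‖(T : ℂ) ^ 3 * v0 Q‖ = T ^ 3 * ‖v0 Q‖ := by
      rw [norm_mul, norm_pow, Complex.norm_real, Real.norm_of_nonneg hT.le]
    have hpos : T ^ 3 * ‖v0 Q‖ ≠ 0 := mul_ne_zero (pow_pos hT 3).ne' hv
    have key : ∀ (e : ℤ) (z : ℂ), ‖z‖ ≠ 0 → Real.log ‖((T : ℂ) ^ 3 * v0 Q) ^ e * z‖ =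
        e * (3 * Real.log T + (logNorms Q 0 + logNorms Q 1 + logNorms Q 2)) + Real.log ‖z‖ := by
      intro e z hz
      rw [norm_mul, norm_zpow, hTv, Real.log_mul (zpow_ne_zero _ hpos) hz, Real.log_zpow,
        Real.log_mul (pow_pos hT 3).ne' hv, hs, Real.log_pow]
      push_cast
      ring
    ext j
    rw [Pi.add_apply, Pi.smul_apply, chartCLM_apply_apply]
    fin_cases j
    · refine (key m (Q 0) (h 0)).trans ?_
      simp [logNorms]; ring
    · refine (key n (Q 1) (h 1)).trans ?_
      simp [logNorms]; ring
    · refine (key (-(m + n)) (Q 2) (h 2)).trans ?_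
      simp [logNorms]; ring
  ne_zero Q hQ j := by
    have hT' : (T : ℂ) ≠ 0 := Complex.ofReal_ne_zero.2 hT.ne'
    have hv : v0 Q ≠ 0 := mul_ne_zero (mul_ne_zero (hQ 0) (hQ 1)) (hQ 2)
    have h : (T : ℂ) ^ 3 * v0 Q ≠ 0 := mul_ne_zero (pow_ne_zero 3 hT') hv
    fin_cases j
    · exact mul_ne_zero (zpow_ne_zero _ h) (hQ 0)
    · exact mul_ne_zero (zpow_ne_zero _ h) (hQ 1)
    · exact mul_ne_zero (zpow_ne_zero _ h) (hQ 2)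
  sum_eq := sumCLM_chartCLM (by rw [sumCLM_apply]; simp)
  on_ker _ := chartCLM_of_sum_eq_zero
  sign_ne_zero := one_ne_zero

/-- Inverting the coordinates acts by `-1` on vectors of sum zero; the factors `v₀` in the first two
coordinates contribute the sum times `(1, 1, 0)`. -/
theorem isChart_tripleChart {T : ℝ} (hT : 0 < T) :
    IsChart (tripleChart T) (chartCLM (-1) ![1, 1, 0])
      ((Real.log T) • ![(1 : ℝ), 1, -2]) (-1) where
  logNorms_eq Q hQ := by
    have h : ∀ j, ‖Q j‖ ≠ 0 := fun j => norm_ne_zero_iff.2 (hQ j)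
    have hv : ‖v0 Q‖ ≠ 0 := by
      simp only [v0, norm_mul]
      exact mul_ne_zero (mul_ne_zero (h 0) (h 1)) (h 2)
    have hs := log_norm_v0 hQ
    have key : ∀ z : ℂ, ‖z‖ ≠ 0 → Real.log ‖(T : ℂ) * v0 Q * z⁻¹‖ =
        Real.log T + (logNorms Q 0 + logNorms Q 1 + logNorms Q 2) - Real.log ‖z‖ := by
      intro z hz
      rw [norm_mul, norm_mul, norm_inv, Complex.norm_real, Real.norm_of_nonneg hT.le,
        Real.log_mul (mul_ne_zero hT.ne' hv) (inv_ne_zero hz), Real.log_mul hT.ne' hv, hs,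
        Real.log_inv]
      ring
    ext j
    rw [Pi.add_apply, Pi.smul_apply, chartCLM_apply_apply]
    fin_cases j
    · refine (key (Q 0) (h 0)).trans ?_
      simp [logNorms]; ring
    · refine (key (Q 1) (h 1)).trans ?_
      simp [logNorms]; ring
    · have : Real.log ‖((T : ℂ) ^ 2)⁻¹ * (Q 2)⁻¹‖ = -2 * Real.log T - Real.log ‖Q 2‖ := by
        rw [norm_mul, norm_inv, norm_inv, norm_pow, Complex.norm_real,
          Real.norm_of_nonneg hT.le, Real.log_mul (inv_ne_zero (pow_pos hT 2).ne')
          (inv_ne_zero (h 2)), Real.log_inv, Real.log_inv, Real.log_pow]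
        push_cast
        ring
      refine this.trans ?_
      simp [logNorms]; ring
  ne_zero Q hQ j := by
    have hT' : (T : ℂ) ≠ 0 := Complex.ofReal_ne_zero.2 hT.ne'
    have hv : v0 Q ≠ 0 := mul_ne_zero (mul_ne_zero (hQ 0) (hQ 1)) (hQ 2)
    fin_cases j
    · exact mul_ne_zero (mul_ne_zero hT' hv) (inv_ne_zero (hQ 0))
    · exact mul_ne_zero (mul_ne_zero hT' hv) (inv_ne_zero (hQ 1))
    · exact mul_ne_zero (inv_ne_zero (pow_ne_zero 2 hT')) (inv_ne_zero (hQ 2))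
  sum_eq := sumCLM_chartCLM (by rw [sumCLM_apply]; simp)
  on_ker _ := chartCLM_of_sum_eq_zero
  sign_ne_zero := by norm_num

theorem IsChart.comp {A A' : Pt → Pt} {M M' : (Fin 3 → ℝ) →L[ℝ] (Fin 3 → ℝ)} {k k' : Fin 3 → ℝ}
    {ε ε' : ℝ} (h' : IsChart A' M' k' ε') (h : IsChart A M k ε) :
    IsChart (fun Q => A' (A Q)) (M'.comp M) (M' k + k') (ε' * ε) where
  logNorms_eq Q hQ := by
    rw [h'.logNorms_eq _ (h.ne_zero Q hQ), h.logNorms_eq Q hQ, map_add, add_assoc]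
    rfl
  ne_zero Q hQ := h'.ne_zero _ (h.ne_zero Q hQ)
  sum_eq v := (h'.sum_eq _).trans (h.sum_eq v)
  on_ker w hw := by
    rw [ContinuousLinearMap.comp_apply, h.on_ker w hw, map_smul, h'.on_ker w hw, smul_smul,
      mul_comm]
  sign_ne_zero := mul_ne_zero h'.sign_ne_zero h.sign_ne_zero

section

variable {T l p C : ℝ}

theorem exists_isChart_localChart (hT : 0 < T) (l : ℝ) (P : Pt) :
    ∃ M k ε, IsChart (localChart T l P) M k ε := by
  unfold localChart
  split_ifs
  · exact ⟨_, _, _, isChart_deck hT _ _⟩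
  · exact ⟨_, _, _, (isChart_tripleChart hT).comp (isChart_deck hT _ _)⟩

theorem localChart_congr {P P' : Pt} (h : ∀ j, ‖P j‖ = ‖P' j‖) :
    localChart T l P = localChart T l P' := by
  have hd : ∀ m n : ℤ, ‖deck T m n P 2‖ = ‖deck T m n P' 2‖ := by
    intro m n
    simp [deck, v0, h]
  funext Q
  rw [localChart, localChart, hd, h 0, h 1]

theorem logNorms_congr {P P' : Pt} (h : ∀ j, ‖P j‖ = ‖P' j‖) : logNorms P = logNorms P' := by
  funext j
  rw [logNorms, logNorms, h j]

theorem cell_bounds {u : ℝ} (hp : Admissible T l p C) :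
    -1 ≤ Real.logb T u + (cell T l u) * (l + 3) ∧
      Real.logb T u + (cell T l u) * (l + 3) < l + 2 := by
  have hl : 0 < l + 3 := by linarith [hp.l_pos]
  have h1 := Int.floor_le ((Real.logb T u + 1) / (l + 3))
  have h2 := Int.lt_floor_add_one ((Real.logb T u + 1) / (l + 3))
  rw [le_div_iff₀ hl] at h1
  rw [div_lt_iff₀ hl] at h2
  rw [cell]
  push_cast
  constructor <;> linarith

/-- After translation `x` and `y` lie between `T ^ (l + 2)` and `1 / T`. If also `|z| ≤ 1 / T`
nothing is left to show. Otherwise `|x'''| = T ^ (l + 1) / |x| < 1 / T`, likewise for `y'''`, and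
`|z'''| = T⁻² / |z| < 1 / T`. -/
theorem inVertexRegion_localChart (hp : Admissible T l p C) {P : Pt} (hP : ‖v0 P‖ = T ^ l) :
    InVertexRegion T l (logNorms (localChart T l P P)) := by
  have hT := hp.T_pos
  have hL := hp.log_neg
  have hne := ne_zero_of_norm_v0 (Real.rpow_pos_of_pos hT l) hP
  have hsum := log_norm_v0 hne
  rw [hP, Real.log_rpow hT] at hsum
  set m := cell T l ‖P 0‖
  set n := cell T l ‖P 1‖
  have hc := isChart_deck hT m n
  have hnz := hc.ne_zero P hne
  have hd := hc.logNorms_eq P hne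
  have e0 : logNorms (deck T m n P) 0 = logNorms P 0 + m * ((l + 3) * Real.log T) := by
    rw [hd, Pi.add_apply, chartCLM_apply, sumCLM_apply, ← hsum]; simp; ring
  have e1 : logNorms (deck T m n P) 1 = logNorms P 1 + n * ((l + 3) * Real.log T) := by
    rw [hd, Pi.add_apply, chartCLM_apply, sumCLM_apply, ← hsum]; simp; ring
  have es : sumCLM (logNorms (deck T m n P)) = l * Real.log T := by
    rw [sumCLM_apply, ← log_norm_v0 hnz]
    have : v0 (deck T m n P) = v0 P := by
      have hT' : (T : ℂ) ≠ 0 := Complex.ofReal_ne_zero.2 hT.ne'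
      have hv : v0 P ≠ 0 := mul_ne_zero (mul_ne_zero (hne 0) (hne 1)) (hne 2)
      have h : (T : ℂ) ^ 3 * v0 P ≠ 0 := mul_ne_zero (pow_ne_zero 3 hT') hv
      have h3 : ((T : ℂ) ^ 3 * v0 P) ^ m * ((T : ℂ) ^ 3 * v0 P) ^ n *
          ((T : ℂ) ^ 3 * v0 P) ^ (-(m + n)) = 1 := by
        rw [← zpow_add₀ h, ← zpow_add₀ h, add_neg_cancel, zpow_zero]
      calc v0 (deck T m n P) = (((T : ℂ) ^ 3 * v0 P) ^ m * ((T : ℂ) ^ 3 * v0 P) ^ n *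
          ((T : ℂ) ^ 3 * v0 P) ^ (-(m + n))) * (P 0 * P 1 * P 2) := by
            simp only [deck, v0, Matrix.cons_val]; ring
        _ = v0 P := by rw [h3, one_mul]; rfl
    rw [this, hP, Real.log_rpow hT]
  have b : ∀ u : ℝ, Real.log u + cell T l u * ((l + 3) * Real.log T) ≤ -Real.log T ∧
      (l + 2) * Real.log T < Real.log u + cell T l u * ((l + 3) * Real.log T) := by
    intro u
    obtain ⟨h1, h2⟩ := cell_bounds (u := u) hp
    have e : Real.log u = Real.logb T u * Real.log T := by
      rw [Real.logb, div_mul_cancel₀ _ hL.ne]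
    rw [e]
    constructor
    · have := mul_le_mul_of_nonpos_right h1 hL.le; linarith
    · have := mul_lt_mul_of_neg_right h2 hL; linarith
  obtain ⟨b0, b0'⟩ := b ‖P 0‖
  obtain ⟨b1, b1'⟩ := b ‖P 1‖
  change logNorms P 0 + m * _ ≤ _ at b0
  change logNorms P 1 + n * _ ≤ _ at b1
  change _ < logNorms P 0 + m * _ at b0'
  change _ < logNorms P 1 + n * _ at b1'
  rw [← e0] at b0 b0'
  rw [← e1] at b1 b1'
  have hlogz : Real.log ‖deck T m n P 2‖ = logNorms (deck T m n P) 2 := rfl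
  unfold localChart
  split_ifs with h
  · have h' : logNorms (deck T m n P) 2 ≤ -Real.log T := by
      rw [← hlogz, ← Real.log_inv]
      exact Real.log_le_log (norm_pos_iff.2 (hnz 2)) h
    exact ⟨fun j => by fin_cases j <;> simp only [Fin.zero_eta, Fin.mk_one, Fin.reduceFinMk] <;>
      linarith, by rw [← sumCLM_apply, es]⟩
  · have h' : -Real.log T < logNorms (deck T m n P) 2 := by
      rw [← hlogz, ← Real.log_inv]
      exact Real.log_lt_log (inv_pos.2 hT) (not_le.1 h)
    have ht := isChart_tripleChart hT
    have hq := ht.logNorms_eq _ hnz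
    refine ⟨fun j => ?_, ?_⟩
    · rw [hq, Pi.add_apply, chartCLM_apply, es]
      fin_cases j <;> simp <;> linarith
    · rw [← sumCLM_apply, hq, map_add, ht.sum_eq, es, sumCLM_apply]
      simp; ring

/-! ### The symplectic form and the horizontal distribution -/

/-- The Kähler potential in the chart with affine part `y ↦ M y + k`, as a function of the
logarithms of the norms. -/
noncomputable def chartPotential (B : BumpFunctions T l p C) (κ : ℝ)
    (M : (Fin 3 → ℝ) →L[ℝ] (Fin 3 → ℝ)) (k y : Fin 3 → ℝ) : ℝ :=
  expPotential B (M y + k) + κ * Real.exp (2 * sumCLM y)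

/-- The pullback `κ |v₀|²` from the base is a function of the sum of the logarithms, so its mixed
derivative with a vector of sum zero vanishes. Hence `κ` is irrelevant. -/
theorem hasJet_chartPotential {B : BumpFunctions T l p C} {κ : ℝ}
    {M : (Fin 3 → ℝ) →L[ℝ] (Fin 3 → ℝ)} {k y : Fin 3 → ℝ}
    (h : TwiceDiffAt (expPotential B) (M y + k)) (v : Fin 3 → ℝ) {w : Fin 3 → ℝ}
    (hw : sumCLM w = 0) :
    ∃ a a₁ a₂, HasJet (chartPotential B κ M k) y v w a a₁ a₂
      (secondDeriv (expPotential B) (M y + k) (M v) (M w)) := by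
  have h1 : HasJet (fun y => expPotential B (M y + k)) y v w _ _ _ _ :=
    HasJet.comp_affine M k ⟨h, rfl, rfl, rfl, rfl⟩
  have h2 := ((HasJet.affine sumCLM 0 y v w).const_mul 2).comp_contDiff Real.contDiff_exp
  have h3 := (h1.add (h2.const_mul κ)).congr (g := chartPotential B κ M k)
    (.of_forall fun y => by simp [chartPotential])
  exact ⟨_, _, _, h3.congr_coeff rfl rfl rfl (by rw [hw]; ring)⟩

theorem symplecticForm_eq (hp : Admissible T l p C) (B : BumpFunctions T l p C) (κ : ℝ) {P : Pt}
    (hP : ‖v0 P‖ = T ^ l) {M : (Fin 3 → ℝ) →L[ℝ] (Fin 3 → ℝ)} {k : Fin 3 → ℝ} {ε : ℝ}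
    (hA : IsChart (localChart T l P) M k ε) (v w : Pt) :
    symplecticForm B κ P v w =
      (secondDeriv (chartPotential B κ M k) (logNorms P)
          (rePart (logVel P v)) (imPart (logVel P w))
        - secondDeriv (chartPotential B κ M k) (logNorms P)
          (imPart (logVel P v)) (rePart (logVel P w))) / (4 * Real.pi) := by
  have hne := ne_zero_of_norm_v0 (Real.rpow_pos_of_pos hp.T_pos l) hP
  have hreg := inVertexRegion_localChart hp hP
  rw [hA.logNorms_eq P hne] at hreg
  obtain ⟨_, _, _, hj⟩ := hasJet_chartPotential (κ := κ) (hreg.twiceDiffAt hp B) 0 (map_zero sumCLM)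
  rw [← kahlerForm_comp_logNorms hne hj.twice, symplecticForm]
  apply kahlerForm_congr
  filter_upwards [eventually_ne_zero hne] with Q hQ
  rw [chartPotential, ← hA.logNorms_eq Q hQ, expPotential]
  have e1 : (fun n => Real.exp (logNorms (localChart T l P Q) n)) = norms (localChart T l P Q) := by
    funext n
    exact exp_logNorms (hA.ne_zero Q hQ) n
  have e2 : Real.exp (2 * sumCLM (logNorms Q)) = ‖v0 Q‖ ^ 2 := by
    have hv : 0 < ‖v0 Q‖ := norm_pos_iff.2 (mul_ne_zero (mul_ne_zero (hQ 0) (hQ 1)) (hQ 2))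
    rw [sumCLM_apply, ← log_norm_v0 hQ, two_mul, Real.exp_add, Real.exp_log hv, sq]
  rw [e1, e2]

theorem fderiv_v0 {P : Pt} (hP : ∀ j, P j ≠ 0) (w : Pt) :
    fderiv ℂ v0 P w = v0 P * (logVel P w 0 + logVel P w 1 + logVel P w 2) := by
  have h : ∀ j : Fin 3, HasFDerivAt (fun Q : Pt => Q j)
      (ContinuousLinearMap.proj (R := ℂ) (φ := fun _ : Fin 3 => ℂ) j) P := fun j =>
    (ContinuousLinearMap.proj (R := ℂ) (φ := fun _ : Fin 3 => ℂ) j).hasFDerivAt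
  have h1 : HasFDerivAt v0 _ P := ((h 0).mul (h 1)).mul (h 2)
  rw [h1.fderiv]
  have h0 := hP 0
  have h1 := hP 1
  have h2 := hP 2
  simp [v0, logVel]
  field_simp
  ring

/-- Testing against the fibre tangents `w j * P j` and `i * w j * P j`, with real `w` of sum zero,
separates the imaginary and the real part of `v`. The sign `ε` and the factor `4 π` do not affect
vanishing. -/
theorem isHorizontal_iff (hp : Admissible T l p C) (B : BumpFunctions T l p C) (κ : ℝ) {P : Pt}
    (hP : ‖v0 P‖ = T ^ l) {M : (Fin 3 → ℝ) →L[ℝ] (Fin 3 → ℝ)} {k : Fin 3 → ℝ} {ε : ℝ}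
    (hA : IsChart (localChart T l P) M k ε) (v : Pt) :
    IsHorizontal B κ P v ↔ ∀ w, sumCLM w = 0 →
      secondDeriv (expPotential B) (M (logNorms P) + k) (M (rePart (logVel P v))) w = 0 ∧
      secondDeriv (expPotential B) (M (logNorms P) + k) (M (imPart (logVel P v))) w = 0 := by
  have hT := hp.T_pos
  have hne := ne_zero_of_norm_v0 (Real.rpow_pos_of_pos hT l) hP
  have hv0 : v0 P ≠ 0 := mul_ne_zero (mul_ne_zero (hne 0) (hne 1)) (hne 2)
  have hreg := inVertexRegion_localChart hp hP
  rw [hA.logNorms_eq P hne] at hreg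
  have hD : ∀ v w, sumCLM w = 0 → secondDeriv (chartPotential B κ M k) (logNorms P) v w =
      ε * secondDeriv (expPotential B) (M (logNorms P) + k) (M v) w := by
    intro v w hw
    obtain ⟨_, _, _, hj⟩ := hasJet_chartPotential (κ := κ) (hreg.twiceDiffAt hp B) v hw
    rw [hj.mixed, hA.on_ker w hw, map_smul, smul_eq_mul]
  have hpi := Real.pi_pos
  constructor
  · intro h w hw
    have hre : ∀ c : ℂ, logVel P (fun j => c * (w j : ℂ) * P j) = fun j => c * (w j : ℂ) := by
      intro c
      funext j
      simp [logVel, hne j]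
    have hker : ∀ c : ℂ, fderiv ℂ v0 P (fun j => c * (w j : ℂ) * P j) = 0 := by
      intro c
      rw [fderiv_v0 hne, hre c]
      rw [sumCLM_apply] at hw
      have : (w 0 : ℂ) + w 1 + w 2 = 0 := by exact_mod_cast hw
      linear_combination v0 P * c * this
    have h1 := h _ (hker Complex.I)
    have h2 := h _ (hker 1)
    have r1 : rePart (fun j => Complex.I * (w j : ℂ)) = 0 := by funext j; simp [rePart]
    have i1 : imPart (fun j => Complex.I * (w j : ℂ)) = w := by funext j; simp [imPart]
    have r2 : rePart (fun j => 1 * (w j : ℂ)) = w := by funext j; simp [rePart]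
    have i2 : imPart (fun j => 1 * (w j : ℂ)) = 0 := by funext j; simp [imPart]
    rw [symplecticForm_eq hp B κ hP hA, hre, r1, i1, map_zero, sub_zero, hD _ _ hw,
      div_eq_zero_iff] at h1
    rw [symplecticForm_eq hp B κ hP hA, hre, r2, i2, map_zero, zero_sub, hD _ _ hw,
      div_eq_zero_iff, neg_eq_zero] at h2
    exact ⟨(mul_eq_zero.1 (h1.resolve_right (by positivity))).resolve_left hA.sign_ne_zero,
      (mul_eq_zero.1 (h2.resolve_right (by positivity))).resolve_left hA.sign_ne_zero⟩
  · intro h w hw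
    rw [fderiv_v0 hne] at hw
    have hs := (mul_eq_zero.1 hw).resolve_left hv0
    have hre : sumCLM (rePart (logVel P w)) = 0 := by
      simpa [sumCLM_apply, rePart] using congrArg Complex.re hs
    have him : sumCLM (imPart (logVel P w)) = 0 := by
      simpa [sumCLM_apply, imPart] using congrArg Complex.im hs
    rw [symplecticForm_eq hp B κ hP hA, hD _ _ him, hD _ _ hre, (h _ him).1, (h _ hre).2]
    simp

end

/-! ### Parallel transport -/

section

variable {T l p C : ℝ}

/-- `u` is the vector of angular velocities, in turns per turn, of the horizontal lift through `P`
of the rotation of the base. -/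
structure IsRotation (B : BumpFunctions T l p C) (κ : ℝ) (P : Pt) (u : Fin 3 → ℝ) : Prop where
  sum_eq : sumCLM u = 1
  horizontal : IsHorizontal B κ P fun j => Complex.I * u j * P j

theorem logVel_rotation {P : Pt} (hP : ∀ j, P j ≠ 0) (u : Fin 3 → ℝ) :
    logVel P (fun j => Complex.I * u j * P j) = fun j => Complex.I * (u j : ℂ) := by
  funext j
  simp [logVel, hP j]

theorem isRotation_iff (hp : Admissible T l p C) (B : BumpFunctions T l p C) (κ : ℝ) {P : Pt}
    (hP : ‖v0 P‖ = T ^ l) {M : (Fin 3 → ℝ) →L[ℝ] (Fin 3 → ℝ)} {k : Fin 3 → ℝ} {ε : ℝ}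
    (hA : IsChart (localChart T l P) M k ε) (u : Fin 3 → ℝ) :
    IsRotation B κ P u ↔
      IsRotationVector (secondDeriv (expPotential B) (M (logNorms P) + k)) (M u) := by
  have hne := ne_zero_of_norm_v0 (Real.rpow_pos_of_pos hp.T_pos l) hP
  have h := isHorizontal_iff hp B κ hP hA fun j => Complex.I * u j * P j
  have r : rePart (fun j => Complex.I * (u j : ℂ)) = 0 := by funext j; simp [rePart]
  have i : imPart (fun j => Complex.I * (u j : ℂ)) = u := by funext j; simp [imPart]
  rw [logVel_rotation hne, r, i, map_zero, map_zero] at h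
  constructor
  · rintro ⟨h1, h2⟩
    exact ⟨by rw [← sumCLM_apply, hA.sum_eq, h1], fun w hw => (h.1 h2 w hw).2⟩
  · rintro ⟨h1, h2⟩
    exact ⟨by rw [← hA.sum_eq, sumCLM_apply, h1], h.2 fun w hw => ⟨rfl, h2 w hw⟩⟩

/-- Chart and Hessian depend on the norms only. Therefore the angular velocities are constant along
an orbit of the torus. -/
theorem IsRotation.congr (hp : Admissible T l p C) {B : BumpFunctions T l p C} {κ : ℝ} {P P' : Pt}
    (hP : ‖v0 P‖ = T ^ l) (h : ∀ j, ‖P j‖ = ‖P' j‖) {u : Fin 3 → ℝ} (hu : IsRotation B κ P u) :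
    IsRotation B κ P' u := by
  obtain ⟨M, k, ε, hA⟩ := exists_isChart_localChart hp.T_pos l P
  have hP' : ‖v0 P'‖ = T ^ l := by
    rw [← hP]; simp [v0, h]
  have hA' := hA
  rw [localChart_congr h] at hA'
  rw [isRotation_iff hp B κ hP hA, logNorms_congr h] at hu
  rwa [isRotation_iff hp B κ hP' hA']

theorem exists_isRotation (hp : Admissible T l p C) (B : BumpFunctions T l p C) (κ : ℝ) {P : Pt}
    (hP : ‖v0 P‖ = T ^ l) : ∃ u, IsRotation B κ P u := by
  obtain ⟨M, k, ε, hA⟩ := exists_isChart_localChart hp.T_pos l P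
  have hne := ne_zero_of_norm_v0 (Real.rpow_pos_of_pos hp.T_pos l) hP
  have hreg := inVertexRegion_localChart hp hP
  rw [hA.logNorms_eq P hne] at hreg
  obtain ⟨U, hU⟩ := exists_isRotationVector fun w hw hw0 => hreg.secondDeriv_pos hp B hw hw0
  have he : sumCLM (Pi.single 0 1) = 1 := by
    rw [sumCLM_apply]; exact single_sum 0
  have hker : sumCLM (ε⁻¹ • (U - M (Pi.single 0 1))) = 0 := by
    rw [map_smul, map_sub, hA.sum_eq, he, sumCLM_apply, hU.sum_eq, sub_self, smul_zero]
  -- This is the preimage of `U` under `M`: any vector of sum `1` serves as base point, and the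
  -- remaining difference has sum zero, where `M` is multiplication by `ε`.
  refine ⟨Pi.single 0 1 + ε⁻¹ • (U - M (Pi.single 0 1)), ?_⟩
  rw [isRotation_iff hp B κ hP hA, map_add, hA.on_ker _ hker, smul_smul,
    mul_inv_cancel₀ hA.sign_ne_zero, one_smul, add_sub_cancel]
  exact hU

theorem eq_zero_of_orthogonal (hp : Admissible T l p C) (B : BumpFunctions T l p C) {P : Pt}
    (hP : ‖v0 P‖ = T ^ l) {M : (Fin 3 → ℝ) →L[ℝ] (Fin 3 → ℝ)} {k : Fin 3 → ℝ} {ε : ℝ}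
    (hA : IsChart (localChart T l P) M k ε) {q : Fin 3 → ℝ} (hq : sumCLM q = 0)
    (h : secondDeriv (expPotential B) (M (logNorms P) + k) (M q) q = 0) : q = 0 := by
  have hne := ne_zero_of_norm_v0 (Real.rpow_pos_of_pos hp.T_pos l) hP
  have hreg := inVertexRegion_localChart hp hP
  rw [hA.logNorms_eq P hne] at hreg
  by_contra hq0
  have hpos := hreg.secondDeriv_pos hp B hq hq0
  rw [hA.on_ker q hq, map_smul, _root_.smul_apply, smul_eq_mul] at h
  exact hpos.ne' ((mul_eq_zero.1 h).resolve_left hA.sign_ne_zero)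

theorem IsRotation.unique (hp : Admissible T l p C) {B : BumpFunctions T l p C} {κ : ℝ} {P : Pt}
    (hP : ‖v0 P‖ = T ^ l) {u u' : Fin 3 → ℝ} (hu : IsRotation B κ P u)
    (hu' : IsRotation B κ P u') : u = u' := by
  obtain ⟨M, k, ε, hA⟩ := exists_isChart_localChart hp.T_pos l P
  have hs : sumCLM (u - u') = 0 := by rw [map_sub, hu.sum_eq, hu'.sum_eq, sub_self]
  rw [isRotation_iff hp B κ hP hA] at hu hu'
  refine sub_eq_zero.1 (eq_zero_of_orthogonal hp B hP hA hs ?_)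
  rw [map_sub M, map_sub (secondDeriv _ _), _root_.sub_apply, hu.orthogonal _ hs,
    hu'.orthogonal _ hs, sub_zero]

/-- The horizontal vectors over the rotation of the base are given by real angular velocities. -/
theorem IsHorizontal.eq_rotation (hp : Admissible T l p C) {B : BumpFunctions T l p C} {κ : ℝ}
    {P : Pt} (hP : ‖v0 P‖ = T ^ l) {v : Pt} (hv : IsHorizontal B κ P v)
    (hsum : fderiv ℂ v0 P v = Complex.I * v0 P) :
    ∃ u, IsRotation B κ P u ∧ v = fun j => Complex.I * u j * P j := by
  obtain ⟨M, k, ε, hA⟩ := exists_isChart_localChart hp.T_pos l P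
  have hne := ne_zero_of_norm_v0 (Real.rpow_pos_of_pos hp.T_pos l) hP
  have hv0 : v0 P ≠ 0 := mul_ne_zero (mul_ne_zero (hne 0) (hne 1)) (hne 2)
  rw [fderiv_v0 hne, mul_comm] at hsum
  have hs := mul_right_cancel₀ hv0 hsum
  have hre : sumCLM (rePart (logVel P v)) = 0 := by
    simpa [sumCLM_apply, rePart] using congrArg Complex.re hs
  have him : sumCLM (imPart (logVel P v)) = 1 := by
    simpa [sumCLM_apply, imPart] using congrArg Complex.im hs
  -- The real part has sum zero and is orthogonal to all such vectors, itself included, so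
  -- positivity kills it.
  have h0 : rePart (logVel P v) = 0 := eq_zero_of_orthogonal hp B hP hA hre
    (((isHorizontal_iff hp B κ hP hA v).1 hv _ hre).1)
  have e : v = fun j => Complex.I * (imPart (logVel P v) j : ℂ) * P j := by
    funext j
    have h1 : v j / P j = Complex.I * (imPart (logVel P v) j : ℂ) := by
      have h2 : (v j / P j).re = 0 := congrFun h0 j
      apply Complex.ext
      · simp [h2]
      · simp [imPart, logVel]
    rw [← h1, div_mul_cancel₀ _ (hne j)]
  exact ⟨_, ⟨him, e ▸ hv⟩, e⟩

theorem norm_exp_I_mul (a : ℝ) : ‖Complex.exp (a * Complex.I)‖ = 1 :=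
  Complex.norm_exp_ofReal_mul_I a

/-- The orbit of `P` under rotation with angular velocities `u`. -/
noncomputable def rotate (P : Pt) (u : Fin 3 → ℝ) (t : ℝ) : Pt :=
  fun j => P j * Complex.exp ((u j * t : ℝ) * Complex.I)

theorem norm_rotate (P : Pt) (u : Fin 3 → ℝ) (t : ℝ) (j : Fin 3) : ‖rotate P u t j‖ = ‖P j‖ := by
  rw [rotate, norm_mul, Complex.norm_exp_ofReal_mul_I, mul_one]

theorem hasDerivAt_exp_mul_I (a t : ℝ) :
    HasDerivAt (fun t : ℝ => Complex.exp ((a * t : ℝ) * Complex.I))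
      (Complex.I * a * Complex.exp ((a * t : ℝ) * Complex.I)) t := by
  have h : HasDerivAt (fun t : ℝ => ((a * t : ℝ) : ℂ) * Complex.I) ((a : ℂ) * Complex.I) t := by
    have h1 : HasDerivAt (fun t : ℝ => a * t) a t := by
      simpa using (hasDerivAt_id t).const_mul a
    exact h1.ofReal_comp.mul_const _
  convert h.cexp using 1
  ring

theorem hasDerivAt_rotate (P : Pt) (u : Fin 3 → ℝ) (t : ℝ) :
    HasDerivAt (rotate P u) (fun j => Complex.I * u j * rotate P u t j) t := by
  rw [hasDerivAt_pi]
  intro j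
  refine ((hasDerivAt_exp_mul_I (u j) t).const_mul (P j)).congr_deriv ?_
  simp only [rotate]
  ring

theorem IsRotation.isHorizontalLift (hp : Admissible T l p C) {B : BumpFunctions T l p C} {κ : ℝ}
    {P : Pt} (hP : ‖v0 P‖ = T ^ l) {u : Fin 3 → ℝ} (hu : IsRotation B κ P u) :
    IsHorizontalLift B κ P (rotate P u) where
  start := by
    funext j
    simp [rotate]
  covers t _ := by
    have h1 := hu.sum_eq
    rw [sumCLM_apply] at h1
    have : Complex.exp ((u 0 * t : ℝ) * Complex.I) * Complex.exp ((u 1 * t : ℝ) * Complex.I)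
        * Complex.exp ((u 2 * t : ℝ) * Complex.I) = Complex.exp (t * Complex.I) := by
      rw [← Complex.exp_add, ← Complex.exp_add]
      congr 1
      have h2 : (u 0 : ℂ) + u 1 + u 2 = 1 := by exact_mod_cast h1
      push_cast
      linear_combination (t : ℂ) * Complex.I * h2
    rw [← this]
    simp only [v0, rotate]
    ring
  horizontal t _ := ⟨_, (hasDerivAt_rotate P u t).hasDerivWithinAt,
    (hu.congr hp hP fun j => (norm_rotate P u t j).symm).horizontal⟩

/-- No uniqueness theorem for differential equations is needed. Each velocity is `i u' γ` with `u'`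
real, so the norms are constant; then `u' = u`, and `γ j * exp(-i u_j t)` has derivative zero. -/
theorem IsHorizontalLift.eq_rotate (hp : Admissible T l p C) {B : BumpFunctions T l p C} {κ : ℝ}
    {P : Pt} (hP : ‖v0 P‖ = T ^ l) {u : Fin 3 → ℝ} (hu : IsRotation B κ P u) {γ : ℝ → Pt}
    (hγ : IsHorizontalLift B κ P γ) :
    ∀ t ∈ Set.Icc 0 (2 * Real.pi), γ t = rotate P u t := by
  have hpi : (0 : ℝ) < 2 * Real.pi := by positivity
  have huniq := uniqueDiffOn_Icc hpi
  have hnorm : ∀ t ∈ Set.Icc 0 (2 * Real.pi), ‖v0 (γ t)‖ = T ^ l := by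
    intro t ht
    rw [hγ.covers t ht, norm_mul, norm_exp_I_mul, one_mul, hP]
  have key : ∀ t ∈ Set.Icc 0 (2 * Real.pi), ∃ u', IsRotation B κ (γ t) u' ∧
      HasDerivWithinAt γ (fun j => Complex.I * u' j * γ t j) (Set.Icc 0 (2 * Real.pi)) t := by
    intro t ht
    obtain ⟨v, hv, hh⟩ := hγ.horizontal t ht
    have hne := ne_zero_of_norm_v0 (Real.rpow_pos_of_pos hp.T_pos l) (hnorm t ht)
    have hd : DifferentiableAt ℂ v0 (γ t) := by
      unfold v0; fun_prop
    have h1 := (hd.hasFDerivAt.restrictScalars ℝ).comp_hasDerivWithinAt t hv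
    have h2 : HasDerivWithinAt (v0 ∘ γ) (Complex.I * v0 (γ t)) (Set.Icc 0 (2 * Real.pi)) t := by
      have h3 := ((hasDerivAt_exp_mul_I 1 t).mul_const (v0 P)).hasDerivWithinAt
        (s := Set.Icc 0 (2 * Real.pi))
      refine (h3.congr_of_mem (fun s hs => ?_) ht).congr_deriv ?_
      · rw [Function.comp_apply, hγ.covers s hs, one_mul]
      · rw [hγ.covers t ht]; push_cast; rw [one_mul]; ring
    have h4 : fderiv ℂ v0 (γ t) v = Complex.I * v0 (γ t) := (huniq t ht).eq_deriv _ h1 h2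
    obtain ⟨u', hu', rfl⟩ := hh.eq_rotation hp (hnorm t ht) h4
    exact ⟨u', hu', hv⟩
  have hconst : ∀ t ∈ Set.Icc 0 (2 * Real.pi), ∀ j, ‖γ t j‖ = ‖P j‖ := by
    intro t ht j
    have hder : ∀ s ∈ Set.Icc 0 (2 * Real.pi),
        HasDerivWithinAt (fun s => ‖γ s j‖ ^ 2) 0 (Set.Icc 0 (2 * Real.pi)) s := by
      intro s hs
      obtain ⟨u', -, hd⟩ := key s hs
      have := (hasDerivWithinAt_pi.1 hd j).norm_sq
      refine this.congr_deriv ?_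
      have hre : (Complex.I * (u' j : ℂ) * γ s j * (starRingEnd ℂ) (γ s j)).re = 0 := by
        rw [mul_assoc, Complex.mul_conj]
        simp
      rw [Complex.inner, hre, mul_zero]
    have := constant_of_derivWithin_zero (fun s hs => (hder s hs).differentiableWithinAt)
      (fun s hs => (hder s (Set.Ico_subset_Icc_self hs)).derivWithin
        (huniq s (Set.Ico_subset_Icc_self hs))) t ht
    rw [hγ.start] at this
    exact (pow_left_inj₀ (norm_nonneg _) (norm_nonneg _) two_ne_zero).1 this
  intro t ht
  funext j
  have hder : ∀ s ∈ Set.Icc 0 (2 * Real.pi),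
      HasDerivWithinAt (fun s => γ s j * Complex.exp ((-u j * s : ℝ) * Complex.I)) 0
        (Set.Icc 0 (2 * Real.pi)) s := by
    intro s hs
    obtain ⟨u', hu', hd⟩ := key s hs
    have : u' = u := (hu'.congr hp (hnorm s hs) (hconst s hs)).unique hp hP hu
    subst this
    refine ((hasDerivWithinAt_pi.1 hd j).mul
      (hasDerivAt_exp_mul_I (-u' j) s).hasDerivWithinAt).congr_deriv ?_
    push_cast
    ring
  have := constant_of_derivWithin_zero (fun s hs => (hder s hs).differentiableWithinAt)
    (fun s hs => (hder s (Set.Ico_subset_Icc_self hs)).derivWithin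
      (huniq s (Set.Ico_subset_Icc_self hs))) t ht
  simp only [mul_zero, Complex.ofReal_zero, zero_mul, Complex.exp_zero, mul_one, hγ.start] at this
  rw [rotate, ← this, mul_assoc, ← Complex.exp_add, ← add_mul, ← Complex.ofReal_add, ← add_mul,
    neg_add_cancel, zero_mul, Complex.ofReal_zero, zero_mul, Complex.exp_zero, mul_one]

/-- A continuous choice of the argument along a rotation changes by the angle of rotation. -/
theorem angle_sub_eq {z : ℂ} (hz : z ≠ 0) {a τ : ℝ} (hτ : 0 ≤ τ) {θ : ℝ → ℝ}
    (hθ : ContinuousOn θ (Set.Icc 0 τ))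
    (h : ∀ t ∈ Set.Icc 0 τ, z * Complex.exp ((a * t : ℝ) * Complex.I) =
      ‖z‖ * Complex.exp (θ t * Complex.I)) : θ τ - θ 0 = τ * a := by
  -- The difference between the followed argument and the linear one takes values in `2π ℤ`; being
  -- continuous on an interval, it is constant.
  have hmaps : Set.MapsTo (fun t => θ t - θ 0 - a * t) (Set.Icc 0 τ)
      (AddSubgroup.zmultiples (2 * Real.pi) : Set ℝ) := by
    intro t ht
    have h0 := h 0 ⟨le_rfl, hτ⟩
    have h1 := h t ht
    simp only [mul_zero, Complex.ofReal_zero, zero_mul, Complex.exp_zero, mul_one] at h0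
    have hn : (‖z‖ : ℂ) ≠ 0 := by simpa using hz
    have e : Complex.exp ((θ t - θ 0 - a * t : ℝ) * Complex.I) = 1 := by
      have h2 : Complex.exp (θ 0 * Complex.I) * Complex.exp ((a * t : ℝ) * Complex.I) =
          Complex.exp (θ t * Complex.I) := by
        apply mul_left_cancel₀ hn
        rw [← mul_assoc, ← h0, h1]
      rw [← Complex.exp_add] at h2
      push_cast at h2 ⊢
      rw [show ((θ t : ℂ) - θ 0 - a * t) * Complex.I =
        θ t * Complex.I - (θ 0 * Complex.I + a * t * Complex.I) by ring, Complex.exp_sub, h2]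
      exact div_self (Complex.exp_ne_zero _)
    obtain ⟨n, hn⟩ := Complex.exp_eq_one_iff.1 e
    refine ⟨n, ?_⟩
    have h3 : ((θ t - θ 0 - a * t : ℝ) : ℂ) = (n * (2 * Real.pi) : ℝ) := by
      apply mul_right_cancel₀ Complex.I_ne_zero
      rw [hn]
      push_cast
      ring
    have h4 := Complex.ofReal_injective h3
    simp only [zsmul_eq_mul]
    exact h4.symm
  have hdisc : IsDiscrete (AddSubgroup.zmultiples (2 * Real.pi) : Set ℝ) := by
    rw [isDiscrete_iff_discreteTopology]
    exact inferInstanceAs (DiscreteTopology (AddSubgroup.zmultiples (2 * Real.pi)))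
  have := isPreconnected_Icc.constant_of_mapsTo hdisc
    ((hθ.sub continuousOn_const).sub (by fun_prop)) hmaps
    (Set.right_mem_Icc.2 hτ) (Set.left_mem_Icc.2 hτ)
  change θ τ - θ 0 - a * τ = θ 0 - θ 0 - a * 0 at this
  linarith

theorem IsRotation.monodromyShiftsBy (hp : Admissible T l p C) {B : BumpFunctions T l p C} {κ : ℝ}
    {P : Pt} (hP : ‖v0 P‖ = T ^ l) {u : Fin 3 → ℝ} (hu : IsRotation B κ P u) :
    MonodromyShiftsBy B κ P (u 0) (u 1) := by
  have hne := ne_zero_of_norm_v0 (Real.rpow_pos_of_pos hp.T_pos l) hP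
  have hpi : (0 : ℝ) ≤ 2 * Real.pi := by positivity
  refine ⟨⟨_, hu.isHorizontalLift hp hP⟩, fun γ hγ => ?_⟩
  have h := hγ.eq_rotate hp hP hu
  refine ⟨fun t ht j => by rw [h t ht, norm_rotate], fun θ₁ θ₂ c₁ c₂ h₁ h₂ => ⟨?_, ?_⟩⟩
  · refine angle_sub_eq (hne 0) hpi c₁ fun t ht => ?_
    have := h₁ t ht
    rwa [h t ht, norm_rotate] at this
  · refine angle_sub_eq (hne 1) hpi c₂ fun t ht => ?_
    have := h₂ t ht
    rwa [h t ht, norm_rotate] at this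

/-! ### The corners of the fundamental parallelogram -/

theorem cell_eq_zero (hp : Admissible T l p C) {r : ℝ} (h1 : T ^ (l + 2) < r) (h2 : r ≤ T⁻¹) :
    cell T l r = 0 := by
  have hT := hp.T_pos
  have hL := hp.log_neg
  have hl : 0 < l + 3 := by linarith [hp.l_pos]
  have hpos := Real.rpow_pos_of_pos hT (l + 2)
  have a1 := Real.log_lt_log hpos h1
  have a2 := Real.log_le_log (hpos.trans h1) h2
  rw [Real.log_rpow hT] at a1
  rw [Real.log_inv] at a2
  have b1 : Real.logb T r < l + 2 := by
    rw [Real.logb, div_lt_iff_of_neg hL]; exact a1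
  have b2 : -1 ≤ Real.logb T r := by
    rw [Real.logb, le_div_iff_of_neg hL]; linarith
  rw [cell, neg_eq_zero, Int.floor_eq_zero_iff]
  constructor
  · apply div_nonneg <;> linarith
  · rw [div_lt_one hl]; linarith

theorem deck_zero (T : ℝ) (Q : Pt) : deck T 0 0 Q = Q := by
  funext j
  fin_cases j <;> simp [deck]

theorem localChart_parallelogram (hp : Admissible T l p C) {P : Pt} (hP : P ∈ parallelogram T l) :
    localChart T l P = if ‖P 2‖ ≤ T⁻¹ then id else tripleChart T := by
  funext Q
  rw [localChart, cell_eq_zero hp hP.2.1 hP.2.2.1, cell_eq_zero hp hP.2.2.2.1 hP.2.2.2.2,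
    deck_zero, deck_zero]
  split_ifs <;> rfl

theorem isChart_id : IsChart id (chartCLM 1 0) 0 1 where
  logNorms_eq Q _ := by rw [chartCLM_apply, one_smul, smul_zero, add_zero, add_zero, id]
  ne_zero _ hQ := hQ
  sum_eq := sumCLM_chartCLM (by simp)
  on_ker _ := chartCLM_of_sum_eq_zero
  sign_ne_zero := one_ne_zero

/-- If the rotation vector at a vertex is close to the unit vector of a dominating coordinate, then
the monodromy in the corners is close to the expected value. -/
theorem IsRotation.shift_near (hp : Admissible T l p C) {B : BumpFunctions T l p C} {κ ε : ℝ}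
    {P : Pt} (hP : P ∈ parallelogram T l) {u : Fin 3 → ℝ} (hu : IsRotation B κ P u)
    {S : (Fin 3 → ℝ) → Fin 3 → Prop}
    (hS : ∀ y U s, InVertexRegion T l y → IsRotationVector (secondDeriv (expPotential B) y) U →
      S (fun n => Real.exp (y n)) s → ∀ n, |U n - (Pi.single s 1 : Fin 3 → ℝ) n| ≤ ε)
    {c : Corner} (hc : c.Contains T S P) :
    |u 0 - c.shift.1| ≤ ε ∧ |u 1 - c.shift.2| ≤ ε := by
  have hT := hp.T_pos
  have hne := ne_zero_of_norm_v0 (Real.rpow_pos_of_pos hT l) hP.1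
  have hloc := localChart_parallelogram hp hP
  have hreg := inVertexRegion_localChart hp hP.1
  have hsum := hu.sum_eq
  have hsum' : u 0 + u 1 + u 2 = 1 := hsum
  have lower : ‖P 2‖ ≤ T⁻¹ → ∀ s, S (norms P) s →
      ∀ n, |u n - (Pi.single s 1 : Fin 3 → ℝ) n| ≤ ε := by
    intro h s hs
    rw [if_pos h] at hloc
    have hA : IsChart (localChart T l P) (chartCLM 1 0) 0 1 := by rw [hloc]; exact isChart_id
    rw [isRotation_iff hp B κ hP.1 hA] at hu
    rw [hA.logNorms_eq P hne] at hreg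
    have e : (fun n => Real.exp ((chartCLM 1 0 (logNorms P) + 0) n)) = norms P := by
      funext n
      rw [← isChart_id.logNorms_eq P hne]
      exact exp_logNorms hne n
    have eu : chartCLM 1 0 u = u := by
      rw [chartCLM_apply, one_smul, smul_zero, add_zero]
    rw [eu] at hu
    exact hS _ _ s hreg hu (e ▸ hs)
  have upper : T⁻¹ < ‖P 2‖ → ∀ s, S (norms (tripleChart T P)) s →
      |1 - u 0 - (Pi.single s 1 : Fin 3 → ℝ) 0| ≤ ε ∧
        |1 - u 1 - (Pi.single s 1 : Fin 3 → ℝ) 1| ≤ ε := by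
    intro h s hs
    rw [if_neg (not_le.2 h)] at hloc
    have ht := isChart_tripleChart hT
    have hA := ht
    rw [← hloc] at hA
    rw [isRotation_iff hp B κ hP.1 hA] at hu
    rw [hA.logNorms_eq P hne] at hreg
    have e : (fun n => Real.exp ((chartCLM (-1) ![1, 1, 0] (logNorms P) +
        Real.log T • ![(1 : ℝ), 1, -2]) n)) = norms (tripleChart T P) := by
      funext n
      rw [← ht.logNorms_eq P hne]
      exact exp_logNorms (ht.ne_zero P hne) n
    have := hS _ _ s hreg hu (e ▸ hs)
    have h0 := this 0
    have h1 := this 1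
    -- At the opposite vertex the rotation vector starts with `(1 - u 0, 1 - u 1)`. This reflection
    -- turns `e_0`, `e_1`, `e_2` into the shifts `(0, 1)`, `(1, 0)`, `(1, 1)`.
    have e0 : chartCLM (-1) ![1, 1, 0] u 0 = 1 - u 0 := by
      rw [chartCLM_apply_apply, hsum']; simp; ring
    have e1 : chartCLM (-1) ![1, 1, 0] u 1 = 1 - u 1 := by
      rw [chartCLM_apply_apply, hsum']; simp; ring
    rw [e0] at h0
    rw [e1] at h1
    exact ⟨h0, h1⟩
  cases c with
  | upperRight =>
    have := lower hc.1 2 hc.2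
    simpa [Corner.shift] using And.intro (this 0) (this 1)
  | right =>
    rcases hc with hc | hc
    · have := lower hc.1 1 hc.2
      simpa [Corner.shift] using And.intro (this 0) (this 1)
    · have := upper hc.1 0 hc.2
      rw [abs_sub_comm (u 1)]
      simpa [Corner.shift] using this
  | left =>
    rcases hc with hc | hc
    · have := lower hc.1 0 hc.2
      simpa [Corner.shift] using And.intro (this 0) (this 1)
    · have := upper hc.1 1 hc.2
      rw [abs_sub_comm (u 0)]
      simpa [Corner.shift] using this
  | lowerLeft =>
    have := upper hc.1 2 hc.2
    rw [abs_sub_comm (u 0), abs_sub_comm (u 1)]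
    simpa [Corner.shift] using this

/-- `p > 16` makes `1/4 - 4/p` positive, so a large `l` achieves `gap`. The bound on `C` forces `T₀`
to be exponentially small in `|C|`, which makes the bump functions slow enough whatever `l` is. -/
theorem exists_admissible (p C : ℝ) (hp : 16 < p) :
    ∃ T₀ l₀ : ℝ, 0 < T₀ ∧ ∀ T l, 0 < T → T < T₀ → l₀ ≤ l → Admissible T l p C := by
  have hg : 0 < 1 / 4 - 4 / p := by
    have : 4 / p < 1 / 4 := by rw [div_lt_div_iff₀ (by linarith) (by norm_num)]; linarith
    linarith
  refine ⟨min (1 / 100) (Real.exp (-(1000000 * |C| + 1))), max p (1 / (1 / 4 - 4 / p)),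
    lt_min (by norm_num) (Real.exp_pos _), fun T l hT hT₀ hl => ?_⟩
  have h1 : Real.log T < -(1000000 * |C| + 1) := by
    rw [Real.log_lt_iff_lt_exp hT]
    exact hT₀.trans_le (min_le_right _ _)
  have h2 := abs_nonneg C
  exact
  { T_pos := hT
    T_le := (hT₀.trans_le (min_le_left _ _)).le
    p_gt := hp
    p_le := (le_max_left _ _).trans hl
    gap := by
      have := (le_max_right _ _).trans hl
      rwa [div_le_iff₀ hg] at this
    one_le_log := by linarith
    C_le := by linarith [le_abs_self C] }

/-- A point with two given coordinate norms. -/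
noncomputable def modelPoint (T l r s : ℝ) : Pt := ![(r : ℂ), (s : ℂ), ((T ^ l / (r * s) : ℝ) : ℂ)]

theorem norm_modelPoint (hT : 0 < T) {P : Pt} (hP : ‖v0 P‖ = T ^ l) (j : Fin 3) :
    ‖P j‖ = ‖modelPoint T l ‖P 0‖ ‖P 1‖ j‖ := by
  have hne := ne_zero_of_norm_v0 (Real.rpow_pos_of_pos hT l) hP
  have h0 := norm_pos_iff.2 (hne 0)
  have h1 := norm_pos_iff.2 (hne 1)
  fin_cases j
  · simp [modelPoint]
  · simp [modelPoint]
  · have : ‖((T ^ l / (‖P 0‖ * ‖P 1‖) : ℝ) : ℂ)‖ = ‖P 2‖ := by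
      rw [Complex.norm_real, Real.norm_of_nonneg (by positivity), ← hP, v0, norm_mul, norm_mul,
        mul_div_cancel_left₀ _ (mul_pos h0 h1).ne']
    exact this.symm

end

end GenusTwoMirror

/-! ### Proof of the theorem -/

theorem lemma4p9 (p C : ℝ) (hp : 16 < p) :
    ∃ (T₀ l₀ : ℝ) (K : ℝ → ℝ), 0 < T₀ ∧
      ∀ (T l κ : ℝ), 0 < T → T < T₀ → l₀ ≤ l →
      ∀ B : GenusTwoMirror.BumpFunctions T l p C,
      ∃ f₁ f₂ : ℝ → ℝ → ℝ,
        (∀ P ∈ GenusTwoMirror.parallelogram T l,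
          GenusTwoMirror.MonodromyShiftsBy B κ P (f₁ ‖P 0‖ ‖P 1‖) (f₂ ‖P 0‖ ‖P 1‖)) ∧
        (∀ P ∈ GenusTwoMirror.parallelogram T l, ∀ c : GenusTwoMirror.Corner,
          c.Contains T (GenusTwoMirror.InTile B) P →
          (f₁ ‖P 0‖ ‖P 1‖, f₂ ‖P 0‖ ‖P 1‖) = c.shift) ∧
        (∀ ε > 0, ∀ P ∈ GenusTwoMirror.parallelogram T l, ∀ c : GenusTwoMirror.Corner,
          c.Contains T (GenusTwoMirror.Dominates (K ε)) P →
          |f₁ ‖P 0‖ ‖P 1‖ - c.shift.1| ≤ ε ∧ |f₂ ‖P 0‖ ‖P 1‖ - c.shift.2| ≤ ε) := by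
  obtain ⟨T₀, l₀, hT₀, hadm⟩ := GenusTwoMirror.exists_admissible p C hp
  -- `K = 1 + 808 / ε` is at least `1`, so `K² ≥ K ≥ 808 / ε` and the error `808 / K²` is at most
  -- `ε`.
  refine ⟨T₀, l₀, fun ε => 1 + 808 / ε, hT₀, fun T l κ hT hTT hl B => ?_⟩
  have ha := hadm T l hT hTT hl
  -- The shifts must be functions of the norms, so the rotation vector is chosen at a model point
  -- with positive real coordinates and transferred to all points with the same norms.
  let f : ℝ → ℝ → Fin 3 → ℝ := fun r s =>
    Classical.epsilon (GenusTwoMirror.IsRotation B κ (GenusTwoMirror.modelPoint T l r s))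
  have hf : ∀ P ∈ GenusTwoMirror.parallelogram T l, GenusTwoMirror.IsRotation B κ P (f ‖P 0‖ ‖P 1‖) := by
    intro P hP
    have hn := GenusTwoMirror.norm_modelPoint hT hP.1
    obtain ⟨u, hu⟩ := GenusTwoMirror.exists_isRotation ha B κ hP.1
    have h := Classical.epsilon_spec (p := GenusTwoMirror.IsRotation B κ (GenusTwoMirror.modelPoint T l ‖P 0‖ ‖P 1‖))
      ⟨u, hu.congr ha hP.1 hn⟩
    refine GenusTwoMirror.IsRotation.congr ha ?_ (fun j => (hn j).symm) h
    rw [← hP.1]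
    simp only [GenusTwoMirror.v0, norm_mul, ← hn]
  refine ⟨fun r s => f r s 0, fun r s => f r s 1, fun P hP => (hf P hP).monodromyShiftsBy ha hP.1,
    fun P hP c hc => ?_, fun ε hε P hP c hc => ?_⟩
  -- Complete domination is the case of error `0`, because there the rotation vector is exactly a
  -- unit vector.
  · obtain ⟨h0, h1⟩ := (hf P hP).shift_near ha hP (ε := 0) (fun y U s hy hU hs n => by
      rw [hy.rotation_of_inTile ha B hU hs, sub_self, abs_zero]) hc
    rw [abs_nonpos_iff, sub_eq_zero] at h0 h1
    exact Prod.ext h0 h1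
  · refine (hf P hP).shift_near ha hP (fun y U s hy hU hs n => ?_) hc
    have hq : 0 < 808 / ε := by positivity
    refine (hy.rotation_of_dominates ha B hU (by linarith) hs n).trans ?_
    rw [div_le_iff₀ (by positivity)]
    have : 808 = ε * (808 / ε) := by field_simp
    nlinarith
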